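/- **Setting.** Let $q$ be a prime power and let $\tau$ be a primitive element of $\mathrm{GF}(q^3)$. Let $\ell_\infty$ be the line $z=0$ of $\mathrm{PG}(2,q^3)$ and $\Sigma_\infty$ the hyperplane $z=0$ of $\mathrm{PG}(6,q)$ (homogeneous coordinates $(x_0,x_1,x_2,y_0,y_1,y_2,z)$). Points of $\mathrm{PG}(2,q^3)$ and $\mathrm{PG}(6,q)$ not on $\ell_\infty$, $\Sigma_\infty$ are called affine. The Bruck–Bose map sends the affine point $(\alpha,\beta,1)$, where $\alpha=a_0+a_1\tau+a_2\tau^2$ and $\beta=b_0+b_1\tau+b_2\tau^2$ with $a_i,b_i\in\mathrm{GF}(q)$, to $\sigma(\alpha,\beta,1)=(a_0,a_1,a_2,b_0,b_1,b_2,1)$. A point $U=(\alpha,\beta,0)$ of $\ell_\infty$ corresponds to the plane $[U]=\{\sigma(\lambda\alpha,\lambda\beta,0):\lambda\in\mathrm{GF}(q^3)^{*}\}$ of $\Sigma_\infty$, called a spread element. For a set $X$ of affine points let $[X]=\sigma(X)$; the image of an affine point $P$ is again denoted $P$. A *transversal* of the spread is a line $g$ of the extension of $\Sigma_\infty$ to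 $\mathrm{GF}(q^3)$ that has no point in $\mathrm{PG}(6,q)$ and is such that the sets $\langle v,v^q,v^{q^2}\rangle\cap\mathrm{PG}(6,q)$, $v$ a point of $g$, are precisely the spread elements. A *special conic* is a non-degenerate conic in a spread element whose extension to $\mathrm{PG}(6,q^3)$ meets the transversals. A *special twisted cubic* is a twisted cubic, in a 3-space that meets $\Sigma_\infty$ in a spread element, whose extension to $\mathrm{PG}(6,q^3)$ meets the transversals. An *order-$q$-subplane* of $\mathrm{PG}(2,q^3)$ is a set of points that, with the lines joining two of its points, forms a projective plane of order $q$; its lines are regarded as sets of $q+1$ points of the subplane. Let $\mathscr B$ be an order-$q$-subplane that is tangent to $\ell_\infty$ at $T$, that is, $\mathscr B\cap\ell_\infty=\{T\}$. The *ruled surface* $[\mathscr B]$ is a ruled surface of $\mathrm{PG}(6,q)$ with a special conic directrix $\mathcal C$ in $[T]$ and a special twisted cubic directrix $\mathcal N$ in a 3-space about a spread element other than $[T]$; it consists of the points on the pairwise disjoint generator lines joining the points of $\mathcal C$ to their images under a projectivity from $\mathcal C$ to $\mathcal N$; its extension to $\mathrm{PG}(6,q^3)$ contains the transversals, and its affine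 points are the images under $\sigma$ of the affine points of $\mathscr B$. For an affine point $P$ of $\mathscr B$, the *tangent subspace* $P^\perp$ is the order-$q$-subplane containing the points in which the extensions to $\mathrm{PG}(2,q^3)$ of the lines of $\mathscr B$ through $P$ meet $\ell_\infty$ and containing the points of the line $PT\cap\mathscr B$ of $\mathscr B$; $[P^\perp]$ is the subspace of $\mathrm{PG}(6,q)$ spanned by the images of the affine points of $P^\perp$. **Statement.** Let $\mathscr B$ be an order-$q$-subplane of $\mathrm{PG}(2,q^3)$ tangent to $\ell_\infty$ at $T$, and let $P$ be an affine point of $\mathscr B$. Then the ruled surface $[\mathscr B]$ exists, the tangent subspace $P^\perp$ exists and is unique, and $[P^\perp]$ is a plane. Moreover: 1. There are exactly $q$ lines $\ell_1,\dots,\ell_q$ of $\mathscr B$ through $P$ and not through $T$. Their images $[\ell_1],\dots,[\ell_q]$ are distinct, and each $[\ell_i]$ is the set of points of a special twisted cubic. 2. There is exactly one line $m$ of $\mathscr B$ through $P$ and $T$, and the points of $[m\setminus\{T\}]$ are the affine points of a generator line of the ruled surface $[\mathscr B]$ through $P$. 3. For each $i=1,\dots,q$, the tangent line at $P$ to the twisted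 cubic $[\ell_i]$ (that is, to any special twisted cubic with point set $[\ell_i]$) lies in $[P^\perp]$. -/

import Mathlib

namespace BruckBose

/-! ### Projective spaces, points and subspaces

A projective subspace of `PG(n,k)` is a linear subspace `W` of `k^(n+1)`; a line is a subspace of
vector space dimension 2, a plane one of dimension 3, a 3-space one of dimension 4. -/

/-- The point set of the Desarguesian plane over `K`. -/
abbrev PG2 (K : Type*) [Field K] := Projectivization K (Fin 3 → K)

/-- The point set of `PG(6,F)`. -/
abbrev PG6 (F : Type*) [Field F] := Projectivization F (Fin 7 → F)

/-- The set of points of a projective subspace. -/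
def pts {k V : Type*} [Field k] [AddCommGroup V] [Module k V] (W : Submodule k V) :
    Set (Projectivization k V) :=
  {P | P.submodule ≤ W}

/-- The line at infinity `z = 0` of the plane over `K`. -/
def lineAtInfinity (K : Type*) [Field K] : Submodule K (Fin 3 → K) :=
  LinearMap.ker (LinearMap.proj (R := K) (φ := fun _ : Fin 3 => K) 2)

/-- The hyperplane `z = 0` of the six-dimensional projective space over `k`. -/
def hyperplaneAtInfinity (k : Type*) [Field k] : Submodule k (Fin 7 → k) :=
  LinearMap.ker (LinearMap.proj (R := k) (φ := fun _ : Fin 7 => k) 6)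

/-! ### Subplanes -/

/-- `L` is (the extension of) a line of the substructure with point set `B`: a line of the
plane that contains at least two points of `B`. The corresponding line of the substructure is the
point set `B ∩ pts L`. -/
def IsLineOf {K : Type*} [Field K] (B : Set (PG2 K)) (L : Submodule K (Fin 3 → K)) : Prop :=
  Module.finrank K L = 2 ∧ (B ∩ pts L).Nontrivial

/-- `B` is (the point set of) a subplane of order `q`: its points, together with the
lines joining two of them, form a projective plane of order `q`. That two points of `B` are joined
by a unique line of `B` is automatic. -/
structure IsSubplane {K : Type*} [Field K] (q : ℕ) (B : Set (PG2 K)) : Prop where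
  /-- two lines of `B` meet in a point of `B` -/
  meet : ∀ L M, IsLineOf B L → IsLineOf B M → L ≠ M → (B ∩ pts L ∩ pts M).Nonempty
  /-- `B` contains four points, no three of them collinear -/
  quadrangle : ∃ Q : Fin 4 → PG2 K, (∀ i, Q i ∈ B) ∧
    ∀ i j l, i ≠ j → i ≠ l → j ≠ l →
      ∀ L : Submodule K (Fin 3 → K), Module.finrank K L = 2 →
        ¬ (Q i ∈ pts L ∧ Q j ∈ pts L ∧ Q l ∈ pts L)
  /-- every line of `B` has exactly `q + 1` points of `B` -/
  order : ∀ L, IsLineOf B L → (B ∩ pts L).ncard = q + 1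

/-- `B` is tangent to the line at infinity at `T`. -/
def IsTangentAt {K : Type*} [Field K] (B : Set (PG2 K)) (T : PG2 K) : Prop :=
  B ∩ pts (lineAtInfinity K) = {T}

/-- `A` is the tangent subspace `P^⊥` of the point `P` of `B`, where `B` is tangent to the line at
infinity at `T`: a subplane of order `q` that contains the subline
`{ℓ ∩ ℓ_∞ | ℓ a line of B through P}` of `ℓ_∞` and the subline `PT ∩ B`. -/
structure IsTangentSubspace {K : Type*} [Field K] (q : ℕ) (B : Set (PG2 K)) (T P : PG2 K)
    (A : Set (PG2 K)) : Prop where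
  subplane : IsSubplane q A
  infinity : ∀ L, IsLineOf B L → P ∈ pts L → pts L ∩ pts (lineAtInfinity K) ⊆ A
  through : ∀ L, IsLineOf B L → P ∈ pts L → T ∈ pts L → B ∩ pts L ⊆ A

/-! ### The Bruck-Bose representation -/

section Representation

variable {F K : Type*} [Field F] [Field K] [Algebra F K]

/-- The inverse of the (generalised) Bruck-Bose map `σ`:
`(a₀,a₁,a₂,b₀,b₁,b₂,z) ↦ (a₀+a₁τ+a₂τ², b₀+b₁τ+b₂τ², z)`. -/
def bbInv (τ : K) : (Fin 7 → F) →ₗ[F] (Fin 3 → K) where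
  toFun x := ![x 0 • (1 : K) + x 1 • τ + x 2 • τ ^ 2, x 3 • (1 : K) + x 4 • τ + x 5 • τ ^ 2,
    algebraMap F K (x 6)]
  map_add' x y := by
    ext i
    fin_cases i <;> simp [add_smul] <;> abel
  map_smul' c x := by
    ext i
    fin_cases i <;> simp [Algebra.smul_def] <;> ring

/-- The subspace of `PG(6,F)` that represents a point `P` of the plane over `K`: for an affine point
`(α,β,1)` it is the single point `σ(α,β,1)`; for a point `(α,β,0)` at infinity it is
the spread element `{σ(cα,cβ,0) | c ∈ K}`. -/
def bb (τ : K) (P : PG2 K) : Submodule F (Fin 7 → F) :=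
  (P.submodule.restrictScalars F).comap (bbInv τ)

/-- The set of points of `PG(6,F)` that represents a point set `X`. It is used only for sets of
affine points, where it is the image `σ(X)`. -/
def bbSet (τ : K) (X : Set (PG2 K)) : Set (PG6 F) :=
  {x | ∃ P ∈ X, x ∈ pts (bb (F := F) τ P)}

/-- The subspace of `PG(6,F)` spanned by the points `σ(Q)`, for `Q` an affine point of `A`. If `A`
is a subplane of order `|F|` secant to the line at infinity, this is the plane `[A]`. -/
def bbSpan (τ : K) (A : Set (PG2 K)) : Submodule F (Fin 7 → F) :=
  ⨆ Q ∈ A \ pts (lineAtInfinity K), bb τ Q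

/-! ### The cubic extension and the transversals of the spread -/

/-- The embedding of `PG(6,F)` in `PG(6,K)`, on vectors. -/
def ext7 : (Fin 7 → F) →ₗ[F] (Fin 7 → K) := (Algebra.linearMap F K).compLeft (Fin 7)

variable (F) in
/-- Conjugation `v ↦ v^q`, where `q = |F|`, on the coordinate vectors of `PG(6,K)`. -/
noncomputable def conj7 (v : Fin 7 → K) : Fin 7 → K := fun i => v i ^ Nat.card F

variable (F) in
/-- The line `g` of `PG(6,K)` is a transversal line of the spread: it lies in the hyperplane at
infinity, has no point in `PG(6,F)`, and the planes `⟨v, v^q, v^(q²)⟩`, for `v` a point of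
`g`, meet `PG(6,F)` precisely in the spread elements. -/
structure IsTransversal (τ : K) (g : Submodule K (Fin 7 → K)) : Prop where
  line : Module.finrank K g = 2
  infinity : g ≤ hyperplaneAtInfinity K
  disjoint : ∀ x : Fin 7 → F, ext7 x ∈ g → x = 0
  spread : {W : Submodule F (Fin 7 → F) | ∃ v ∈ g, v ≠ 0 ∧
      W = ((Submodule.span K {v, conj7 F v, conj7 F (conj7 F v)}).restrictScalars F).comap ext7} =
    {W : Submodule F (Fin 7 → F) | ∃ U ∈ pts (lineAtInfinity K), W = bb τ U}

end Representation

/-! ### Conics, twisted cubics and ruled surfaces in parametric form -/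

/-- The point with parameter `(s : t)` of the conic with coefficient vectors `a`. -/
def conicPt {k : Type*} [Field k] (a : Fin 3 → Fin 7 → k) (s t : k) : Fin 7 → k :=
  s ^ 2 • a 0 + (s * t) • a 1 + t ^ 2 • a 2

/-- The point with parameter `(s : t)` of the twisted cubic with coefficient vectors `c`. -/
def cubicPt {k : Type*} [Field k] (c : Fin 4 → Fin 7 → k) (s t : k) : Fin 7 → k :=
  s ^ 3 • c 0 + (s ^ 2 * t) • c 1 + (s * t ^ 2) • c 2 + t ^ 3 • c 3

/-- The set of points of the twisted cubic with coefficient vectors `c`. -/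
def cubicPts {k : Type*} [Field k] (c : Fin 4 → Fin 7 → k) : Set (PG6 k) :=
  {x | ∃ s t : k, (s, t) ≠ 0 ∧ x.submodule = Submodule.span k {cubicPt c s t}}

/-- The tangent line to the twisted cubic at the point with parameter `(s : t)`: it is
spanned by the point and the two partial derivatives of the parametrisation there. (The point is
listed because in characteristic 3 it is not a combination of the partial derivatives.) -/
def cubicTangent {k : Type*} [Field k] (c : Fin 4 → Fin 7 → k) (s t : k) :
    Submodule k (Fin 7 → k) :=
  Submodule.span k {cubicPt c s t,
    (3 * s ^ 2) • c 0 + (2 * s * t) • c 1 + t ^ 2 • c 2,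
    s ^ 2 • c 1 + (2 * s * t) • c 2 + (3 * t ^ 2) • c 3}

/-- The generator line with parameter `(s : t)` of the ruled surface with conic directrix `a` and
twisted cubic directrix `c`: it joins the corresponding points of the directrices. The projectivity
between the directrices is equality of parameters, after a linear change of parameters on one of
them. -/
def generator {k : Type*} [Field k] (a : Fin 3 → Fin 7 → k) (c : Fin 4 → Fin 7 → k) (s t : k) :
    Submodule k (Fin 7 → k) :=
  Submodule.span k {conicPt a s t, cubicPt c s t}

/-- The set of points of the ruled surface. -/
def surfacePts {k : Type*} [Field k] (a : Fin 3 → Fin 7 → k) (c : Fin 4 → Fin 7 → k) :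
    Set (PG6 k) :=
  {x | ∃ s t : k, (s, t) ≠ 0 ∧ x ∈ pts (generator a c s t)}

section Special

variable {F K : Type*} [Field F] [Field K] [Algebra F K]

/-- `a` is (a parametrisation of) a special conic in the spread element `[U]`: a nondegenerate
conic whose extension to `PG(6,K)` meets the transversals of the spread. -/
structure IsSpecialConic (τ : K) (a : Fin 3 → Fin 7 → F) (U : PG2 K) : Prop where
  indep : LinearIndependent F a
  infinity : U ∈ pts (lineAtInfinity K)
  plane : Submodule.span F (Set.range a) = bb τ U
  special : ∀ g, IsTransversal F τ g →
    ∃ s t : K, (s, t) ≠ 0 ∧ conicPt (fun i => (ext7 (a i) : Fin 7 → K)) s t ∈ g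

/-- `c` is (a parametrisation of) a special twisted cubic in a 3-space about the spread element
`[U]`: the 3-space meets the hyperplane at infinity in `[U]`, and the extension of the cubic
to `PG(6,K)` meets the transversals of the spread. -/
structure IsSpecialCubic (τ : K) (c : Fin 4 → Fin 7 → F) (U : PG2 K) : Prop where
  indep : LinearIndependent F c
  infinity : U ∈ pts (lineAtInfinity K)
  about : Submodule.span F (Set.range c) ⊓ hyperplaneAtInfinity F = bb τ U
  special : ∀ g, IsTransversal F τ g →
    ∃ s t : K, (s, t) ≠ 0 ∧ cubicPt (fun i => (ext7 (c i) : Fin 7 → K)) s t ∈ g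

/-- The ruled surface with directrices `a` and `c` is the ruled surface `[B]` that
corresponds to the subplane `B` tangent to the line at infinity at `T`. -/
structure IsRuledSurfaceOf (τ : K) (B : Set (PG2 K)) (T : PG2 K)
    (a : Fin 3 → Fin 7 → F) (c : Fin 4 → Fin 7 → F) : Prop where
  /-- the conic directrix is a special conic in `[T]` -/
  conic : IsSpecialConic τ a T
  /-- the cubic directrix is a special twisted cubic in a 3-space about another spread element -/
  cubic : ∃ U, U ≠ T ∧ IsSpecialCubic τ c U
  /-- the generator lines are pairwise disjoint -/
  disjoint : ∀ s t s' t' : F, s * t' ≠ s' * t → Disjoint (generator a c s t) (generator a c s' t')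
  /-- the extension of the surface to `PG(6,K)` contains the transversals of the spread -/
  transversals : ∀ g, IsTransversal F τ g →
    pts g ⊆ surfacePts (fun i => (ext7 (a i) : Fin 7 → K)) (fun i => (ext7 (c i) : Fin 7 → K))
  /-- the affine points of the surface are those that represent the affine points of `B` -/
  affine : surfacePts a c \ pts (hyperplaneAtInfinity F) =
    bbSet τ (B \ pts (lineAtInfinity K))

end Special

end BruckBose

open BruckBose

/-! An order-`q` subplane of the plane over `K` is the set of points with coordinates in `F` for a
suitable basis of `K^3` (`IsSubplane.eq_vecPts`, `IsSubplane.exists_eq_vecPts`). For the tangent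
subplane, `exists_normalForm` chooses the basis so that `P = ⟨v 0⟩` and `T = ⟨v 1⟩`, and the last
coordinates of `v 0`, `v 1`, `v 2` are 1, 0 and some `θ` outside `F`; tangency is exactly what keeps
`θ` out of `F`.

An affine point `⟨s v 0 + x v 1 + t v 2⟩` of the subplane has last coordinate `s + tθ`. Applying `σ`
divides by it, and since the norm `(s + tθ)(s + tθ^q)(s + tθ^(q²))` lies in `F`, this amounts, up to
a factor in `F`, to multiplying by `(s + tθ^q)(s + tθ^(q²))`. With this multiplier the vector `v 1`
traces a conic in `[T]`, and `s v + t w` traces a twisted cubic for every line `⟨v, w⟩` of the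
subplane through `P = ⟨v⟩` that misses `T`. Joining conic and cubic at equal parameters gives the
ruled surface (`exists_isSpecialConic`, `exists_isSpecialCubic`, `cubicPts_eq_bbSet`,
`exists_isRuledSurfaceOf`).

Over `K`, the inverse Bruck-Bose map extends to `phi τ`, with conjugates `phi (τ^q)` and `phi
(τ^(q²))`; jointly these three maps are injective. The common kernel of any two of them is a line,
and these three lines are all the transversals (`isTransversal_vanishing`,
`IsTransversal.eq_vanishing`). Conjugating the multiplier brings in the factor `s + tθ`, so conic
and cubic meet a transversal at the parameter `(-θ : 1)`, and the generator there is that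
transversal.

Differentiating the cubic at `P`, that is at `(1 : 0)`, gives modulo `v 0` the direction `w - θ v
0`. For `w = y v 1 + v 2` this is `y v 1 + (v 2 - θ v 0)`, an `F`-combination of two fixed vectors
at infinity. The subplane with basis `v 0`, `v 1`, `v 2 - θ v 0` is `P^⊥` (`isTangentSubspace_iff`),
so all these tangents lie in the plane `[P^⊥]` (`bbSpan_vecPts`). The tangent has to be found for
every special parametrisation of the cubic, not only the one constructed;
`IsSpecialCubic.cubicTangent_eq` recovers enough of the shape of such a parametrisation from its
points on the transversals. -/

namespace BruckBose

/-! ### The Frobenius automorphism of a cubic extension of a finite field -/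

section Frobenius

variable (F : Type*) {K : Type*} [Field F] [Finite F] [Field K] [Algebra F K]

/-- The Frobenius map `x ↦ x^q`, where `q = |F|`. -/
noncomputable def frob : K →ₐ[F] K :=
  letI := Fintype.ofFinite F
  FiniteField.frobeniusAlgHom F K

theorem frob_apply (x : K) : frob F x = x ^ Nat.card F := by
  let := Fintype.ofFinite F
  rw [Nat.card_eq_fintype_card]
  rfl

theorem frob_injective : Function.Injective (frob F : K → K) := (frob F : K →ₐ[F] K).toRingHom.injective

-- The elements of `F` are roots of `X^q - X`, which has at most `q` roots, so they are all of them.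
variable (K) in
theorem range_algebraMap_eq_setOf_pow_card_eq :
    Set.range (algebraMap F K) = {x : K | x ^ Nat.card F = x} := by
  have hlt : 1 < Nat.card F := Finite.one_lt_card
  have hne : (Polynomial.X ^ Nat.card F - Polynomial.X : Polynomial K) ≠ 0 :=
    FiniteField.X_pow_card_sub_X_ne_zero K hlt
  have hset : {x : K | x ^ Nat.card F = x} =
      (Polynomial.X ^ Nat.card F - Polynomial.X : Polynomial K).rootSet K := by
    ext x
    simp [Polynomial.mem_rootSet, hne, sub_eq_zero]
  have hfin : {x : K | x ^ Nat.card F = x}.Finite := by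
    rw [hset]
    exact Polynomial.rootSet_finite _ _
  refine Set.eq_of_subset_of_ncard_le ?_ ?_ hfin
  · rintro _ ⟨x, rfl⟩
    let := Fintype.ofFinite F
    rw [Set.mem_ofPred_eq, ← map_pow, Nat.card_eq_fintype_card, FiniteField.pow_card]
  · rw [hset, ← Set.image_univ, Set.ncard_image_of_injective _ (algebraMap F K).injective,
      Set.ncard_univ]
    refine (Polynomial.ncard_rootSet_le _ _).trans ?_
    rw [FiniteField.X_pow_card_sub_X_natDegree_eq K hlt]

theorem mem_range_iff_pow_card {x : K} :
    x ∈ Set.range (algebraMap F K) ↔ x ^ Nat.card F = x := by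
  rw [range_algebraMap_eq_setOf_pow_card_eq]
  rfl

theorem frob_eq_self_iff {x : K} : frob F x = x ↔ x ∈ Set.range (algebraMap F K) := by
  rw [mem_range_iff_pow_card, frob_apply]

variable {F}

/-- `K` has `q^3` elements, so `x^(q^3) = x`. -/
theorem frob_frob_frob (hK : Module.finrank F K = 3) (x : K) : frob F (frob F (frob F x)) = x := by
  have : Module.Finite F K := Module.finite_of_finrank_eq_succ hK
  have : Finite K := Module.finite_of_finite F
  let := Fintype.ofFinite K
  have hc : Nat.card K = Nat.card F ^ 3 := by
    rw [Module.natCard_eq_pow_finrank (K := F), hK]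
  simp only [frob_apply, ← pow_mul]
  conv_rhs => rw [← FiniteField.pow_card x, ← Nat.card_eq_fintype_card, hc]
  ring_nf

/-- The conjugates of an element outside the ground field are distinct. -/
theorem frob_ne (hK : Module.finrank F K = 3) {θ : K} (hθ : θ ∉ Set.range (algebraMap F K)) :
    θ ≠ frob F θ ∧ θ ≠ frob F (frob F θ) ∧ frob F θ ≠ frob F (frob F θ) := by
  have h1 : θ ≠ frob F θ := fun h => hθ ((frob_eq_self_iff F).1 h.symm)
  refine ⟨h1, fun h => h1 ?_, fun h => h1 (frob_injective F h)⟩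
  have := congrArg (frob F) h
  rw [frob_frob_frob hK] at this
  exact this.symm

/-- A quadratic with three distinct roots vanishes. -/
theorem quadratic_eq_zero {k : Type*} [Field k] {r s t a b c : k} (hrs : r ≠ s) (hrt : r ≠ t)
    (hst : s ≠ t) (hr : a + b * r + c * r ^ 2 = 0) (hs : a + b * s + c * s ^ 2 = 0)
    (ht : a + b * t + c * t ^ 2 = 0) : a = 0 ∧ b = 0 ∧ c = 0 := by
  have h1 : b + c * (r + s) = 0 :=
    mul_left_cancel₀ (sub_ne_zero.2 hrs) (by linear_combination hr - hs)
  have h2 : b + c * (r + t) = 0 :=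
    mul_left_cancel₀ (sub_ne_zero.2 hrt) (by linear_combination hr - ht)
  have hc : c = 0 := mul_left_cancel₀ (sub_ne_zero.2 hst) (by linear_combination h1 - h2)
  subst hc
  have hb : b = 0 := by simpa using h1
  subst hb
  simpa using hr

/-- The dual of `quadratic_eq_zero`. -/
theorem vandermonde_eq_zero {k : Type*} [Field k] {r s t a b c : k} (hrs : r ≠ s) (hrt : r ≠ t)
    (hst : s ≠ t) (h0 : a + b + c = 0) (h1 : r * a + s * b + t * c = 0)
    (h2 : r ^ 2 * a + s ^ 2 * b + t ^ 2 * c = 0) : a = 0 ∧ b = 0 ∧ c = 0 := by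
  refine ⟨?_, ?_, ?_⟩
  · refine mul_left_cancel₀ (mul_ne_zero (sub_ne_zero.2 hrs) (sub_ne_zero.2 hrt)) ?_
    linear_combination h2 - (s + t) * h1 + s * t * h0
  · refine mul_left_cancel₀ (mul_ne_zero (sub_ne_zero.2 hrs.symm) (sub_ne_zero.2 hst)) ?_
    linear_combination h2 - (r + t) * h1 + r * t * h0
  · refine mul_left_cancel₀ (mul_ne_zero (sub_ne_zero.2 hrt.symm) (sub_ne_zero.2 hst.symm)) ?_
    linear_combination h2 - (r + s) * h1 + r * s * h0

/-- Applying Frobenius to the relation shows that the three distinct conjugates of `θ` are all roots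
of the same quadratic over `F`. -/
theorem eq_zero_of_quadratic (hK : Module.finrank F K = 3) {θ : K}
    (hθ : θ ∉ Set.range (algebraMap F K)) {x y z : F}
    (h : algebraMap F K x + algebraMap F K y * θ + algebraMap F K z * θ ^ 2 = 0) :
    x = 0 ∧ y = 0 ∧ z = 0 := by
  obtain ⟨h1, h2, h3⟩ := frob_ne hK hθ
  have h' := congrArg (frob F) h
  simp only [map_add, map_mul, map_pow, AlgHom.commutes, map_zero] at h'
  have h'' := congrArg (frob F) h'
  simp only [map_add, map_mul, map_pow, AlgHom.commutes, map_zero] at h''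
  simpa using quadratic_eq_zero h1 h2 h3 h h' h''

omit [Finite F] in
theorem eq_zero_of_linear {θ : K} (hθ : θ ∉ Set.range (algebraMap F K)) {x y : F}
    (h : algebraMap F K x + algebraMap F K y * θ = 0) : x = 0 ∧ y = 0 := by
  have hy : y = 0 := by
    by_contra hy
    have hy' : algebraMap F K y ≠ 0 := by simpa using hy
    refine hθ ⟨-x / y, ?_⟩
    rw [map_div₀, map_neg, div_eq_iff hy']
    linear_combination -h
  subst hy
  simpa using h

/-- Every element of a cubic extension is a quadratic polynomial in `θ`. -/
theorem exists_eq_quadratic (hK : Module.finrank F K = 3) {θ : K}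
    (hθ : θ ∉ Set.range (algebraMap F K)) (a : K) :
    ∃ x y z : F, algebraMap F K x + algebraMap F K y * θ + algebraMap F K z * θ ^ 2 = a := by
  have hli : LinearIndependent F ![1, θ, θ ^ 2] := by
    rw [Fintype.linearIndependent_iff]
    intro g hg
    simp only [Fin.sum_univ_three, Matrix.cons_val_zero, Matrix.cons_val_one,
      Matrix.cons_val_two, Algebra.smul_def, mul_one] at hg
    obtain ⟨h0, h1, h2⟩ := eq_zero_of_quadratic hK hθ hg
    intro i
    fin_cases i <;> assumption
  have hsp := hli.span_eq_top_of_card_eq_finrank (by simp [hK])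
  have ha : a ∈ Submodule.span F (Set.range ![1, θ, θ ^ 2]) := hsp ▸ Submodule.mem_top
  obtain ⟨c, hc⟩ := (Submodule.mem_span_range_iff_exists_fun F).1 ha
  refine ⟨c 0, c 1, c 2, ?_⟩
  simpa [Fin.sum_univ_three, Algebra.smul_def] using hc

/-- The product of the conjugates lies in the ground field. -/
theorem exists_norm_eq (hK : Module.finrank F K = 3) (a : K) :
    ∃ x : F, algebraMap F K x = a * frob F a * frob F (frob F a) := by
  have : frob F (a * frob F a * frob F (frob F a)) = a * frob F a * frob F (frob F a) := by
    simp only [map_mul, frob_frob_frob hK]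
    ring
  exact (frob_eq_self_iff F).1 this

theorem exists_trace_eq (hK : Module.finrank F K = 3) (a : K) :
    ∃ x : F, algebraMap F K x = a + frob F a + frob F (frob F a) := by
  have : frob F (a + frob F a + frob F (frob F a)) = a + frob F a + frob F (frob F a) := by
    simp only [map_add, frob_frob_frob hK]
    ring
  exact (frob_eq_self_iff F).1 this

theorem exists_trace_pair_eq (hK : Module.finrank F K = 3) (a : K) :
    ∃ x : F, algebraMap F K x =
      a * frob F a + a * frob F (frob F a) + frob F a * frob F (frob F a) := by
  have : frob F (a * frob F a + a * frob F (frob F a) + frob F a * frob F (frob F a)) =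
      a * frob F a + a * frob F (frob F a) + frob F a * frob F (frob F a) := by
    simp only [map_add, map_mul, frob_frob_frob hK]
    ring
  exact (frob_eq_self_iff F).1 this

/-- An element of the ground field has order dividing `q - 1`, which is too small for order `q^3 -
1`. -/
theorem primitiveRoot_notMem_range {q : ℕ} (hq : Nat.card F = q) {τ : K}
    (hτ : IsPrimitiveRoot τ (q ^ 3 - 1)) : τ ∉ Set.range (algebraMap F K) := by
  intro h
  have hlt : 1 < q := hq ▸ Finite.one_lt_card
  rw [mem_range_iff_pow_card, hq] at h
  have h3 : q < q ^ 3 := by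
    calc q = q ^ 1 := (pow_one q).symm
      _ < q ^ 3 := Nat.pow_lt_pow_right hlt (by norm_num)
  have hτ0 : τ ≠ 0 := hτ.ne_zero (by omega)
  have h1 : τ ^ (q - 1) = 1 := by
    refine mul_right_cancel₀ hτ0 ?_
    rw [← pow_succ, Nat.sub_add_cancel hlt.le, h, one_mul]
  have := Nat.le_of_dvd (by omega) (hτ.dvd_of_pow_eq_one _ h1)
  omega

/-- A subset of cardinality `|F|` that contains `0` and is closed under multiplication is the
ground field. -/
theorem eq_range_algebraMap_of_closed {R : Set K} (hc : R.ncard = Nat.card F) (h0 : (0 : K) ∈ R)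
    (hmul : ∀ x ∈ R, ∀ y ∈ R, x * y ∈ R) :
    R = Set.range (algebraMap F K) := by
  have hlt : 1 < Nat.card F := Finite.one_lt_card
  have hfin : R.Finite := Set.finite_of_ncard_pos (by omega)
  classical
  have hpow : ∀ x ∈ R, x ^ Nat.card F = x := by
    intro x hx
    by_cases hx0 : x = 0
    · subst hx0
      exact zero_pow (by omega)
    -- Multiplication by `x` permutes the nonzero elements of `R`, so comparing products gives
    -- `x^(q-1) = 1`. This is why closure under addition is not needed.
    have hperm : ∏ y ∈ hfin.toFinset.erase 0, (x * y) = ∏ y ∈ hfin.toFinset.erase 0, y := by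
      have himg : (hfin.toFinset.erase 0).image (x * ·) = hfin.toFinset.erase 0 := by
        refine Finset.eq_of_subset_of_card_le ?_ ?_
        · intro z hz
          simp only [Finset.mem_image, Finset.mem_erase, Set.Finite.mem_toFinset] at hz ⊢
          obtain ⟨y, ⟨hy0, hy⟩, rfl⟩ := hz
          exact ⟨mul_ne_zero hx0 hy0, hmul x hx y hy⟩
        · rw [Finset.card_image_of_injective _ (mul_right_injective₀ hx0)]
      conv_rhs => rw [← himg]
      rw [Finset.prod_image (mul_right_injective₀ hx0).injOn]
    have hcard : (hfin.toFinset.erase 0).card = Nat.card F - 1 := by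
      rw [Finset.card_erase_of_mem (by simpa using h0), ← Set.ncard_eq_toFinset_card R hfin, hc]
    rw [Finset.prod_mul_distrib, Finset.prod_const, hcard] at hperm
    have hne : ∏ y ∈ hfin.toFinset.erase 0, y ≠ 0 :=
      Finset.prod_ne_zero_iff.2 fun y hy => (Finset.mem_erase.1 hy).1
    have h1 : x ^ (Nat.card F - 1) = 1 := mul_right_cancel₀ hne (by rw [hperm, one_mul])
    calc x ^ Nat.card F = x ^ (Nat.card F - 1 + 1) := by rw [Nat.sub_add_cancel hlt.le]
      _ = x := by rw [pow_succ, h1, one_mul]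
  refine Set.eq_of_subset_of_ncard_le (fun x hx => (mem_range_iff_pow_card F).2 (hpow x hx)) ?_
    (Set.finite_range _)
  rw [hc, ← Set.image_univ, Set.ncard_image_of_injective _ (algebraMap F K).injective,
    Set.ncard_univ]

end Frobenius

/-! ### Coordinates of a subplane -/

section Coordinates

open Matrix

variable {F K : Type*} [Field F] [Field K] [Algebra F K]

/-- The set of points of the plane over `K` that are represented by the vectors of an `F`-subspace
`M`. -/
def vecPts (M : Submodule F (Fin 3 → K)) : Set (PG2 K) :=
  {Q | ∃ m ∈ M, ∃ hm : m ≠ 0, Q = Projectivization.mk K m hm}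

theorem mk_mem_vecPts {M : Submodule F (Fin 3 → K)} {v : Fin 3 → K} {hv : v ≠ 0} :
    Projectivization.mk K v hv ∈ vecPts M ↔ ∃ k : K, k ≠ 0 ∧ k • v ∈ M := by
  constructor
  · rintro ⟨m, hm, hm0, h⟩
    obtain ⟨k, hk⟩ := (Projectivization.mk_eq_mk_iff' K _ _ _ _).1 h.symm
    exact ⟨k, fun h0 => hm0 (by rw [← hk, h0, zero_smul]), hk ▸ hm⟩
  · rintro ⟨k, hk, hm⟩
    exact ⟨k • v, hm, smul_ne_zero hk hv,
      (Projectivization.mk_eq_mk_iff' K _ _ _ _).2 ⟨k⁻¹, inv_smul_smul₀ hk v⟩⟩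

theorem mk_mem_pts {k V : Type*} [Field k] [AddCommGroup V] [Module k V] {W : Submodule k V}
    {v : V} {hv : v ≠ 0} : Projectivization.mk k v hv ∈ pts W ↔ v ∈ W := by
  simp [pts]

theorem mk_mem_lineAtInfinity {v : Fin 3 → K} {hv : v ≠ 0} :
    Projectivization.mk K v hv ∈ pts (lineAtInfinity K) ↔ v 2 = 0 := by
  rw [mk_mem_pts]
  simp [lineAtInfinity]

theorem exists_mk_eq {k V : Type*} [Field k] [AddCommGroup V] [Module k V]
    (Q : Projectivization k V) : ∃ v, ∃ hv : v ≠ 0, Q = Projectivization.mk k v hv :=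
  ⟨Q.rep, Q.rep_nonzero, Q.mk_rep.symm⟩

theorem range_pair {α : Type*} (a b : α) : Set.range ![a, b] = {a, b} := by
  simp [Set.pair_comm]

theorem mk_ne_mk {k V : Type*} [Field k] [AddCommGroup V] [Module k V] {v w : V}
    (h : LinearIndependent k ![v, w]) (hv : v ≠ 0) (hw : w ≠ 0) :
    Projectivization.mk k v hv ≠ Projectivization.mk k w hw := by
  rw [Ne, Projectivization.mk_eq_mk_iff']
  rintro ⟨a, ha⟩
  have := LinearIndependent.pair_iff.1 h 1 (-a) (by rw [← ha]; module)
  exact one_ne_zero this.1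

theorem isLineOf_span {B : Set (PG2 K)} {v w : Fin 3 → K} (h : LinearIndependent K ![v, w])
    {hv0 : v ≠ 0} {hw0 : w ≠ 0} (hv : Projectivization.mk K v hv0 ∈ B)
    (hw : Projectivization.mk K w hw0 ∈ B) :
    IsLineOf B (Submodule.span K {v, w}) := by
  refine ⟨?_, ⟨_, ⟨hv, mk_mem_pts.2 (Submodule.subset_span (by simp))⟩, _,
    ⟨hw, mk_mem_pts.2 (Submodule.subset_span (by simp))⟩, mk_ne_mk h _ _⟩⟩
  have := finrank_span_eq_card h
  rwa [range_pair, Fintype.card_fin] at this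

/-- A line of dimension two is spanned by any two independent vectors in it. -/
theorem eq_span_pair {k V : Type*} [Field k] [AddCommGroup V] [Module k V] {L : Submodule k V}
    (hL : Module.finrank k L = 2) {v w : V} (h : LinearIndependent k ![v, w]) (hv : v ∈ L)
    (hw : w ∈ L) : L = Submodule.span k {v, w} := by
  have : Module.Finite k L := Module.finite_of_finrank_eq_succ hL
  symm
  refine Submodule.eq_of_le_of_finrank_eq (Submodule.span_le.2 ?_) ?_
  · rintro x (rfl | rfl) <;> assumption
  · have := finrank_span_eq_card h
    rw [range_pair, Fintype.card_fin] at this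
    exact this.trans hL.symm

/-- The meet of two joins, in terms of coordinates with respect to a basis `e`. -/
theorem IsSubplane.meet_of_cross {q : ℕ} {B : Set (PG2 K)} (hB : IsSubplane q B)
    (e : Module.Basis (Fin 3) K (Fin 3 → K)) {S : Set (Fin 3 → K)}
    (hS : S = {c | ∃ h : e.equivFun.symm c ≠ 0, Projectivization.mk K _ h ∈ B})
    {t u v w : Fin 3 → K} (ht : t ∈ S) (hu : u ∈ S) (hv : v ∈ S) (hw : w ∈ S)
    (r : Fin 3 → K) (k : K) (hk : k ≠ 0) (hr : r ≠ 0)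
    (h : k • r = (t ⨯₃ u) ⨯₃ (v ⨯₃ w)) : r ∈ S := by
  have hne : (t ⨯₃ u) ⨯₃ (v ⨯₃ w) ≠ 0 := h ▸ smul_ne_zero hk hr
  have htu : LinearIndependent K ![t, u] :=
    crossProduct_ne_zero_iff_linearIndependent.1 fun h => hne (by rw [h]; simp)
  have hvw : LinearIndependent K ![v, w] :=
    crossProduct_ne_zero_iff_linearIndependent.1 fun h => hne (by rw [h]; simp)
  have himg : ∀ a b : Fin 3 → K, LinearIndependent K ![a, b] →
      LinearIndependent K ![e.equivFun.symm a, e.equivFun.symm b] := by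
    intro a b hab
    rw [LinearIndependent.pair_iff] at hab ⊢
    intro x y hxy
    refine hab x y (e.equivFun.symm.injective ?_)
    simpa only [map_add, map_smul, map_zero] using hxy
  have hmem : ∀ a b c : Fin 3 → K, e.equivFun.symm c ∈
      Submodule.span K {e.equivFun.symm a, e.equivFun.symm b} → ∃ x y : K, x • a + y • b = c := by
    intro a b c hc
    obtain ⟨x, y, hxy⟩ := Submodule.mem_span_pair.1 hc
    refine ⟨x, y, e.equivFun.symm.injective ?_⟩
    simpa only [map_add, map_smul] using hxy
  have hmk : ∀ c ∈ S, ∀ h : e.equivFun.symm c ≠ 0, Projectivization.mk K _ h ∈ B := by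
    intro c hc h
    rw [hS] at hc
    exact hc.2
  have hL := isLineOf_span (himg t u htu) (hmk _ ht ((himg t u htu).ne_zero 0)) (hmk _ hu ((himg t u htu).ne_zero 1))
  have hM := isLineOf_span (himg v w hvw) (hmk _ hv ((himg v w hvw).ne_zero 0)) (hmk _ hw ((himg v w hvw).ne_zero 1))
  -- If the lines coincided, both inner cross products would be multiples of `t ⨯₃ u` and the outer
  -- product would vanish.
  have hLM : Submodule.span K {e.equivFun.symm t, e.equivFun.symm u} ≠
      Submodule.span K {e.equivFun.symm v, e.equivFun.symm w} := by
    intro hEq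
    obtain ⟨a, b, rfl⟩ := hmem t u v (hEq ▸ Submodule.subset_span (by simp))
    obtain ⟨c, d, rfl⟩ := hmem t u w (hEq ▸ Submodule.subset_span (by simp))
    apply hne
    have : (a • t + b • u) ⨯₃ (c • t + d • u) = (a * d - b * c) • (t ⨯₃ u) := by
      simp only [map_add, map_smul, LinearMap.add_apply, LinearMap.smul_apply, cross_self]
      rw [← cross_anticomm t u]
      module
    rw [this, map_smul, cross_self, smul_zero]
  obtain ⟨Q, ⟨hQB, hQL⟩, hQM⟩ := hB.meet _ _ hL hM hLM
  obtain ⟨z, hz, rfl⟩ := exists_mk_eq Q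
  rw [mk_mem_pts] at hQL hQM
  obtain ⟨c, rfl⟩ := e.equivFun.symm.surjective z
  have hc0 : c ≠ 0 := fun h => hz (by rw [h, map_zero])
  obtain ⟨x, y, hxy⟩ := hmem _ _ _ hQL
  obtain ⟨x', y', hxy'⟩ := hmem _ _ _ hQM
  have h1 : (t ⨯₃ u) ⬝ᵥ c = 0 := by
    rw [← hxy, dotProduct_comm]
    simp [add_dotProduct]
  have h2 : (v ⨯₃ w) ⬝ᵥ c = 0 := by
    rw [← hxy', dotProduct_comm]
    simp [add_dotProduct]
  -- The common point `c` is orthogonal to both line vectors `t ⨯₃ u` and `v ⨯₃ w`, hence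
  -- proportional to their cross product, which is a multiple of `r`.
  have h3 : ¬ LinearIndependent K ![c, r] := by
    rw [← crossProduct_ne_zero_iff_linearIndependent, not_not]
    have : k • (c ⨯₃ r) = 0 := by
      rw [← map_smul, h, ← cross_anticomm, cross_cross_eq_smul_sub_smul, h1, h2]
      simp
    exact (smul_eq_zero.1 this).resolve_left hk
  rw [LinearIndependent.pair_iff' hc0] at h3
  push Not at h3
  obtain ⟨a, rfl⟩ := h3
  have ha : a ≠ 0 := fun h => hr (by rw [h, zero_smul])
  rw [hS]
  refine ⟨by rw [map_smul]; exact smul_ne_zero ha hz, ?_⟩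
  convert hQB using 1
  rw [Projectivization.mk_eq_mk_iff']
  exact ⟨a, by rw [map_smul]⟩

/-- A subplane of order `|F|` that contains the fundamental frame of a basis consists of the points
with coordinates in `F`. -/
theorem IsSubplane.eq_vecPts [Finite F] {B : Set (PG2 K)} (hB : IsSubplane (Nat.card F) B)
    (e : Module.Basis (Fin 3) K (Fin 3 → K))
    (he : ∀ i, Projectivization.mk K (e i) (e.ne_zero i) ∈ B)
    (hu : ∃ h : e 0 + e 1 + e 2 ≠ 0, Projectivization.mk K _ h ∈ B) :
    B = vecPts (Submodule.span F (Set.range e)) := by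
  -- `S` is the set of coordinate vectors of points of `B`; the aim is to show that it consists of
  -- the multiples of nonzero vectors over `F`.
  set S : Set (Fin 3 → K) := {c | ∃ h : e.equivFun.symm c ≠ 0, Projectivization.mk K _ h ∈ B}
    with hS
  have hsymm : ∀ c, e.equivFun.symm c = c 0 • e 0 + c 1 • e 1 + c 2 • e 2 := by
    intro c
    rw [Module.Basis.equivFun_symm_apply, Fin.sum_univ_three]
  have hsmul' : ∀ (k : K) (c : Fin 3 → K), k ≠ 0 → c ∈ S → k • c ∈ S := by
    rintro k c hk ⟨h, hc⟩
    refine ⟨by rw [map_smul]; exact smul_ne_zero hk h, ?_⟩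
    convert hc using 1
    rw [Projectivization.mk_eq_mk_iff']
    exact ⟨k, by rw [map_smul]⟩
  have hsmul : ∀ (k : K) (c : Fin 3 → K), k ≠ 0 → k • c ∈ S → c ∈ S := by
    intro k c hk hc
    simpa [hk] using hsmul' k⁻¹ _ (inv_ne_zero hk) hc
  have meet := @IsSubplane.meet_of_cross _ _ _ _ hB e S hS
  have e0 : ![1, 0, 0] ∈ S := ⟨by rw [hsymm]; simpa using e.ne_zero 0, by
    convert he 0 using 2; rw [hsymm]; simp⟩
  have e1 : ![0, 1, 0] ∈ S := ⟨by rw [hsymm]; simpa using e.ne_zero 1, by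
    convert he 1 using 2; rw [hsymm]; simp⟩
  have e2 : ![0, 0, 1] ∈ S := ⟨by rw [hsymm]; simpa using e.ne_zero 2, by
    convert he 2 using 2; rw [hsymm]; simp⟩
  have eu : ![1, 1, 1] ∈ S := ⟨by rw [hsymm]; simpa using hu.1, by
    convert hu.2 using 2; rw [hsymm]; simp⟩
  -- Von Staudt constructions in the affine chart `(x, y, 1)`: `e2` is the origin, `e0` and `e1` are
  -- the horizontal and vertical directions, and `eu` lies on the diagonal. Every new point is the
  -- meet of two joins of points already in `S`.
  have diag : ∀ x, ![x, 0, 1] ∈ S → ![x, x, 1] ∈ S := fun x hx =>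
    meet hx e1 e2 eu _ (-1) (by simp) (by simp) (by simp [cross_apply])
  have diag' : ∀ x, ![x, x, 1] ∈ S → ![0, x, 1] ∈ S := fun x hx =>
    meet hx e0 e2 e1 _ 1 one_ne_zero (by simp) (by simp [cross_apply])
  have diag'' : ∀ x, ![0, x, 1] ∈ S → ![x, x, 1] ∈ S := fun x hx =>
    meet hx e0 e2 eu _ 1 one_ne_zero (by simp) (by simp [cross_apply])
  have fst : ∀ x y, ![x, y, 1] ∈ S → ![x, 0, 1] ∈ S := fun x y hx =>
    meet hx e1 e2 e0 _ (-1) (by simp) (by simp) (by simp [cross_apply])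
  have snd : ∀ x y, ![x, y, 1] ∈ S → ![y, 0, 1] ∈ S := fun x y hx =>
    fst y y (diag'' y (meet hx e0 e2 e1 _ 1 one_ne_zero (by simp) (by simp [cross_apply])))
  have both : ∀ x y, ![x, 0, 1] ∈ S → ![y, 0, 1] ∈ S → ![x, y, 1] ∈ S := fun x y hx hy =>
    meet hx e1 (diag' y (diag y hy)) e0 _ (-1) (by simp) (by simp) (by simp [cross_apply])
  have h1 : ![1, 0, 1] ∈ S := fst 1 1 eu
  have slope : ∀ m, ![m, 0, 1] ∈ S → ![1, m, 0] ∈ S := fun m hm =>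
    meet e2 (both 1 m h1 hm) e0 e1 _ 1 one_ne_zero (by simp) (by simp [cross_apply])
  have slope' : ∀ m, ![1, m, 0] ∈ S → ![m, 0, 1] ∈ S := fun m hm =>
    snd 1 m (meet e2 hm h1 e1 _ 1 one_ne_zero (by simp) (by simp [cross_apply]))
  -- The line of slope `y` through the origin meets the vertical line at `x` in the point `(x, xy)`.
  have mul : ∀ x y, ![x, 0, 1] ∈ S → ![y, 0, 1] ∈ S → ![x * y, 0, 1] ∈ S := fun x y hx hy =>
    snd x (x * y) (meet e2 (slope y hy) hx e1 _ 1 one_ne_zero (by simp)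
      (by simp [cross_apply, mul_comm]))
  have hind : LinearIndependent K ![e 0, e 2] := by
    have := e.linearIndependent.comp ![0, 2] (by decide)
    convert this using 1
    ext i
    fin_cases i <;> rfl
  have hline := isLineOf_span hind (he 0) (he 2)
  have hne : ∀ x, x • e 0 + e 2 ≠ 0 := fun x h =>
    one_ne_zero (LinearIndependent.pair_iff.1 hind x 1 (by rw [one_smul, h])).2
  -- The points `(x, 0, 1)` are those of the line `⟨e 0, e 2⟩` other than `⟨e 0⟩`, so there are `(q
  -- + 1) - 1 = q` values of `x`. Together with closure under products this identifies them with
  -- `F`.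
  have hR : {x : K | ![x, 0, 1] ∈ S} = Set.range (algebraMap F K) := by
    refine eq_range_algebraMap_of_closed ?_ e2 fun x hx y hy => mul x y hx hy
    set f : K → PG2 K := fun x => Projectivization.mk K (x • e 0 + e 2) (hne x)
    have hf : Function.Injective f := by
      intro x y hxy
      obtain ⟨a, ha⟩ := (Projectivization.mk_eq_mk_iff' K _ _ _ _).1 hxy
      have := LinearIndependent.pair_iff.1 hind (a * y - x) (a - 1) (by
        rw [← sub_eq_zero] at ha
        rw [← ha]
        module)
      have ha1 : a = 1 := sub_eq_zero.1 this.2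
      rw [ha1, one_mul] at this
      exact (sub_eq_zero.1 this.1).symm
    have himg : f '' {x : K | ![x, 0, 1] ∈ S} =
        (B ∩ pts (Submodule.span K {e 0, e 2})) \ {Projectivization.mk K (e 0) (e.ne_zero 0)} := by
      ext Q
      constructor
      · rintro ⟨x, ⟨hx, hxB⟩, rfl⟩
        refine ⟨⟨?_, ?_⟩, ?_⟩
        · convert hxB using 2
          rw [hsymm]
          simp
        · rw [mk_mem_pts, Submodule.mem_span_pair]
          exact ⟨x, 1, by rw [one_smul]⟩
        · rw [Set.mem_singleton_iff, Projectivization.mk_eq_mk_iff']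
          rintro ⟨a, ha⟩
          have := LinearIndependent.pair_iff.1 hind (x - a) 1 (by
            rw [← sub_eq_zero] at ha
            rw [← neg_eq_zero, ← ha]
            module)
          exact one_ne_zero this.2
      · rintro ⟨⟨hQB, hQL⟩, hQ0⟩
        obtain ⟨z, hz, rfl⟩ := exists_mk_eq Q
        rw [mk_mem_pts, Submodule.mem_span_pair] at hQL
        obtain ⟨a, b, rfl⟩ := hQL
        rw [Set.mem_singleton_iff, Projectivization.mk_eq_mk_iff'] at hQ0
        have hb : b ≠ 0 := fun hb => hQ0 ⟨a, by rw [hb]; module⟩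
        have hEq : Projectivization.mk K _ hz = f (b⁻¹ * a) := by
          rw [Projectivization.mk_eq_mk_iff']
          refine ⟨b, ?_⟩
          rw [smul_add, smul_smul, mul_inv_cancel_left₀ hb]
        refine ⟨b⁻¹ * a, ⟨by rw [hsymm]; simpa using hne _, ?_⟩, hEq.symm⟩
        rw [hEq] at hQB
        convert hQB using 2
        rw [hsymm]
        simp
    have hcard := congrArg Set.ncard himg
    rw [Set.ncard_image_of_injective _ hf, Set.ncard_sdiff_singleton_of_mem (show _ ∈ B ∩ _ from ⟨he 0,
      mk_mem_pts.2 (Submodule.subset_span (by simp))⟩), hB.order _ hline] at hcard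
    simpa using hcard
  have hRmem : ∀ x : K, ![x, 0, 1] ∈ S ↔ x ∈ Set.range (algebraMap F K) := fun x =>
    Set.ext_iff.1 hR x
  -- Normalise a nonzero coordinate to 1, trying the last, then the first, then the middle one.
  have key : ∀ c : Fin 3 → K, c ≠ 0 → (c ∈ S ↔
      ∃ k : K, k ≠ 0 ∧ ∀ i, k * c i ∈ Set.range (algebraMap F K)) := by
    intro c hc
    constructor
    · intro hcS
      by_cases h2 : c 2 = 0
      · by_cases h0 : c 0 = 0
        · have h1 : c 1 ≠ 0 := fun h1 => hc (by ext i; fin_cases i <;> assumption)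
          refine ⟨(c 1)⁻¹, inv_ne_zero h1, fun i => ?_⟩
          fin_cases i
          · exact ⟨0, by simp [h0]⟩
          · exact ⟨1, by simp [h1]⟩
          · exact ⟨0, by simp [h2]⟩
        · refine ⟨(c 0)⁻¹, inv_ne_zero h0, ?_⟩
          have h3 : ![1, (c 0)⁻¹ * c 1, 0] ∈ S := by
            convert hsmul' _ _ (inv_ne_zero h0) hcS using 1
            ext i
            fin_cases i <;> simp [h0, h2]
          intro i
          fin_cases i
          · exact ⟨1, by simp [h0]⟩
          · exact (hRmem _).1 (slope' _ h3)
          · exact ⟨0, by simp [h2]⟩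
      · refine ⟨(c 2)⁻¹, inv_ne_zero h2, ?_⟩
        have h3 : ![(c 2)⁻¹ * c 0, (c 2)⁻¹ * c 1, 1] ∈ S := by
          convert hsmul' _ _ (inv_ne_zero h2) hcS using 1
          ext i
          fin_cases i <;> simp [h2]
        intro i
        fin_cases i
        · exact (hRmem _).1 (fst _ _ h3)
        · exact (hRmem _).1 (snd _ _ h3)
        · exact ⟨1, by simp [h2]⟩
    · rintro ⟨k, hk, hkc⟩
      refine hsmul k c hk ?_
      choose d hd using hkc
      have hcd : k • c = fun i => algebraMap F K (d i) := by
        ext i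
        rw [hd]
        rfl
      rw [hcd]
      by_cases h2 : d 2 = 0
      · by_cases h0 : d 0 = 0
        · have h1 : d 1 ≠ 0 := by
            intro h1
            refine smul_ne_zero hk hc ?_
            rw [hcd]
            ext i
            fin_cases i <;> simp [h0, h1, h2]
          convert hsmul' (algebraMap F K (d 1)) _ (by simpa using h1) e1 using 1
          ext i
          fin_cases i <;> simp [h0, h2]
        · convert hsmul' (algebraMap F K (d 0)) _ (by simpa using h0)
            (slope (algebraMap F K (d 1 / d 0)) ((hRmem _).2 ⟨_, rfl⟩)) using 1
          ext i
          fin_cases i <;> simp [h0, h2, mul_div_cancel₀]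
      · convert hsmul' (algebraMap F K (d 2)) _ (by simpa using h2)
            (both (algebraMap F K (d 0 / d 2)) (algebraMap F K (d 1 / d 2))
            ((hRmem _).2 ⟨_, rfl⟩) ((hRmem _).2 ⟨_, rfl⟩)) using 1
        ext i
        fin_cases i <;> simp [h2, mul_div_cancel₀]
  ext Q
  obtain ⟨z, hz, rfl⟩ := exists_mk_eq Q
  obtain ⟨c, rfl⟩ := e.equivFun.symm.surjective z
  have hc : c ≠ 0 := fun h => hz (by rw [h, map_zero])
  have h3 : Projectivization.mk K _ hz ∈ B ↔ c ∈ S := ⟨fun h => ⟨hz, h⟩, fun h => h.2⟩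
  rw [h3, key c hc, mk_mem_vecPts]
  refine exists_congr fun k => and_congr_right fun _ => ?_
  rw [Submodule.mem_span_range_iff_exists_fun]
  constructor
  · intro h
    choose d hd using h
    refine ⟨d, ?_⟩
    rw [hsymm, Fin.sum_univ_three]
    simp only [smul_add, smul_smul, ← hd, algebraMap_smul]
  · rintro ⟨d, hd⟩ i
    refine ⟨d i, ?_⟩
    have h4 : e.equivFun.symm (fun i => algebraMap F K (d i)) = e.equivFun.symm (k • c) := by
      rw [map_smul, ← hd, hsymm, Fin.sum_univ_three]
      simp only [algebraMap_smul]
    exact congrFun (e.equivFun.symm.injective h4) i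

end Coordinates

/-! ### Subplanes as `F`-spans of bases -/

section Subplanes

open Matrix

variable {F K : Type*} [Field F] [Field K] [Algebra F K]

theorem mem_span_range_three {k V : Type*} [Semiring k] [AddCommMonoid V] [Module k V]
    {v : Fin 3 → V} {x : V} : x ∈ Submodule.span k (Set.range v) ↔
      ∃ a b c : k, a • v 0 + b • v 1 + c • v 2 = x := by
  rw [Submodule.mem_span_range_iff_exists_fun]
  constructor
  · rintro ⟨c, rfl⟩
    exact ⟨c 0, c 1, c 2, by rw [Fin.sum_univ_three]⟩
  · rintro ⟨a, b, c, rfl⟩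
    exact ⟨![a, b, c], by simp [Fin.sum_univ_three]⟩

/-- The vectors representing the points of a subplane with coordinates in `F` form an `F`-space of
dimension three, and `F`-bases of it are `K`-bases of the whole space. -/
theorem span_eq_and_linearIndependent {e v : Fin 3 → Fin 3 → K} (he : LinearIndependent K e)
    (hv : LinearIndependent F v) (hve : ∀ i, v i ∈ Submodule.span F (Set.range e)) :
    Submodule.span F (Set.range v) = Submodule.span F (Set.range e) ∧ LinearIndependent K v := by
  have heF : LinearIndependent F e := he.restrict_scalars' F
  have hfin : Module.Finite F (Submodule.span F (Set.range e)) :=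
    Module.Finite.span_of_finite F (Set.finite_range e)
  have hspan : Submodule.span F (Set.range v) = Submodule.span F (Set.range e) := by
    refine Submodule.eq_of_le_of_finrank_eq (Submodule.span_le.2 ?_) ?_
    · rintro _ ⟨i, rfl⟩
      exact hve i
    · rw [finrank_span_eq_card hv, finrank_span_eq_card heF]
  refine ⟨hspan, ?_⟩
  refine linearIndependent_of_top_le_span_of_card_eq_finrank ?_ (by simp)
  rw [← he.span_eq_top_of_card_eq_finrank (by simp), Submodule.span_le]
  rintro _ ⟨i, rfl⟩
  have h1 : e i ∈ Submodule.span F (Set.range v) := hspan ▸ Submodule.subset_span ⟨i, rfl⟩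
  exact Submodule.span_le_restrictScalars F K _ h1

theorem linearIndependent_three {k V : Type*} [Field k] [AddCommGroup V] [Module k V]
    {a b c : V} (h : LinearIndependent k ![a, b]) (hc : c ∉ Submodule.span k {a, b}) :
    LinearIndependent k ![a, b, c] := by
  have h1 : LinearIndependent k ![c, a, b] := by
    have := linearIndependent_finCons (x := c) (v := ![a, b]) |>.2 ⟨h, by rwa [range_pair]⟩
    exact this
  have := h1.comp ![1, 2, 0] (by decide)
  convert this using 1
  ext i : 1
  fin_cases i <;> rfl

/-- Otherwise `v`, `w`, `x` would be an `F`-basis of the span of `e`, hence independent over `K`,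
although `x` lies on the line `⟨v, w⟩`. So a line of the subplane carries exactly a subline over
`F`. -/
theorem exists_eq_add_of_mem_span {e : Fin 3 → Fin 3 → K} (he : LinearIndependent K e)
    {v w x : Fin 3 → K} (hvw : LinearIndependent K ![v, w])
    (hv : v ∈ Submodule.span F (Set.range e)) (hw : w ∈ Submodule.span F (Set.range e))
    (hx : x ∈ Submodule.span F (Set.range e)) (h : x ∈ Submodule.span K {v, w}) :
    ∃ a b : F, a • v + b • w = x := by
  rw [← Submodule.mem_span_pair]
  by_contra hn
  have hli := linearIndependent_three (hvw.restrict_scalars' F) hn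
  have := (span_eq_and_linearIndependent he hli (by
    intro i
    fin_cases i <;> assumption)).2
  obtain ⟨a, b, hab⟩ := Submodule.mem_span_pair.1 h
  rw [Fintype.linearIndependent_iff] at this
  have := this ![a, b, -1] (by simp [Fin.sum_univ_three, hab]) 2
  simp at this

/-- Any two points of a subplane are part of a coordinate frame. -/
theorem exists_extend_basis {e : Fin 3 → Fin 3 → K} (he : LinearIndependent K e)
    {v w : Fin 3 → K} (hvw : LinearIndependent K ![v, w])
    (hv : v ∈ Submodule.span F (Set.range e)) (hw : w ∈ Submodule.span F (Set.range e)) :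
    ∃ x, LinearIndependent K ![v, w, x] ∧
      Submodule.span F (Set.range e) = Submodule.span F (Set.range ![v, w, x]) := by
  have hvwF := hvw.restrict_scalars' F
  have : ∃ x ∈ Submodule.span F (Set.range e), x ∉ Submodule.span F {v, w} := by
    by_contra! hn
    have hfin : Module.Finite F (Submodule.span F {v, w}) :=
      Module.Finite.span_of_finite F (Set.toFinite _)
    have h1 := Submodule.finrank_mono (show Submodule.span F (Set.range e) ≤ _ from hn)
    have h2 := finrank_span_eq_card hvwF
    rw [range_pair, Fintype.card_fin] at h2
    rw [finrank_span_eq_card (he.restrict_scalars' F), h2] at h1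
    simp at h1
  obtain ⟨x, hx, hx'⟩ := this
  have := span_eq_and_linearIndependent he (linearIndependent_three hvwF hx') (by
    intro i
    fin_cases i <;> assumption)
  exact ⟨x, this.2, this.1.symm⟩

theorem exists_mem_of_isLineOf_vecPts {M : Submodule F (Fin 3 → K)} {L : Submodule K (Fin 3 → K)}
    (hL : IsLineOf (vecPts M) L) :
    ∃ v ∈ M, ∃ w ∈ M, LinearIndependent K ![v, w] ∧ L = Submodule.span K {v, w} := by
  obtain ⟨h2, Q, ⟨⟨v, hv, hv0, rfl⟩, hvL⟩, R, ⟨⟨w, hw, hw0, rfl⟩, hwL⟩, hne⟩ := hL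
  rw [mk_mem_pts] at hvL hwL
  have hvw : LinearIndependent K ![v, w] := by
    rw [LinearIndependent.pair_iff' hv0]
    rintro a rfl
    refine hne.symm ?_
    rw [Projectivization.mk_eq_mk_iff']
    exact ⟨a, rfl⟩
  exact ⟨v, hv, w, hw, hvw, eq_span_pair h2 hvw hvL hwL⟩

/-- This is a copy of the plane over `F`: its points are those of a three-dimensional `F`-space, in
which two subspaces of dimension two always meet. -/
theorem isSubplane_vecPts [Finite F] {e : Fin 3 → Fin 3 → K} (he : LinearIndependent K e) :
    IsSubplane (Nat.card F) (vecPts (Submodule.span F (Set.range e))) := by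
  set M := Submodule.span F (Set.range e) with hM
  refine ⟨?_, ?_, ?_⟩
  · intro L L' hL hL' _
    obtain ⟨v, hv, w, hw, hvw, rfl⟩ := exists_mem_of_isLineOf_vecPts hL
    obtain ⟨v', hv', w', hw', hvw', rfl⟩ := exists_mem_of_isLineOf_vecPts hL'
    have hfin : Module.Finite F M := Module.Finite.span_of_finite F (Set.finite_range e)
    -- Four vectors in a space of dimension three are dependent; moving two terms of the relation to
    -- the other side exhibits a common point of the two lines.
    let u : Fin 4 → M := ![⟨v, hv⟩, ⟨w, hw⟩, ⟨v', hv'⟩, ⟨w', hw'⟩]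
    have hu : ¬ LinearIndependent F u := by
      intro h
      have := h.fintype_card_le_finrank
      rw [hM, finrank_span_eq_card (he.restrict_scalars' F)] at this
      simp at this
    obtain ⟨g, hg, i, hi⟩ := Fintype.not_linearIndependent_iff.1 hu
    have hg' : g 0 • v + g 1 • w + g 2 • v' + g 3 • w' = 0 := by
      simpa [u, Fin.sum_univ_four] using congrArg Subtype.val hg
    have hx : g 0 • v + g 1 • w ≠ 0 := by
      intro h0
      have h1 := LinearIndependent.pair_iff.1 (hvw.restrict_scalars' F) _ _ h0
      rw [h0, zero_add] at hg'
      have h2 := LinearIndependent.pair_iff.1 (hvw'.restrict_scalars' F) _ _ hg'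
      fin_cases i
      exacts [hi h1.1, hi h1.2, hi h2.1, hi h2.2]
    refine ⟨Projectivization.mk K _ hx, ⟨⟨_, ?_, hx, rfl⟩, ?_⟩, ?_⟩
    · exact M.add_mem (M.smul_mem _ hv) (M.smul_mem _ hw)
    · rw [mk_mem_pts, Submodule.mem_span_pair]
      exact ⟨algebraMap F K (g 0), algebraMap F K (g 1), by simp only [algebraMap_smul]⟩
    · rw [mk_mem_pts, Submodule.mem_span_pair]
      refine ⟨-algebraMap F K (g 2), -algebraMap F K (g 3), ?_⟩
      simp only [neg_smul, algebraMap_smul]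
      rw [← sub_eq_zero, ← neg_eq_zero, ← hg']
      abel
  -- The sign on the unit vector makes the four vectors sum to zero, so a subspace containing any
  -- three of them contains the fourth, and therefore everything.
  · let r : Fin 4 → Fin 3 → K := ![e 0, e 1, e 2, -(e 0 + e 1 + e 2)]
    have hsum : ∑ i, r i = 0 := by simp [r, Fin.sum_univ_four]
    have hr0 : ∀ i, r i ≠ 0 := by
      intro i
      fin_cases i
      · exact he.ne_zero 0
      · exact he.ne_zero 1
      · exact he.ne_zero 2
      · intro h
        have := Fintype.linearIndependent_iff.1 he (fun _ => -1) (by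
          rw [← h]
          simp [r, Fin.sum_univ_three]) 0
        simp at this
    have hrM : ∀ i, r i ∈ M := by
      have he' : ∀ i, e i ∈ M := fun i => Submodule.subset_span ⟨i, rfl⟩
      intro i
      fin_cases i
      exacts [he' 0, he' 1, he' 2, M.neg_mem (M.add_mem (M.add_mem (he' 0) (he' 1)) (he' 2))]
    refine ⟨fun i => Projectivization.mk K (r i) (hr0 i), fun i => ⟨_, hrM i, hr0 i, rfl⟩, ?_⟩
    rintro i j l hij hil hjl L hL ⟨hi, hj, hl⟩
    rw [mk_mem_pts] at hi hj hl
    have hall : ∀ k, r k ∈ L := by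
      intro k
      by_cases hki : k = i
      · rwa [hki]
      by_cases hkj : k = j
      · rwa [hkj]
      by_cases hkl : k = l
      · rwa [hkl]
      have huniv : (Finset.univ : Finset (Fin 4)) = {i, j, l, k} := by
        clear * - hij hil hjl hki hkj hkl
        decide +revert
      rw [huniv, Finset.sum_insert (by simp [hij, hil, Ne.symm hki]),
        Finset.sum_insert (by simp [hjl, Ne.symm hkj]),
        Finset.sum_insert (by simp [Ne.symm hkl]), Finset.sum_singleton] at hsum
      have : r k = -(r i + r j + r l) := by
        rw [← sub_eq_zero, ← hsum]
        abel
      rw [this]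
      exact L.neg_mem (L.add_mem (L.add_mem hi hj) hl)
    have htop : L = ⊤ := by
      rw [eq_top_iff, ← he.span_eq_top_of_card_eq_finrank (by simp), Submodule.span_le]
      rintro _ ⟨i, rfl⟩
      fin_cases i
      exacts [hall 0, hall 1, hall 2]
    rw [htop, finrank_top] at hL
    simp at hL
  · intro L hL
    obtain ⟨v, hv, w, hw, hvw, rfl⟩ := exists_mem_of_isLineOf_vecPts hL
    have hv0 : v ≠ 0 := hvw.ne_zero 0
    have hne : ∀ x : F, x • v + w ≠ 0 := fun x h =>
      one_ne_zero (LinearIndependent.pair_iff.1 (hvw.restrict_scalars' F) x 1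
        (by rw [one_smul, h])).2
    let f : F → PG2 K := fun x => Projectivization.mk K (x • v + w) (hne x)
    have hf : Function.Injective f := by
      intro x y hxy
      obtain ⟨a, ha⟩ := (Projectivization.mk_eq_mk_iff' K _ _ _ _).1 hxy
      have := LinearIndependent.pair_iff.1 hvw (a * algebraMap F K y - algebraMap F K x) (a - 1) (by
        rw [← sub_eq_zero, ← algebraMap_smul K y, ← algebraMap_smul K x] at ha
        rw [← ha]
        module)
      have ha1 : a = 1 := sub_eq_zero.1 this.2
      rw [ha1, one_mul] at this
      exact (algebraMap F K).injective (sub_eq_zero.1 this.1).symm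
    -- The `q + 1` points are `⟨v⟩` and `⟨x v + w⟩` for `x` in `F`.
    have hset : vecPts M ∩ pts (Submodule.span K {v, w}) =
        insert (Projectivization.mk K v hv0) (Set.range f) := by
      ext Q
      constructor
      · rintro ⟨⟨m, hm, hm0, rfl⟩, hmL⟩
        rw [mk_mem_pts] at hmL
        obtain ⟨a, b, rfl⟩ := exists_eq_add_of_mem_span he hvw hv hw hm hmL
        by_cases hb : b = 0
        · left
          rw [Projectivization.mk_eq_mk_iff']
          exact ⟨algebraMap F K a, by rw [hb, zero_smul, add_zero, algebraMap_smul]⟩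
        · right
          refine ⟨b⁻¹ * a, ?_⟩
          symm
          rw [Projectivization.mk_eq_mk_iff']
          refine ⟨algebraMap F K b, ?_⟩
          rw [algebraMap_smul, smul_add, smul_smul, mul_inv_cancel_left₀ hb]
      · rintro (rfl | ⟨x, rfl⟩)
        · exact ⟨⟨v, hv, hv0, rfl⟩, mk_mem_pts.2 (Submodule.subset_span (by simp))⟩
        · refine ⟨⟨_, M.add_mem (M.smul_mem _ hv) hw, hne x, rfl⟩, ?_⟩
          rw [mk_mem_pts, Submodule.mem_span_pair]
          exact ⟨algebraMap F K x, 1, by rw [algebraMap_smul, one_smul]⟩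
    rw [hset, Set.ncard_insert_of_notMem, ← Set.image_univ, Set.ncard_image_of_injective _ hf,
      Set.ncard_univ]
    rintro ⟨x, hx⟩
    obtain ⟨a, ha⟩ := (Projectivization.mk_eq_mk_iff' K _ _ _ _).1 hx
    have := LinearIndependent.pair_iff.1 hvw (algebraMap F K x - a) 1 (by
      rw [← sub_eq_zero, ← algebraMap_smul K x] at ha
      rw [← neg_eq_zero, ← ha]
      module)
    exact one_ne_zero this.2

/-- A subplane of order `|F|` consists of the points with coordinates in `F`, for suitable
coordinates. -/
theorem IsSubplane.exists_eq_vecPts [Finite F] {B : Set (PG2 K)}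
    (hB : IsSubplane (Nat.card F) B) :
    ∃ e : Fin 3 → Fin 3 → K, LinearIndependent K e ∧
      B = vecPts (Submodule.span F (Set.range e)) := by
  obtain ⟨Q, hQB, hQ⟩ := hB.quadrangle
  choose r hr0 hr using fun i => exists_mk_eq (Q i)
  have hli : ∀ i j l : Fin 4, i ≠ j → i ≠ l → j ≠ l → LinearIndependent K ![r i, r j, r l] := by
    intro i j l hij hil hjl
    by_contra hn
    have hdet : (Matrix.of ![r i, r j, r l]).det = 0 := by
      by_contra hd
      exact hn (Matrix.linearIndependent_rows_iff_isUnit.2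
        ((Matrix.isUnit_iff_isUnit_det _).2 (isUnit_iff_ne_zero.2 hd)))
    -- A null vector `n` of the matrix gives a linear form vanishing at three points of the
    -- quadrangle; its kernel is a line through them.
    obtain ⟨n, hn0, hn⟩ := Matrix.exists_mulVec_eq_zero_iff.2 hdet
    let f : Module.Dual K (Fin 3 → K) := dotProductBilin K K n
    have hf : ∀ x, f x = n ⬝ᵥ x := fun x => rfl
    have hf0 : f ≠ 0 := by
      intro h
      refine hn0 (dotProduct_eq_zero n fun x => ?_)
      rw [← hf, h, LinearMap.zero_apply]
    have hker := Module.Dual.finrank_ker_add_one_of_ne_zero hf0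
    rw [Module.finrank_fin_fun] at hker
    refine hQ i j l hij hil hjl (LinearMap.ker f) (by omega) ?_
    rw [hr i, hr j, hr l]
    simp only [mk_mem_pts, LinearMap.mem_ker, hf, dotProduct_comm n]
    exact ⟨congrFun hn 0, congrFun hn 1, congrFun hn 2⟩
  have h012 := hli 0 1 2 (by decide) (by decide) (by decide)
  have hmem : r 3 ∈ Submodule.span K (Set.range ![r 0, r 1, r 2]) := by
    rw [h012.span_eq_top_of_card_eq_finrank (by simp)]
    exact Submodule.mem_top
  obtain ⟨a, b, c, habc⟩ := mem_span_range_three.1 hmem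
  change a • r 0 + b • r 1 + c • r 2 = r 3 at habc
  -- A zero coefficient would make the fourth point collinear with two of the others. Rescaling the
  -- first three vectors by `a`, `b`, `c` then turns the fourth into the unit point.
  have ha : a ≠ 0 := by
    rintro rfl
    have := Fintype.linearIndependent_iff.1 (hli 1 2 3 (by decide) (by decide) (by decide))
      ![b, c, -1] (by simp [Fin.sum_univ_three, ← habc]; abel) 2
    simp at this
  have hb : b ≠ 0 := by
    rintro rfl
    have := Fintype.linearIndependent_iff.1 (hli 0 2 3 (by decide) (by decide) (by decide))
      ![a, c, -1] (by simp [Fin.sum_univ_three, ← habc]; abel) 2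
    simp at this
  have hc : c ≠ 0 := by
    rintro rfl
    have := Fintype.linearIndependent_iff.1 (hli 0 1 3 (by decide) (by decide) (by decide))
      ![a, b, -1] (by simp [Fin.sum_univ_three, ← habc]; abel) 2
    simp at this
  have hscale : LinearIndependent K ![a • r 0, b • r 1, c • r 2] := by
    rw [Fintype.linearIndependent_iff] at h012 ⊢
    intro g hg
    have := h012 ![g 0 * a, g 1 * b, g 2 * c] (by
      simpa [Fin.sum_univ_three, smul_smul] using hg)
    intro i
    have hi := this i
    fin_cases i
    · simpa [ha] using hi
    · simpa [hb] using hi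
    · simpa [hc] using hi
  refine ⟨_, hscale, ?_⟩
  have hmk : ∀ (i : Fin 4) (k : K) (hk : k • r i ≠ 0), Projectivization.mk K (k • r i) hk ∈ B := by
    intro i k hk
    convert hQB i
    rw [hr i, Projectivization.mk_eq_mk_iff']
    exact ⟨k, rfl⟩
  let e := basisOfLinearIndependentOfCardEqFinrank hscale (by simp)
  have hee : ⇑e = ![a • r 0, b • r 1, c • r 2] :=
    coe_basisOfLinearIndependentOfCardEqFinrank _ _
  have hne : a • r 0 + b • r 1 + c • r 2 ≠ 0 := habc ▸ hr0 3
  rw [← hee]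
  refine hB.eq_vecPts e ?_ ?_
  · intro i
    fin_cases i
    · simp only [hee]
      exact hmk 0 a _
    · simp only [hee]
      exact hmk 1 b _
    · simp only [hee]
      exact hmk 2 c _
  · have h3 : e 0 + e 1 + e 2 = r 3 := by
      rw [hee, ← habc]
      rfl
    refine ⟨h3 ▸ hr0 3, ?_⟩
    convert hQB 3
    rw [hr 3]
    congr 1

/-- A subplane of order `|F|` is determined by two points on each of two of its lines. -/
theorem IsSubplane.eq_vecPts_of_mem [Finite F] {A : Set (PG2 K)}
    (hA : IsSubplane (Nat.card F) A) {u v w : Fin 3 → K} (h : LinearIndependent K ![u, v, w])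
    (hA' : ∀ x ∈ ({u, u + v, w, v + w} : Set (Fin 3 → K)), ∀ hx : x ≠ 0,
      Projectivization.mk K x hx ∈ A) :
    A = vecPts (Submodule.span F (Set.range ![u, v, w])) := by
  -- The vectors `-u`, `u + v`, `w` add up to `v + w`, so the four given points are the fundamental
  -- frame of this basis.
  have hli : LinearIndependent K ![-u, u + v, w] := by
    rw [Fintype.linearIndependent_iff] at h ⊢
    intro g hg
    have := h ![g 1 - g 0, g 1, g 2] (by
      simp only [Fin.sum_univ_three, cons_val_zero, cons_val_one, cons_val_two] at hg ⊢
      rw [← hg]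
      simp
      module)
    have h0 := this 0
    have h1 := this 1
    have h2 := this 2
    simp only [cons_val_zero, cons_val_one, cons_val_two] at h0 h1 h2
    have h0' : g 0 = 0 := by rw [← neg_eq_zero, ← h0, h1, zero_sub]
    intro i
    fin_cases i <;> assumption
  let e := basisOfLinearIndependentOfCardEqFinrank hli (by simp)
  have hee : ⇑e = ![-u, u + v, w] := coe_basisOfLinearIndependentOfCardEqFinrank _ _
  have hspan : Submodule.span F (Set.range ![u, v, w]) = Submodule.span F (Set.range e) := by
    refine (span_eq_and_linearIndependent h (e.linearIndependent.restrict_scalars' F) ?_).1.symm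
    have h0 : u ∈ Submodule.span F (Set.range ![u, v, w]) := Submodule.subset_span ⟨0, rfl⟩
    have h1 : v ∈ Submodule.span F (Set.range ![u, v, w]) := Submodule.subset_span ⟨1, rfl⟩
    have h2 : w ∈ Submodule.span F (Set.range ![u, v, w]) := Submodule.subset_span ⟨2, rfl⟩
    intro i
    rw [hee]
    fin_cases i
    exacts [Submodule.neg_mem _ h0, Submodule.add_mem _ h0 h1, h2]
  rw [hspan]
  refine hA.eq_vecPts e ?_ ?_
  · intro i
    fin_cases i
    · have hu0 : u ≠ 0 := h.ne_zero 0
      convert hA' u (by simp) hu0 using 1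
      rw [Projectivization.mk_eq_mk_iff']
      exact ⟨-1, by rw [hee]; simp⟩
    · simp only [hee]
      exact hA' (u + v) (by simp) _
    · simp only [hee]
      exact hA' w (by simp) _
  · have h3 : e 0 + e 1 + e 2 = v + w := by
      rw [hee]
      simp
    have hne : v + w ≠ 0 := by
      intro h0
      have := Fintype.linearIndependent_iff.1 h ![0, 1, 1] (by
        simpa [Fin.sum_univ_three] using h0) 1
      simp at this
    refine ⟨h3 ▸ hne, ?_⟩
    simp only [h3]
    exact hA' _ (by simp) _

end Subplanes

/-! ### Conjugation and the transversals of the spread -/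

section Transversals

variable {F K : Type*} [Field F] [Field K] [Algebra F K]

/-- The `K`-linear extension of the inverse Bruck-Bose map, with `t` in place of `τ`. -/
def phi (t : K) : (Fin 7 → K) →ₗ[K] (Fin 3 → K) where
  toFun x := ![x 0 + x 1 * t + x 2 * t ^ 2, x 3 + x 4 * t + x 5 * t ^ 2, x 6]
  map_add' x y := by
    ext i
    fin_cases i <;> simp <;> ring
  map_smul' c x := by
    ext i
    fin_cases i <;> simp <;> ring

@[simp] theorem phi_apply_zero (t : K) (x : Fin 7 → K) :
    phi t x 0 = x 0 + x 1 * t + x 2 * t ^ 2 := rfl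

@[simp] theorem phi_apply_one (t : K) (x : Fin 7 → K) :
    phi t x 1 = x 3 + x 4 * t + x 5 * t ^ 2 := rfl

@[simp] theorem phi_apply_two (t : K) (x : Fin 7 → K) : phi t x 2 = x 6 := rfl

@[simp] theorem ext7_apply (x : Fin 7 → F) (i : Fin 7) :
    (ext7 x : Fin 7 → K) i = algebraMap F K (x i) := rfl

theorem phi_ext7 (t : K) (x : Fin 7 → F) : phi t (ext7 x) = bbInv t x := by
  ext i
  fin_cases i <;> simp [phi, bbInv, Algebra.smul_def]

theorem bbInv_apply_two (t : K) (x : Fin 7 → F) : bbInv t x 2 = algebraMap F K (x 6) := rfl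

theorem ext7_injective : Function.Injective (ext7 : (Fin 7 → F) →ₗ[F] (Fin 7 → K)) := by
  intro x y h
  ext i
  exact (algebraMap F K).injective (congrFun h i)

theorem mem_hyperplaneAtInfinity {x : Fin 7 → K} : x ∈ hyperplaneAtInfinity K ↔ x 6 = 0 := by
  simp [hyperplaneAtInfinity]

theorem mem_lineAtInfinity {x : Fin 3 → K} : x ∈ lineAtInfinity K ↔ x 2 = 0 := by
  simp [lineAtInfinity]

theorem mem_bb_mk {τ : K} {v : Fin 3 → K} {hv : v ≠ 0} {x : Fin 7 → F} :
    x ∈ bb τ (Projectivization.mk K v hv) ↔ ∃ k : K, k • v = bbInv τ x := by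
  simp [bb, Submodule.mem_span_singleton]

variable (K) in
theorem finrank_lineAtInfinity : Module.finrank K (lineAtInfinity K) = 2 := by
  let f : Module.Dual K (Fin 3 → K) := LinearMap.proj (φ := fun _ : Fin 3 => K) 2
  have h0 : f ≠ 0 := by
    intro h
    have := LinearMap.congr_fun h ![0, 0, 1]
    simp [f] at this
  have := Module.Dual.finrank_ker_add_one_of_ne_zero h0
  rw [Module.finrank_fin_fun] at this
  exact Nat.succ_injective this

/-- Each block of three coordinates is the coefficient list of a quadratic, and `phi` evaluates it;
three distinct roots make the quadratic zero. -/
theorem eq_zero_of_phi {r s t : K} (hrs : r ≠ s) (hrt : r ≠ t) (hst : s ≠ t) {x : Fin 7 → K}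
    (hr : phi r x = 0) (hs : phi s x = 0) (ht : phi t x = 0) : x = 0 := by
  have h0 := quadratic_eq_zero hrs hrt hst (congrFun hr 0) (congrFun hs 0) (congrFun ht 0)
  have h1 := quadratic_eq_zero hrs hrt hst (congrFun hr 1) (congrFun hs 1) (congrFun ht 1)
  have h2 : x 6 = 0 := congrFun hr 2
  ext i
  fin_cases i
  exacts [h0.1, h0.2.1, h0.2.2, h1.1, h1.2.1, h1.2.2, h2]

/-- Lagrange interpolation: the witness lists the coefficients of `(X - s)(X - t) / ((r - s)(r -
t))`, scaled by the first two coordinates of `u`. -/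
theorem exists_phi_eq {r s t : K} (hrs : r ≠ s) (hrt : r ≠ t) {u : Fin 3 → K} (hu : u 2 = 0) :
    ∃ x : Fin 7 → K, phi r x = u ∧ phi s x = 0 ∧ phi t x = 0 := by
  have h1 := sub_ne_zero.2 hrs
  have h2 := sub_ne_zero.2 hrt
  refine ⟨((r - s) * (r - t))⁻¹ • ![u 0 * (s * t), -u 0 * (s + t), u 0, u 1 * (s * t),
    -u 1 * (s + t), u 1, 0], ?_, ?_, ?_⟩
  · ext i
    fin_cases i
    · simp
      field_simp
      ring
    · simp
      field_simp
      ring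
    · simp [hu]
  · ext i
    fin_cases i
    · simp
      field_simp
      ring
    · simp
      field_simp
      ring
    · simp
  · ext i
    fin_cases i
    · simp
      field_simp
      ring
    · simp
      field_simp
      ring
    · simp

/-- The line at infinity on which `phi s` and `phi t` vanish. -/
def vanishing (s t : K) : Submodule K (Fin 7 → K) := LinearMap.ker (phi s) ⊓ LinearMap.ker (phi t)

theorem mem_vanishing {s t : K} {x : Fin 7 → K} :
    x ∈ vanishing s t ↔ phi s x = 0 ∧ phi t x = 0 := Iff.rfl

/-- The third evaluation map `phi r` identifies this space with the line at infinity. -/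
theorem finrank_vanishing {r s t : K} (hrs : r ≠ s) (hrt : r ≠ t) (hst : s ≠ t) :
    Module.finrank K (vanishing s t) = 2 := by
  rw [← finrank_lineAtInfinity K]
  let f : vanishing s t →ₗ[K] lineAtInfinity K :=
    (phi r).restrict fun x hx => mem_lineAtInfinity.2 (congrFun hx.1 2)
  refine (LinearEquiv.ofBijective f ⟨?_, ?_⟩).finrank_eq
  · rw [← LinearMap.ker_eq_bot, LinearMap.ker_eq_bot']
    rintro ⟨x, hx⟩ h
    exact Subtype.ext (eq_zero_of_phi hrs hrt hst (congrArg Subtype.val h) hx.1 hx.2)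
  · rintro ⟨u, hu⟩
    obtain ⟨x, h1, h2, h3⟩ := exists_phi_eq hrs hrt (mem_lineAtInfinity.1 hu)
    exact ⟨⟨x, h2, h3⟩, Subtype.ext h1⟩

/-- The plane determinant of the first two coordinates. -/
def det2 (x y : Fin 3 → K) : K := x 0 * y 1 - x 1 * y 0

theorem exists_smul_of_det2 {x y : Fin 3 → K} (hx2 : x 2 = 0) (hy2 : y 2 = 0) (hx : x ≠ 0)
    (h : det2 x y = 0) : ∃ k : K, k • x = y := by
  unfold det2 at h
  by_cases h0 : x 0 = 0
  · have h1 : x 1 ≠ 0 := by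
      intro h1
      refine hx ?_
      ext i
      fin_cases i <;> assumption
    rw [h0, zero_mul, zero_sub, neg_eq_zero, mul_eq_zero] at h
    refine ⟨y 1 / x 1, ?_⟩
    ext i
    fin_cases i
    · simp [h0, h.resolve_left h1]
    · simp [h1]
    · simp [hx2, hy2]
  · refine ⟨y 0 / x 0, ?_⟩
    ext i
    fin_cases i
    · simp [h0]
    · simp only [Fin.mk_one, Pi.smul_apply, smul_eq_mul]
      field_simp
      linear_combination -h
    · simp [hx2, hy2]

/-- A sesquilinear form with respect to two different twists that vanishes on the diagonal is
zero. -/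
theorem eq_zero_of_diagonal {V : Type*} [AddCommGroup V] [Module K V] {g : Submodule K V}
    {D : V → V → K} {α β : K → K} (hl : ∀ u v w, D (u + v) w = D u w + D v w)
    (hr : ∀ u v w, D u (v + w) = D u v + D u w) (hα : ∀ k u v, D (k • u) v = α k * D u v)
    (hβ : ∀ k u v, D u (k • v) = β k * D u v) {k : K} (hk : α k ≠ β k)
    (hd : ∀ v ∈ g, D v v = 0) : ∀ v ∈ g, ∀ w ∈ g, D v w = 0 := by
  have h : ∀ v ∈ g, ∀ w ∈ g, D v w + D w v = 0 := by
    intro v hv w hw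
    have := hd _ (g.add_mem hv hw)
    rw [hl, hr, hr, hd v hv, hd w hw] at this
    simpa using this
  -- After polarisation, replacing `w` by `k • w` weights the two terms by `β k` and `α k`, which
  -- are different; so each term vanishes separately.
  intro v hv w hw
  have h1 := h v hv w hw
  have h2 := h v hv _ (g.smul_mem k hw)
  rw [hα, hβ] at h2
  refine mul_left_cancel₀ (sub_ne_zero.2 hk) ?_
  linear_combination α k * h1 - h2

section Finite

variable [Finite F]

@[simp] theorem conj7_apply (x : Fin 7 → K) (i : Fin 7) : conj7 F x i = frob F (x i) := by
  rw [frob_apply]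
  rfl

theorem conj7_add (x y : Fin 7 → K) : conj7 F (x + y) = conj7 F x + conj7 F y := by
  ext i
  simp

theorem conj7_smul (k : K) (x : Fin 7 → K) : conj7 F (k • x) = frob F k • conj7 F x := by
  ext i
  simp

theorem conj7_ext7 (x : Fin 7 → F) : conj7 F (ext7 x : Fin 7 → K) = ext7 x := by
  ext i
  simp

theorem exists_ext7_eq {y : Fin 7 → K} (hy : conj7 F y = y) : ∃ x : Fin 7 → F, ext7 x = y := by
  have h : ∀ i, y i ∈ Set.range (algebraMap F K) := by
    intro i
    rw [← frob_eq_self_iff, ← conj7_apply, hy]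
  choose x hx using h
  exact ⟨x, funext hx⟩

/-- Frobenius is a ring homomorphism, so conjugating both the point and the node of evaluation
conjugates the value. This moves a vanishing condition from one conjugate of `τ` to the next. -/
theorem phi_conj7 (t : K) (x : Fin 7 → K) (i : Fin 3) :
    phi (frob F t) (conj7 F x) i = frob F (phi t x i) := by
  fin_cases i <;> simp

theorem phi_conj7_eq_zero_iff {t : K} {x : Fin 7 → K} :
    phi (frob F t) (conj7 F x) = 0 ↔ phi t x = 0 := by
  simp only [funext_iff, phi_conj7, Pi.zero_apply, map_eq_zero]

theorem frob_bbInv (t : K) (x : Fin 7 → F) (i : Fin 3) :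
    frob F (bbInv t x i) = bbInv (frob F t) x i := by
  rw [← phi_ext7, ← phi_ext7, ← phi_conj7, conj7_ext7]

variable (hK : Module.finrank F K = 3) {τ : K} (hτ : τ ∉ Set.range (algebraMap F K))

include hK

theorem conj7_conj7_conj7 (x : Fin 7 → K) : conj7 F (conj7 F (conj7 F x)) = x := by
  ext i
  simp only [conj7_apply, frob_frob_frob hK]

theorem phi_conj7_eq_zero {x : Fin 7 → K} :
    phi τ (conj7 F x) = 0 ↔ phi (frob F (frob F τ)) x = 0 := by
  have := phi_conj7_eq_zero_iff (F := F) (t := frob F (frob F τ)) (x := x)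
  rwa [frob_frob_frob hK] at this

theorem phi_conj7_conj7_eq_zero {x : Fin 7 → K} :
    phi τ (conj7 F (conj7 F x)) = 0 ↔ phi (frob F τ) x = 0 := by
  rw [phi_conj7_eq_zero hK, phi_conj7_eq_zero_iff]

include hτ

theorem bbInv_injective : Function.Injective (bbInv τ : (Fin 7 → F) →ₗ[F] (Fin 3 → K)) := by
  rw [← LinearMap.ker_eq_bot, LinearMap.ker_eq_bot']
  intro x hx
  have h0 := eq_zero_of_quadratic hK hτ (x := x 0) (y := x 1) (z := x 2) (by
    simpa [phi_ext7] using (phi_apply_zero τ (ext7 x)).symm.trans (by rw [phi_ext7, hx]; rfl))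
  have h1 := eq_zero_of_quadratic hK hτ (x := x 3) (y := x 4) (z := x 5) (by
    simpa [phi_ext7] using (phi_apply_one τ (ext7 x)).symm.trans (by rw [phi_ext7, hx]; rfl))
  have h2 : x 6 = 0 := by
    simpa [bbInv_apply_two] using congrFun hx 2
  ext i
  fin_cases i
  exacts [h0.1, h0.2.1, h0.2.2, h1.1, h1.2.1, h1.2.2, h2]

theorem exists_bbInv_eq {v : Fin 3 → K} (hv : v 2 ∈ Set.range (algebraMap F K)) :
    ∃ x : Fin 7 → F, bbInv τ x = v := by
  obtain ⟨z, hz⟩ := hv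
  obtain ⟨a, b, c, h0⟩ := exists_eq_quadratic hK hτ (v 0)
  obtain ⟨a', b', c', h1⟩ := exists_eq_quadratic hK hτ (v 1)
  refine ⟨![a, b, c, a', b', c', z], ?_⟩
  rw [← phi_ext7]
  ext i
  fin_cases i
  · simpa using h0
  · simpa using h1
  · simpa using hz

theorem finrank_comap_bbInv {N : Submodule F (Fin 3 → K)}
    (hN : ∀ v ∈ N, v 2 ∈ Set.range (algebraMap F K)) :
    Module.finrank F (N.comap (bbInv τ)) = Module.finrank F N := by
  have h1 : (N.comap (bbInv τ)).map (bbInv τ) = N :=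
    Submodule.map_comap_eq_of_le fun v hv => exists_bbInv_eq hK hτ (hN v hv)
  rw [((N.comap (bbInv τ)).equivMapOfInjective _ (bbInv_injective hK hτ)).finrank_eq, h1]

theorem finrank_bb {U : PG2 K} (hU : U ∈ pts (lineAtInfinity K)) :
    Module.finrank F (bb (F := F) τ U) = 3 := by
  obtain ⟨u, hu, rfl⟩ := exists_mk_eq U
  rw [mk_mem_lineAtInfinity] at hU
  rw [bb, finrank_comap_bbInv hK hτ]
  · have := ((LinearEquiv.toSpanNonzeroSingleton K (Fin 3 → K) u hu).restrictScalars F).finrank_eq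
    rw [hK] at this
    exact this.symm
  · intro v hv
    obtain ⟨k, rfl⟩ := Submodule.mem_span_singleton.1 hv
    exact ⟨0, by simp [hU]⟩

/-- The line on which the conjugates of the inverse Bruck-Bose map vanish is a transversal. -/
theorem isTransversal_vanishing :
    IsTransversal F τ (vanishing (frob F τ) (frob F (frob F τ))) := by
  obtain ⟨h01, h02, h12⟩ := frob_ne hK hτ
  refine ⟨finrank_vanishing h01 h02 h12, ?_, ?_, ?_⟩
  · intro x hx
    exact mem_hyperplaneAtInfinity.2 (congrFun hx.1 2)
  · intro x hx
    refine ext7_injective (K := K) ?_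
    rw [map_zero]
    refine eq_zero_of_phi h01 h02 h12 ?_ hx.1 hx.2
    rw [← phi_conj7_eq_zero_iff (F := F), conj7_ext7]
    exact hx.1
  -- Each of the three conjugate evaluation maps kills two of `v`, `v^q`, `v^(q²)`, so it reads off
  -- one coefficient of a combination. A point over `F` has conjugate values, which forces the
  -- coefficients to be `a`, `a^q`, `a^(q²)`.
  have key : ∀ v ∈ vanishing (frob F τ) (frob F (frob F τ)), ∀ hu : phi τ v ≠ 0,
      ((Submodule.span K {v, conj7 F v, conj7 F (conj7 F v)}).restrictScalars F).comap ext7 =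
        bb τ (Projectivization.mk K (phi τ v) hu) := by
    intro v hv hu
    have h1 : phi τ (conj7 F v) = 0 := (phi_conj7_eq_zero hK).2 hv.2
    have h2 : phi τ (conj7 F (conj7 F v)) = 0 := (phi_conj7_conj7_eq_zero hK).2 hv.1
    have h3 : phi (frob F τ) (conj7 F (conj7 F v)) = 0 := phi_conj7_eq_zero_iff.2 h1
    ext x
    rw [mem_bb_mk, ← phi_ext7]
    simp only [Submodule.mem_comap, Submodule.restrictScalars_mem, Submodule.mem_span_triple]
    constructor
    · rintro ⟨a, b, c, h⟩
      refine ⟨a, ?_⟩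
      rw [← h, map_add, map_add, map_smul, map_smul, map_smul, h1, h2]
      simp
    · rintro ⟨a, ha⟩
      refine ⟨a, frob F a, frob F (frob F a), ?_⟩
      have h4 : phi (frob F τ) (conj7 F v) = fun i => frob F (phi τ v i) := by
        ext i
        rw [phi_conj7]
      have h6 : phi (frob F (frob F τ)) (conj7 F (conj7 F v)) =
          fun i => frob F (frob F (phi τ v i)) := by
        ext i
        rw [phi_conj7, phi_conj7]
      have h7 : phi (frob F (frob F τ)) (conj7 F v) = 0 := phi_conj7_eq_zero_iff.2 hv.1
      have h8 : phi (frob F τ) (ext7 x) = frob F a • fun i => frob F (phi τ v i) := by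
        ext i
        rw [← conj7_ext7, phi_conj7, ← ha]
        simp only [Pi.smul_apply, smul_eq_mul, map_mul]
      have h9 : phi (frob F (frob F τ)) (ext7 x) =
          frob F (frob F a) • fun i => frob F (frob F (phi τ v i)) := by
        ext i
        rw [← conj7_ext7, phi_conj7, h8]
        simp only [Pi.smul_apply, smul_eq_mul, map_mul]
      rw [← sub_eq_zero]
      refine eq_zero_of_phi h01 h02 h12 ?_ ?_ ?_
      · rw [map_sub, map_add, map_add, map_smul, map_smul, map_smul, h1, h2, ← ha]
        simp
      · rw [map_sub, map_add, map_add, map_smul, map_smul, map_smul, hv.1, h3, h4, h8]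
        simp
      · rw [map_sub, map_add, map_add, map_smul, map_smul, map_smul, hv.2, h7, h6, h9]
        simp
  ext W
  constructor
  · rintro ⟨v, hv, hv0, rfl⟩
    have hu : phi τ v ≠ 0 := fun h => hv0 (eq_zero_of_phi h01 h02 h12 h hv.1 hv.2)
    refine ⟨Projectivization.mk K (phi τ v) hu, ?_, key v hv hu⟩
    rw [mk_mem_lineAtInfinity]
    exact congrFun hv.1 2
  · rintro ⟨U, hU, rfl⟩
    obtain ⟨u, hu, rfl⟩ := exists_mk_eq U
    rw [mk_mem_lineAtInfinity] at hU
    obtain ⟨v, hv, hv1, hv2⟩ := exists_phi_eq h01 h02 hU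
    refine ⟨v, ⟨hv1, hv2⟩, ?_, ?_⟩
    · rintro rfl
      exact hu (by rw [← hv, map_zero])
    · subst hv
      exact (key v ⟨hv1, hv2⟩ hu).symm

/-- A plane that is spanned by conjugate points and meets `PG(6,F)` in a spread element contains
only points of the extended spread element. -/
theorem exists_smul_eq_phi {v : Fin 7 → K} (hv : v 6 = 0) {u : Fin 3 → K} {hu : u ≠ 0}
    (hu2 : u 2 = 0)
    (h : ((Submodule.span K {v, conj7 F v, conj7 F (conj7 F v)}).restrictScalars F).comap ext7 =
      bb τ (Projectivization.mk K u hu)) (i : Fin 3) :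
    ∃ k : K, k • u = phi τ ((conj7 F)^[i] v) := by
  obtain ⟨h01, h02, h12⟩ := frob_ne hK hτ
  -- The trace-like vector `kv + (kv)^q + (kv)^(q²)` is fixed by conjugation, so it comes from
  -- `PG(6,F)` and lies in the spread element.
  have htr : ∀ k : K, det2 u (phi τ (k • v + frob F k • conj7 F v +
      frob F (frob F k) • conj7 F (conj7 F v))) = 0 := by
    intro k
    have hfix : conj7 F (k • v + frob F k • conj7 F v +
        frob F (frob F k) • conj7 F (conj7 F v)) = k • v + frob F k • conj7 F v +
        frob F (frob F k) • conj7 F (conj7 F v) := by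
      simp only [conj7_add, conj7_smul, conj7_conj7_conj7 hK, frob_frob_frob hK]
      abel
    obtain ⟨x, hx⟩ := exists_ext7_eq hfix
    have hxb : x ∈ bb τ (Projectivization.mk K u hu) := by
      rw [← h]
      simp only [Submodule.mem_comap, Submodule.restrictScalars_mem, Submodule.mem_span_triple]
      exact ⟨_, _, _, hx.symm⟩
    obtain ⟨a, ha⟩ := mem_bb_mk.1 hxb
    rw [← hx, phi_ext7, ← ha]
    simp only [det2, Pi.smul_apply, smul_eq_mul]
    ring
  have hexp : ∀ k : K, k * det2 u (phi τ v) + frob F k * det2 u (phi τ (conj7 F v)) +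
      frob F (frob F k) * det2 u (phi τ (conj7 F (conj7 F v))) = 0 := by
    intro k
    rw [← htr k]
    simp only [det2, map_add, map_smul, Pi.add_apply, Pi.smul_apply, smul_eq_mul]
    ring
  -- The values `1`, `τ`, `τ²` of `k` give a Vandermonde system in the three determinants, with
  -- distinct nodes `τ`, `τ^q`, `τ^(q²)`.
  have h1 := hexp 1
  have h2 := hexp τ
  have h3 := hexp (τ ^ 2)
  simp only [map_one, one_mul] at h1
  simp only [map_pow] at h3
  obtain ⟨d0, d1, d2⟩ := vandermonde_eq_zero h01 h02 h12 h1 h2 h3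
  refine exists_smul_of_det2 hu2 ?_ hu ?_
  · fin_cases i <;> simp [hv]
  · fin_cases i <;> assumption

/-- The spread has exactly three transversals. -/
theorem IsTransversal.eq_vanishing {g : Submodule K (Fin 7 → K)} (hg : IsTransversal F τ g) :
    g = vanishing (frob F τ) (frob F (frob F τ)) ∨ g = vanishing τ (frob F (frob F τ)) ∨
      g = vanishing τ (frob F τ) := by
  obtain ⟨h01, h02, h12⟩ := frob_ne hK hτ
  have hg6 : ∀ v ∈ g, v 6 = 0 := fun v hv => mem_hyperplaneAtInfinity.1 (hg.infinity hv)
  -- The map `p i` is semilinear with twist `frob^i`. Up to conjugation, `p 1` and `p 2` are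
  -- evaluation at `τ^(q²)` and `τ^q`, so it suffices to show that two of the three maps vanish on
  -- `g`.
  set p : Fin 3 → (Fin 7 → K) → Fin 3 → K := fun i v => phi τ ((conj7 F)^[i] v) with hp
  have hp2 : ∀ i, ∀ v ∈ g, p i v 2 = 0 := by
    intro i v hv
    fin_cases i <;> simp [hp, hg6 v hv]
  have hpu : ∀ v ∈ g, v ≠ 0 → ∃ u : Fin 3 → K, u ≠ 0 ∧ u 2 = 0 ∧ ∀ i, ∃ k : K, k • u = p i v := by
    intro v hv hv0
    obtain ⟨U, hU, hW⟩ := hg.spread.subset ⟨v, hv, hv0, rfl⟩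
    obtain ⟨u, hu, rfl⟩ := exists_mk_eq U
    rw [mk_mem_lineAtInfinity] at hU
    exact ⟨u, hu, hU, exists_smul_eq_phi hK hτ (hg6 v hv) hU hW⟩
  have hpadd : ∀ i v w, p i (v + w) = p i v + p i w := by
    intro i v w
    fin_cases i <;> simp [hp, conj7_add]
  have hpsmul : ∀ i k v, p i (k • v) = ((frob F : K →ₐ[F] K)^[i] k) • p i v := by
    intro i k v
    fin_cases i <;> simp [hp, conj7_smul]
  have hfne : ∀ i j : Fin 3, i ≠ j → (frob F : K →ₐ[F] K)^[i] τ ≠ (frob F : K →ₐ[F] K)^[j] τ := by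
    intro i j hij
    fin_cases i <;> fin_cases j <;>
      simp [h01, h02, h12, h01.symm, h02.symm, h12.symm] at hij ⊢
  -- For a single `v` the vectors `p i v` and `p j v` are parallel; since the twists differ at `τ`,
  -- this extends to pairs of vectors of `g`.
  have hdet : ∀ i j, i ≠ j → ∀ v ∈ g, ∀ w ∈ g, det2 (p i v) (p j w) = 0 := by
    intro i j hij
    refine eq_zero_of_diagonal (D := fun v w => det2 (p i v) (p j w)) (α := (frob F : K →ₐ[F] K)^[i])
      (β := (frob F : K →ₐ[F] K)^[j]) ?_ ?_ ?_ ?_ (hfne i j hij) ?_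
    · intro u v w
      simp only [det2, hpadd, Pi.add_apply]
      ring
    · intro u v w
      simp only [det2, hpadd, Pi.add_apply]
      ring
    · intro k u v
      simp only [det2, hpsmul, Pi.smul_apply, smul_eq_mul]
      ring
    · intro k u v
      simp only [det2, hpsmul, Pi.smul_apply, smul_eq_mul]
      ring
    · intro v hv
      by_cases hv0 : v = 0
      · have : p i v = 0 := by
          rw [hv0, ← zero_smul K (0 : Fin 7 → K), hpsmul]
          fin_cases i <;> simp
        simp [det2, this]
      obtain ⟨u, -, -, h⟩ := hpu v hv hv0
      obtain ⟨a, ha⟩ := h i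
      obtain ⟨b, hb⟩ := h j
      rw [← ha, ← hb]
      simp only [det2, Pi.smul_apply, smul_eq_mul]
      ring
  have hpzero : ∀ v, (∀ i, p i v = 0) → v = 0 := fun v h =>
    eq_zero_of_phi h01 h02 h12 (h 0) ((phi_conj7_conj7_eq_zero hK).1 (h 2))
      ((phi_conj7_eq_zero hK).1 (h 1))
  -- If all values were multiples of one `u`, a vector of `g` belonging to the spread element of
  -- another direction `u'` would have all its values parallel to both, hence zero.
  have hno : ∀ u : Fin 3 → K, u ≠ 0 → u 2 = 0 →
      ¬ ∀ v ∈ g, ∀ i, ∃ k : K, k • u = p i v := by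
    intro u hu hu2 hall
    obtain ⟨u', hu', hu'2, hind⟩ : ∃ u' : Fin 3 → K, u' ≠ 0 ∧ u' 2 = 0 ∧ det2 u u' ≠ 0 := by
      by_cases h0 : u 0 = 0
      · have h1 : u 1 ≠ 0 := by
          intro h1
          refine hu ?_
          ext i
          fin_cases i <;> assumption
        exact ⟨![1, 0, 0], by simp, by simp, by simp [det2, h1]⟩
      · exact ⟨![0, 1, 0], by simp, by simp, by simp [det2, h0]⟩
    obtain ⟨v, hv, hv0, hW⟩ := hg.spread.superset
      ⟨Projectivization.mk K u' hu', mk_mem_lineAtInfinity.2 hu'2, rfl⟩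
    refine hv0 (hpzero v fun i => ?_)
    obtain ⟨a, ha⟩ := hall v hv i
    obtain ⟨b, hb⟩ := exists_smul_eq_phi hK hτ (hg6 v hv) hu'2 hW.symm i
    have hab : a • u = b • u' := ha.trans hb.symm
    have h0 : a * u 0 = b * u' 0 := congrFun hab 0
    have h1 : a * u 1 = b * u' 1 := congrFun hab 1
    have : a * det2 u u' = 0 := by
      unfold det2
      linear_combination u' 1 * h0 - u' 0 * h1
    rw [← ha, (mul_eq_zero.1 this).resolve_right hind, zero_smul]
  -- If neither `p i` nor `p j` vanished on `g`, parallelism between different indices would make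
  -- every value parallel to `p i v`; for the index `i` itself, `p j w` is the intermediary.
  have hpair : ∀ i j, i ≠ j → (∀ v ∈ g, p i v = 0) ∨ (∀ v ∈ g, p j v = 0) := by
    intro i j hij
    by_contra! hcon
    obtain ⟨⟨v, hv, hv0⟩, w, hw, hw0⟩ := hcon
    refine hno (p i v) hv0 (hp2 i v hv) fun x hx l => ?_
    by_cases hl : l = i
    · subst hl
      obtain ⟨a, ha⟩ := exists_smul_of_det2 (hp2 j w hw) (hp2 l v hv) hw0
        (hdet j l hij.symm w hw v hv)
      obtain ⟨b, hb⟩ := exists_smul_of_det2 (hp2 j w hw) (hp2 l x hx) hw0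
        (hdet j l hij.symm w hw x hx)
      have ha0 : a ≠ 0 := fun h => hv0 (by rw [← ha, h, zero_smul])
      refine ⟨b * a⁻¹, ?_⟩
      rw [← ha, ← hb, smul_smul, inv_mul_cancel_right₀ ha0]
    · exact exists_smul_of_det2 (hp2 i v hv) (hp2 l x hx) hv0 (hdet i l (Ne.symm hl) v hv x hx)
  have hle : ∀ s t : K, Module.finrank K (vanishing s t) = 2 →
      (∀ v ∈ g, phi s v = 0 ∧ phi t v = 0) → g = vanishing s t := fun s t hst h =>
    Submodule.eq_of_le_of_finrank_eq (fun v hv => h v hv) (hg.line.trans hst.symm)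
  have h0 : (∀ v ∈ g, p 0 v = 0) → ∀ v ∈ g, phi τ v = 0 := id
  have h1 : (∀ v ∈ g, p 1 v = 0) → ∀ v ∈ g, phi (frob F (frob F τ)) v = 0 := fun h v hv =>
    (phi_conj7_eq_zero hK).1 (h v hv)
  have h2 : (∀ v ∈ g, p 2 v = 0) → ∀ v ∈ g, phi (frob F τ) v = 0 := fun h v hv =>
    (phi_conj7_conj7_eq_zero hK).1 (h v hv)
  by_cases hz : ∀ v ∈ g, p 0 v = 0
  · right
    rcases hpair 1 2 (by decide) with h | h
    · left
      exact hle _ _ (finrank_vanishing h01.symm h12 h02) fun v hv => ⟨h0 hz v hv, h1 h v hv⟩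
    · right
      exact hle _ _ (finrank_vanishing h02.symm h12.symm h01) fun v hv => ⟨h0 hz v hv, h2 h v hv⟩
  · left
    exact hle _ _ (finrank_vanishing h01 h02 h12) fun v hv =>
      ⟨h2 ((hpair 0 2 (by decide)).resolve_left hz) v hv,
        h1 ((hpair 0 1 (by decide)).resolve_left hz) v hv⟩

end Finite

end Transversals

/-! ### Construction of special conics, special twisted cubics and ruled surfaces -/

section Construction

variable {F K : Type*} [Field F] [Field K] [Algebra F K]

theorem ext7_conicPt (a : Fin 3 → Fin 7 → F) (s t : F) :
    ext7 (conicPt a s t) =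
      conicPt (fun i => (ext7 (a i) : Fin 7 → K)) (algebraMap F K s) (algebraMap F K t) := by
  ext i
  simp [conicPt]

theorem ext7_cubicPt (c : Fin 4 → Fin 7 → F) (s t : F) :
    ext7 (cubicPt c s t) =
      cubicPt (fun i => (ext7 (c i) : Fin 7 → K)) (algebraMap F K s) (algebraMap F K t) := by
  ext i
  simp [cubicPt]

theorem phi_conicPt (r : K) (a : Fin 3 → Fin 7 → F) (s t : K) :
    phi r (conicPt (fun i => (ext7 (a i) : Fin 7 → K)) s t) =
      s ^ 2 • bbInv r (a 0) + (s * t) • bbInv r (a 1) + t ^ 2 • bbInv r (a 2) := by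
  simp only [conicPt, map_add, map_smul, phi_ext7]

theorem phi_cubicPt (r : K) (c : Fin 4 → Fin 7 → F) (s t : K) :
    phi r (cubicPt (fun i => (ext7 (c i) : Fin 7 → K)) s t) =
      s ^ 3 • bbInv r (c 0) + (s ^ 2 * t) • bbInv r (c 1) + (s * t ^ 2) • bbInv r (c 2) +
        t ^ 3 • bbInv r (c 3) := by
  simp only [cubicPt, map_add, map_smul, phi_ext7]

theorem add_mul_ne_zero {θ : K} (hθ : θ ∉ Set.range (algebraMap F K)) {s t : F}
    (hst : (s, t) ≠ 0) : algebraMap F K s + algebraMap F K t * θ ≠ 0 := fun h => by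
  obtain ⟨rfl, rfl⟩ := eq_zero_of_linear hθ h
  exact hst rfl

variable [Finite F]

theorem conj7_conicPt (a : Fin 3 → Fin 7 → F) (s t : K) :
    conj7 F (conicPt (fun i => (ext7 (a i) : Fin 7 → K)) s t) =
      conicPt (fun i => (ext7 (a i) : Fin 7 → K)) (frob F s) (frob F t) := by
  ext i
  simp [conicPt]

theorem conj7_cubicPt (c : Fin 4 → Fin 7 → F) (s t : K) :
    conj7 F (cubicPt (fun i => (ext7 (c i) : Fin 7 → K)) s t) =
      cubicPt (fun i => (ext7 (c i) : Fin 7 → K)) (frob F s) (frob F t) := by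
  ext i
  simp [cubicPt]

theorem conj7_mem_vanishing {r s : K} {x : Fin 7 → K} :
    conj7 F x ∈ vanishing (frob F r) (frob F s) ↔ x ∈ vanishing r s := by
  simp only [mem_vanishing, phi_conj7_eq_zero_iff]

theorem vanishing_comm (r s : K) : vanishing r s = vanishing s r := inf_comm _ _

theorem frob_notMem {θ : K} (hθ : θ ∉ Set.range (algebraMap F K)) :
    frob F θ ∉ Set.range (algebraMap F K) := by
  rw [← frob_eq_self_iff] at hθ ⊢
  exact fun h => hθ (frob_injective F h)

variable (hK : Module.finrank F K = 3) {τ : K} (hτ : τ ∉ Set.range (algebraMap F K))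

include hK

/-- The product is a norm from `K` to `F`. It exchanges division by `s + tθ` for multiplication by
the other two conjugate factors, up to a scalar of `F`. -/
theorem exists_norm_linear_eq {θ : K} (hθ : θ ∉ Set.range (algebraMap F K)) {s t : F}
    (hst : (s, t) ≠ 0) : ∃ n : F, n ≠ 0 ∧ algebraMap F K n =
      (algebraMap F K s + algebraMap F K t * θ) * ((algebraMap F K s + algebraMap F K t * frob F θ) *
        (algebraMap F K s + algebraMap F K t * frob F (frob F θ))) := by
  obtain ⟨n, hn⟩ := exists_norm_eq (F := F) hK (algebraMap F K s + algebraMap F K t * θ)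
  simp only [map_add, map_mul, AlgHom.commutes] at hn
  refine ⟨n, ?_, by rw [hn, mul_assoc]⟩
  rintro rfl
  rw [map_zero, eq_comm, mul_eq_zero, mul_eq_zero] at hn
  rcases hn with (h | h) | h
  · exact add_mul_ne_zero hθ hst h
  · exact add_mul_ne_zero (frob_notMem hθ) hst h
  · exact add_mul_ne_zero (frob_notMem (frob_notMem hθ)) hst h

/-- The elementary symmetric functions of two of the conjugates of `θ` are independent. -/
theorem eq_zero_of_symmetric {θ : K} (hθ : θ ∉ Set.range (algebraMap F K)) {x y z : F}
    (h : algebraMap F K x + algebraMap F K y * (frob F θ + frob F (frob F θ)) +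
      algebraMap F K z * (frob F θ * frob F (frob F θ)) = 0) : x = 0 ∧ y = 0 ∧ z = 0 := by
  obtain ⟨n, hn⟩ := exists_norm_eq (F := F) hK θ
  obtain ⟨r, hr⟩ := exists_trace_eq (F := F) hK θ
  -- Multiplying by `θ` turns the relation into a quadratic in `θ` over `F`, because `θ(θ^q +
  -- θ^(q²)) = rθ - θ²` with `r` the trace, and `θ^(1+q+q²) = n`.
  obtain ⟨h0, h1, h2⟩ := eq_zero_of_quadratic hK hθ (x := z * n) (y := x + y * r) (z := -y) (by
    simp only [map_add, map_mul, map_neg, hn, hr]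
    linear_combination θ * h)
  rw [neg_eq_zero] at h2
  subst h2
  have hx : x = 0 := by simpa using h1
  subst hx
  refine ⟨rfl, rfl, ?_⟩
  have hθ0 : θ ≠ 0 := by
    rintro rfl
    exact hθ ⟨0, map_zero _⟩
  refine (mul_eq_zero.1 h0).resolve_right ?_
  rintro rfl
  rw [map_zero] at hn
  simp [hθ0] at hn

include hτ

/-- A point at which a curve over `F` meets one transversal has conjugates on the other
transversals. -/
theorem exists_mem_transversal {f : K → K → Fin 7 → K}
    (hf : ∀ s t, conj7 F (f s t) = f (frob F s) (frob F t)) {s t : K} (hst : (s, t) ≠ 0)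
    (h : f s t ∈ vanishing (frob F τ) (frob F (frob F τ))) {g : Submodule K (Fin 7 → K)}
    (hg : IsTransversal F τ g) : ∃ s t : K, (s, t) ≠ 0 ∧ f s t ∈ g := by
  have hne : ∀ s t : K, (s, t) ≠ 0 → (frob F s, frob F t) ≠ 0 := by
    intro s t hst
    simpa using hst
  have h1 : f (frob F s) (frob F t) ∈ vanishing τ (frob F (frob F τ)) := by
    rw [← hf, vanishing_comm]
    have := (conj7_mem_vanishing (F := F)).2 h
    rwa [frob_frob_frob hK] at this
  have h2 : f (frob F (frob F s)) (frob F (frob F t)) ∈ vanishing τ (frob F τ) := by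
    rw [← hf, vanishing_comm]
    have := (conj7_mem_vanishing (F := F)).2 h1
    rwa [frob_frob_frob hK] at this
  rcases hg.eq_vanishing hK hτ with rfl | rfl | rfl
  · exact ⟨s, t, hst, h⟩
  · exact ⟨_, _, hne _ _ hst, h1⟩
  · exact ⟨_, _, hne _ _ (hne _ _ hst), h2⟩

theorem bbInv_ne_zero {x : Fin 7 → F} (hx : x ≠ 0) : bbInv τ x ≠ 0 := by
  rwa [Ne, (injective_iff_map_eq_zero' _).1 (bbInv_injective hK hτ)]

theorem mk_mem_bbSet {X : Set (PG2 K)} {x : Fin 7 → F} {hx : x ≠ 0} :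
    Projectivization.mk F x hx ∈ bbSet τ X ↔
      Projectivization.mk K (bbInv τ x) (bbInv_ne_zero hK hτ hx) ∈ X := by
  constructor
  · rintro ⟨Q, hQ, hx⟩
    obtain ⟨v, hv, rfl⟩ := exists_mk_eq Q
    rw [mk_mem_pts, mem_bb_mk] at hx
    convert hQ using 1
    exact (Projectivization.mk_eq_mk_iff' K _ _ _ _).2 hx
  · intro h
    refine ⟨_, h, ?_⟩
    rw [mk_mem_pts, mem_bb_mk]
    exact ⟨1, one_smul _ _⟩

/-- The special conic in `[v]` with pole at `-θ`. -/
theorem exists_isSpecialConic {v : Fin 3 → K} (hv : v ≠ 0) (hv2 : v 2 = 0) {θ : K}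
    (hθ : θ ∉ Set.range (algebraMap F K)) :
    ∃ a : Fin 3 → Fin 7 → F, IsSpecialConic τ a (Projectivization.mk K v hv) ∧
      conicPt (fun i => (ext7 (a i) : Fin 7 → K)) (-θ) 1 ∈
        vanishing (frob F τ) (frob F (frob F τ)) ∧
      ∀ s t : K, phi τ (conicPt (fun i => (ext7 (a i) : Fin 7 → K)) s t) =
        ((s + t * frob F θ) * (s + t * frob F (frob F θ))) • v := by
  have hex : ∀ k : K, ∃ x : Fin 7 → F, bbInv τ x = k • v := fun k =>
    exists_bbInv_eq hK hτ ⟨0, by simp [hv2]⟩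
  -- The three multipliers of `v` are the coefficients of `(s + tθ^q)(s + tθ^(q²))`.
  obtain ⟨a0, h0⟩ := hex 1
  obtain ⟨a1, h1⟩ := hex (frob F θ + frob F (frob F θ))
  obtain ⟨a2, h2⟩ := hex (frob F θ * frob F (frob F θ))
  let a : Fin 3 → Fin 7 → F := ![a0, a1, a2]
  have hindep : LinearIndependent F a := by
    rw [Fintype.linearIndependent_iff]
    intro g hg
    have h := congrArg (bbInv τ) hg
    rw [Fin.sum_univ_three, map_add, map_add, map_smul, map_smul, map_smul, map_zero] at h
    change g 0 • bbInv τ a0 + g 1 • bbInv τ a1 + g 2 • bbInv τ a2 = 0 at h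
    rw [h0, h1, h2, ← algebraMap_smul K (g 0), ← algebraMap_smul K (g 1),
      ← algebraMap_smul K (g 2), smul_smul, smul_smul, smul_smul, ← add_smul, ← add_smul,
      smul_eq_zero, mul_one] at h
    obtain ⟨e0, e1, e2⟩ := eq_zero_of_symmetric hK hθ (h.resolve_right hv)
    intro i
    fin_cases i <;> assumption
  -- Conjugating the coefficients of `(s + tθ^q)(s + tθ^(q²))` once or twice produces a factor `s +
  -- tθ`, which is zero at `(-θ, 1)`.
  have hvan : conicPt (fun i => (ext7 (a i) : Fin 7 → K)) (-θ) 1 ∈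
      vanishing (frob F τ) (frob F (frob F τ)) := by
    rw [mem_vanishing]
    constructor
    · rw [phi_conicPt]
      ext i
      simp only [Pi.add_apply, Pi.smul_apply, ← frob_bbInv]
      change _ • frob F (bbInv τ a0 i) + _ • frob F (bbInv τ a1 i) + _ • frob F (bbInv τ a2 i) = 0
      rw [h0, h1, h2]
      simp only [Pi.smul_apply, smul_eq_mul, map_mul, map_add, map_one, frob_frob_frob hK]
      ring
    · rw [phi_conicPt]
      ext i
      simp only [Pi.add_apply, Pi.smul_apply, ← frob_bbInv]
      change _ • frob F (frob F (bbInv τ a0 i)) + _ • frob F (frob F (bbInv τ a1 i)) +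
        _ • frob F (frob F (bbInv τ a2 i)) = 0
      rw [h0, h1, h2]
      simp only [Pi.smul_apply, smul_eq_mul, map_mul, map_add, map_one, frob_frob_frob hK]
      ring
  refine ⟨a, ⟨hindep, mk_mem_lineAtInfinity.2 hv2, ?_, ?_⟩, hvan, ?_⟩
  · refine Submodule.eq_of_le_of_finrank_eq (Submodule.span_le.2 ?_) ?_
    · rintro _ ⟨i, rfl⟩
      rw [SetLike.mem_coe, mem_bb_mk]
      fin_cases i
      exacts [⟨_, h0.symm⟩, ⟨_, h1.symm⟩, ⟨_, h2.symm⟩]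
    · rw [finrank_span_eq_card hindep, finrank_bb hK hτ (mk_mem_lineAtInfinity.2 hv2)]
      rfl
  · intro g hg
    exact exists_mem_transversal hK hτ (conj7_conicPt a) (by simp) hvan hg
  · intro s t
    rw [phi_conicPt]
    change s ^ 2 • bbInv τ a0 + (s * t) • bbInv τ a1 + t ^ 2 • bbInv τ a2 = _
    rw [h0, h1, h2]
    module

/-- The special twisted cubic that corresponds to the subline
`{⟨s • v + t • w⟩ | s, t ∈ F}`. -/
theorem exists_isSpecialCubic {v w : Fin 3 → K} (hv2 : v 2 = 1)
    (hθ : w 2 ∉ Set.range (algebraMap F K)) (hu : w - w 2 • v ≠ 0) :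
    ∃ c : Fin 4 → Fin 7 → F, IsSpecialCubic τ c (Projectivization.mk K (w - w 2 • v) hu) ∧
      cubicPt (fun i => (ext7 (c i) : Fin 7 → K)) (-w 2) 1 ∈
        vanishing (frob F τ) (frob F (frob F τ)) ∧
      ∀ s t : K, phi τ (cubicPt (fun i => (ext7 (c i) : Fin 7 → K)) s t) =
        ((s + t * frob F (w 2)) * (s + t * frob F (frob F (w 2)))) • (s • v + t • w) := by
  set θ := w 2 with hwθ
  obtain ⟨n, hn⟩ := exists_norm_eq (F := F) hK θ
  obtain ⟨r, hr⟩ := exists_trace_eq (F := F) hK θ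
  obtain ⟨m, hm⟩ := exists_trace_pair_eq (F := F) hK θ
  -- These are the coefficients of `(s + tθ^q)(s + tθ^(q²))(s v + t w)`. Their last coordinates are
  -- the coefficients 1, `r`, `m`, `n` of the norm form of `s + tθ`, hence lie in `F`.
  obtain ⟨c0, h0⟩ := exists_bbInv_eq hK hτ (v := v) (F := F) ⟨1, by simp [hv2]⟩
  obtain ⟨c1, h1⟩ := exists_bbInv_eq hK hτ (F := F)
    (v := w + (frob F θ + frob F (frob F θ)) • v) ⟨r, by simp [hv2, hr, ← hwθ]; ring⟩
  obtain ⟨c2, h2⟩ := exists_bbInv_eq hK hτ (F := F)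
    (v := (frob F θ + frob F (frob F θ)) • w + (frob F θ * frob F (frob F θ)) • v)
    ⟨m, by simp [hv2, hm, ← hwθ]; ring⟩
  obtain ⟨c3, h3⟩ := exists_bbInv_eq hK hτ (F := F)
    (v := (frob F θ * frob F (frob F θ)) • w) ⟨n, by simp [hn, ← hwθ]; ring⟩
  let c : Fin 4 → Fin 7 → F := ![c0, c1, c2, c3]
  set u := w - θ • v with hudef
  have hu2 : u 2 = 0 := by simp [hudef, hv2, ← hwθ]
  have hU := mk_mem_lineAtInfinity (hv := hu) |>.2 hu2
  have hw : w = u + θ • v := by rw [hudef]; abel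
  have hvu : ∀ x y : K, x • v + y • u = 0 → x = 0 ∧ y = 0 := by
    intro x y hxy
    have hx : x = 0 := by simpa [hv2, hu2] using congrFun hxy 2
    subst hx
    rw [zero_smul, zero_add, smul_eq_zero] at hxy
    exact ⟨rfl, hxy.resolve_right hu⟩
  have hindep : LinearIndependent F c := by
    rw [Fintype.linearIndependent_iff]
    intro g hg
    have h := congrArg (bbInv τ) hg
    rw [Fin.sum_univ_four, map_add, map_add, map_add, map_smul, map_smul, map_smul, map_smul,
      map_zero] at h
    change g 0 • bbInv τ c0 + g 1 • bbInv τ c1 + g 2 • bbInv τ c2 + g 3 • bbInv τ c3 = 0 at h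
    rw [h0, h1, h2, h3, ← algebraMap_smul K (g 0), ← algebraMap_smul K (g 1),
      ← algebraMap_smul K (g 2), ← algebraMap_smul K (g 3), hw] at h
    obtain ⟨hA, hB⟩ := hvu (algebraMap F K (g 0) +
        algebraMap F K (g 1) * (θ + frob F θ + frob F (frob F θ)) + algebraMap F K (g 2) *
        (θ * frob F θ + θ * frob F (frob F θ) + frob F θ * frob F (frob F θ)) +
        algebraMap F K (g 3) * (θ * frob F θ * frob F (frob F θ)))
      (algebraMap F K (g 1) + algebraMap F K (g 2) * (frob F θ + frob F (frob F θ)) +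
        algebraMap F K (g 3) * (frob F θ * frob F (frob F θ))) (by
        rw [← h]
        module)
    obtain ⟨e1, e2, e3⟩ := eq_zero_of_symmetric hK hθ hB
    have e0 : g 0 = 0 := by simpa [e1, e2, e3] using hA
    intro i
    fin_cases i <;> assumption
  have hvan : cubicPt (fun i => (ext7 (c i) : Fin 7 → K)) (-θ) 1 ∈
      vanishing (frob F τ) (frob F (frob F τ)) := by
    rw [mem_vanishing]
    constructor
    · rw [phi_cubicPt]
      ext i
      simp only [Pi.add_apply, Pi.smul_apply, ← frob_bbInv]
      change _ • frob F (bbInv τ c0 i) + _ • frob F (bbInv τ c1 i) + _ • frob F (bbInv τ c2 i) +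
        _ • frob F (bbInv τ c3 i) = 0
      rw [h0, h1, h2, h3]
      simp only [Pi.smul_apply, Pi.add_apply, smul_eq_mul, map_mul, map_add, frob_frob_frob hK]
      ring
    · rw [phi_cubicPt]
      ext i
      simp only [Pi.add_apply, Pi.smul_apply, ← frob_bbInv]
      change _ • frob F (frob F (bbInv τ c0 i)) + _ • frob F (frob F (bbInv τ c1 i)) +
        _ • frob F (frob F (bbInv τ c2 i)) + _ • frob F (frob F (bbInv τ c3 i)) = 0
      rw [h0, h1, h2, h3]
      simp only [Pi.smul_apply, Pi.add_apply, smul_eq_mul, map_mul, map_add, frob_frob_frob hK]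
      ring
  have hzle : Submodule.span F (Set.range c) ⊓ hyperplaneAtInfinity F ≤
      bb τ (Projectivization.mk K u hu) := by
    rintro x ⟨hx, hx6⟩
    rw [mem_bb_mk]
    obtain ⟨g, rfl⟩ := (Submodule.mem_span_range_iff_exists_fun F).1 hx
    have h6 := bbInv_apply_two (K := K) τ (∑ i, g i • c i)
    rw [mem_hyperplaneAtInfinity.1 hx6, map_zero] at h6
    rw [Fin.sum_univ_four, map_add, map_add, map_add, map_smul, map_smul, map_smul,
      map_smul] at h6 ⊢
    change (g 0 • bbInv τ c0 + g 1 • bbInv τ c1 + g 2 • bbInv τ c2 + g 3 • bbInv τ c3) 2 = 0 at h6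
    change ∃ k : K, k • u =
      g 0 • bbInv τ c0 + g 1 • bbInv τ c1 + g 2 • bbInv τ c2 + g 3 • bbInv τ c3
    rw [h0, h1, h2, h3, ← algebraMap_smul K (g 0), ← algebraMap_smul K (g 1),
      ← algebraMap_smul K (g 2), ← algebraMap_smul K (g 3)] at h6 ⊢
    simp only [Pi.add_apply, Pi.smul_apply, smul_eq_mul, hv2, ← hwθ] at h6
    refine ⟨algebraMap F K (g 1) + algebraMap F K (g 2) * (frob F θ + frob F (frob F θ)) +
        algebraMap F K (g 3) * (frob F θ * frob F (frob F θ)), ?_⟩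
    rw [← sub_eq_zero, ← neg_eq_zero, ← zero_smul K v, ← h6, hw]
    module
  refine ⟨c, ⟨hindep, hU, ?_, ?_⟩, hvan, ?_⟩
  -- The intersection has dimension at least `4 + 6 - 7 = 3`, the dimension of a spread element.
  · refine Submodule.eq_of_le_of_finrank_le hzle ?_
    rw [finrank_bb hK hτ hU]
    have h4 : Module.finrank F (Submodule.span F (Set.range c)) = 4 := finrank_span_eq_card hindep
    have h6 : Module.finrank F (hyperplaneAtInfinity F) + 1 = 7 := by
      let f : Module.Dual F (Fin 7 → F) := LinearMap.proj (φ := fun _ : Fin 7 => F) 6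
      have hf0 : f ≠ 0 := by
        intro h
        have := LinearMap.congr_fun h (fun _ => 1)
        simp [f] at this
      have := Module.Dual.finrank_ker_add_one_of_ne_zero hf0
      rwa [Module.finrank_fin_fun] at this
    have h7 := Submodule.finrank_sup_add_finrank_inf_eq (Submodule.span F (Set.range c))
      (hyperplaneAtInfinity F)
    have h8 := Submodule.finrank_le (Submodule.span F (Set.range c) ⊔ hyperplaneAtInfinity F)
    rw [Module.finrank_fin_fun] at h8
    omega
  · intro g hg
    exact exists_mem_transversal hK hτ (conj7_cubicPt c) (by simp) hvan hg
  · intro s t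
    rw [phi_cubicPt]
    change s ^ 3 • bbInv τ c0 + (s ^ 2 * t) • bbInv τ c1 + (s * t ^ 2) • bbInv τ c2 +
      t ^ 3 • bbInv τ c3 = _
    rw [h0, h1, h2, h3]
    module

end Construction

/-! ### The cubics and the ruled surface of a subplane -/

section Surface

variable {F K : Type*} [Field F] [Finite F] [Field K] [Algebra F K]
  (hK : Module.finrank F K = 3) {τ : K} (hτ : τ ∉ Set.range (algebraMap F K))

include hK hτ

/-- The twisted cubic with the standard parametrisation represents the points of a line of a
subplane. -/
theorem cubicPts_eq_bbSet {e : Fin 3 → Fin 3 → K} (he : LinearIndependent K e)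
    {v w : Fin 3 → K} (hvw : LinearIndependent K ![v, w])
    (hv : v ∈ Submodule.span F (Set.range e)) (hw : w ∈ Submodule.span F (Set.range e))
    (hv2 : v 2 = 1) (hθ : w 2 ∉ Set.range (algebraMap F K)) {c : Fin 4 → Fin 7 → F}
    (hc : ∀ s t : K, phi τ (cubicPt (fun i => (ext7 (c i) : Fin 7 → K)) s t) =
      ((s + t * frob F (w 2)) * (s + t * frob F (frob F (w 2)))) • (s • v + t • w)) :
    cubicPts c = bbSet τ (vecPts (Submodule.span F (Set.range e)) ∩
      pts (Submodule.span K {v, w})) := by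
  have hval : ∀ s t : F, bbInv τ (cubicPt c s t) =
      ((algebraMap F K s + algebraMap F K t * frob F (w 2)) *
        (algebraMap F K s + algebraMap F K t * frob F (frob F (w 2)))) • (s • v + t • w) := by
    intro s t
    rw [← phi_ext7, ext7_cubicPt, hc, algebraMap_smul, algebraMap_smul]
  ext x
  obtain ⟨ξ, hξ, rfl⟩ := exists_mk_eq x
  rw [mk_mem_bbSet hK hτ, Set.mem_inter_iff, mk_mem_vecPts, mk_mem_pts]
  constructor
  · rintro ⟨s, t, hst, h⟩
    rw [Projectivization.submodule_mk, Submodule.span_singleton_eq_span_singleton] at h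
    obtain ⟨k, hk⟩ := h
    have hk' : bbInv τ (cubicPt c s t) = algebraMap F K k • bbInv τ ξ := by
      rw [← hk, algebraMap_smul, ← map_smul]
      rfl
    rw [hval] at hk'
    have hk0 : algebraMap F K k ≠ 0 := by simp
    have hne : (algebraMap F K s + algebraMap F K t * frob F (w 2)) *
        (algebraMap F K s + algebraMap F K t * frob F (frob F (w 2))) ≠ 0 :=
      mul_ne_zero (add_mul_ne_zero (frob_notMem hθ) hst)
        (add_mul_ne_zero (frob_notMem (frob_notMem hθ)) hst)
    set d := (algebraMap F K s + algebraMap F K t * frob F (w 2)) *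
        (algebraMap F K s + algebraMap F K t * frob F (frob F (w 2)))
    constructor
    · refine ⟨d⁻¹ * algebraMap F K k, mul_ne_zero (inv_ne_zero hne) hk0, ?_⟩
      rw [mul_smul, ← hk', inv_smul_smul₀ hne]
      exact Submodule.add_mem _ (Submodule.smul_mem _ _ hv) (Submodule.smul_mem _ _ hw)
    · have : bbInv τ ξ = ((algebraMap F K k)⁻¹ * d) • (s • v + t • w) := by
        rw [mul_smul, hk', inv_smul_smul₀ hk0]
      rw [this, ← algebraMap_smul K s, ← algebraMap_smul K t]
      refine Submodule.smul_mem _ _ (Submodule.add_mem _ ?_ ?_) <;>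
        exact Submodule.smul_mem _ _ (Submodule.subset_span (by simp))
  · rintro ⟨⟨k, hk, hkM⟩, hL⟩
    obtain ⟨s, t, hst⟩ := exists_eq_add_of_mem_span he hvw hv hw hkM (Submodule.smul_mem _ k hL)
    have hst0 : (s, t) ≠ 0 := by
      rintro h
      rw [Prod.mk_eq_zero] at h
      rw [h.1, h.2, zero_smul, zero_smul, add_zero, eq_comm, smul_eq_zero] at hst
      exact hst.elim hk (bbInv_ne_zero hK hτ hξ)
    refine ⟨s, t, hst0, ?_⟩
    rw [Projectivization.submodule_mk, Submodule.span_singleton_eq_span_singleton]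
    -- Since `s + tθ = k ξ₆` for `θ = w 2`, dividing the norm `n` by `ξ₆` gives `k` times the
    -- multiplier of the parametrisation; that is the scalar relating `ξ` to the cubic point, and it
    -- lies in `F`.
    obtain ⟨n, hn0, hn⟩ := exists_norm_linear_eq hK hθ hst0
    have h6 : algebraMap F K s + algebraMap F K t * w 2 = k * algebraMap F K (ξ 6) := by
      have := congrFun hst 2
      simpa [hv2, bbInv_apply_two, Algebra.smul_def] using this
    have hξ6 : ξ 6 ≠ 0 := by
      intro h
      rw [h, map_zero, mul_zero] at h6
      exact add_mul_ne_zero hθ hst0 h6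
    have hξ6' : algebraMap F K (ξ 6) ≠ 0 := by simpa using hξ6
    refine ⟨Units.mk0 (n / ξ 6) (div_ne_zero hn0 hξ6), ?_⟩
    refine bbInv_injective hK hτ ?_
    rw [hval, hst, Units.smul_mk0, map_smul, ← algebraMap_smul K (n / ξ 6), smul_smul, map_div₀, hn,
      h6]
    congr 1
    field_simp

/-- The ruled surface of a subplane tangent to the line at infinity. -/
theorem exists_isRuledSurfaceOf {v : Fin 3 → Fin 3 → K} (hv : LinearIndependent K v)
    (h0 : v 0 2 = 1) (h1 : v 1 2 = 0) (hθ : v 2 2 ∉ Set.range (algebraMap F K)) :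
    ∃ (a : Fin 3 → Fin 7 → F) (c : Fin 4 → Fin 7 → F),
      IsRuledSurfaceOf τ (vecPts (Submodule.span F (Set.range v)))
        (Projectivization.mk K (v 1) (hv.ne_zero 1)) a c := by
  set θ := v 2 2 with hθdef
  have hcoord : ∀ x y z : K, x • v 0 + y • v 1 + z • v 2 = 0 → x = 0 ∧ y = 0 ∧ z = 0 := by
    intro x y z h
    have := Fintype.linearIndependent_iff.1 hv ![x, y, z] (by simpa [Fin.sum_univ_three] using h)
    exact ⟨this 0, this 1, this 2⟩
  set u := v 2 - θ • v 0 with hudef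
  have hu : u ≠ 0 := by
    intro h
    have := hcoord (-θ) 0 1 (by rw [← h, hudef]; module)
    exact one_ne_zero this.2.2
  have hu2 : u 2 = 0 := by simp [hudef, h0, ← hθdef]
  obtain ⟨h01, h02, h12⟩ := frob_ne hK hθ
  obtain ⟨t01, t02, t12⟩ := frob_ne hK hτ
  obtain ⟨a, ha, hav, hap⟩ := exists_isSpecialConic hK hτ (hv.ne_zero 1) h1 hθ
  obtain ⟨c, hc, hcv, hcp⟩ := exists_isSpecialCubic hK hτ h0 hθ hu
  have haval : ∀ s t : F, bbInv τ (conicPt a s t) =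
      ((algebraMap F K s + algebraMap F K t * frob F θ) *
        (algebraMap F K s + algebraMap F K t * frob F (frob F θ))) • v 1 := by
    intro s t
    rw [← phi_ext7, ext7_conicPt, hap]
  have hcval : ∀ s t : F, bbInv τ (cubicPt c s t) =
      ((algebraMap F K s + algebraMap F K t * frob F θ) *
        (algebraMap F K s + algebraMap F K t * frob F (frob F θ))) •
          (algebraMap F K s • v 0 + algebraMap F K t • v 2) := by
    intro s t
    rw [← phi_ext7, ext7_cubicPt, hcp]
  -- Conic and cubic share the multiplier, so every point of a generator is a multiple of an
  -- `F`-combination of the basis.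
  have hgen : ∀ s t x y : F, bbInv τ (x • conicPt a s t + y • cubicPt c s t) =
      ((algebraMap F K s + algebraMap F K t * frob F θ) *
        (algebraMap F K s + algebraMap F K t * frob F (frob F θ))) •
          (algebraMap F K (y * s) • v 0 + algebraMap F K x • v 1 + algebraMap F K (y * t) • v 2) := by
    intro s t x y
    rw [map_add, map_smul, map_smul, haval, hcval, ← algebraMap_smul K x, ← algebraMap_smul K y,
      map_mul, map_mul]
    module
  refine ⟨a, c, ⟨ha, ⟨_, ?_, hc⟩, ?_, ?_, ?_⟩⟩
  · intro h
    obtain ⟨k, hk⟩ := (Projectivization.mk_eq_mk_iff' K _ _ _ _).1 h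
    have := hcoord (-θ) (-k) 1 (by rw [neg_smul k, hk]; module)
    exact one_ne_zero this.2.2
  · intro s t s' t' hne
    have hst : (s, t) ≠ 0 := by
      rintro h
      rw [Prod.mk_eq_zero] at h
      simp [h.1, h.2] at hne
    have hst' : (s', t') ≠ 0 := by
      rintro h
      rw [Prod.mk_eq_zero] at h
      simp [h.1, h.2] at hne
    obtain ⟨n, hn0, hn⟩ := exists_norm_linear_eq hK hθ hst
    obtain ⟨n', hn0', hn'⟩ := exists_norm_linear_eq hK hθ hst'
    have hp : (algebraMap F K s + algebraMap F K t * frob F θ) *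
        (algebraMap F K s + algebraMap F K t * frob F (frob F θ)) ≠ 0 := by
      intro h
      rw [h, mul_zero] at hn
      simp [hn0] at hn
    have hp' : (algebraMap F K s' + algebraMap F K t' * frob F θ) *
        (algebraMap F K s' + algebraMap F K t' * frob F (frob F θ)) ≠ 0 := by
      intro h
      rw [h, mul_zero] at hn'
      simp [hn0'] at hn'
    have hne' : algebraMap F K s * algebraMap F K t' - algebraMap F K s' * algebraMap F K t ≠ 0 := by
      rw [← map_mul, ← map_mul, ← map_sub]
      exact (map_ne_zero _).2 (sub_ne_zero.2 hne)
    rw [Submodule.disjoint_def]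
    intro z hz hz'
    obtain ⟨x, y, rfl⟩ := Submodule.mem_span_pair.1 hz
    obtain ⟨x', y', hEq⟩ := Submodule.mem_span_pair.1 hz'
    have hb := congrArg (bbInv τ) hEq
    rw [hgen, hgen] at hb
    set p := (algebraMap F K s + algebraMap F K t * frob F θ) *
        (algebraMap F K s + algebraMap F K t * frob F (frob F θ))
    set p' := (algebraMap F K s' + algebraMap F K t' * frob F θ) *
        (algebraMap F K s' + algebraMap F K t' * frob F (frob F θ))
    obtain ⟨e0, e1, e2⟩ := hcoord
      (p * algebraMap F K (y * s) - p' * algebraMap F K (y' * s'))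
      (p * algebraMap F K x - p' * algebraMap F K x')
      (p * algebraMap F K (y * t) - p' * algebraMap F K (y' * t')) (by
        rw [eq_comm, ← sub_eq_zero] at hb
        rw [← hb]
        module)
    simp only [map_mul] at e0 e2
    have hy : y = 0 := by
      have : algebraMap F K y * (p * (algebraMap F K s * algebraMap F K t' -
          algebraMap F K s' * algebraMap F K t)) = 0 := by
        linear_combination algebraMap F K t' * e0 - algebraMap F K s' * e2
      simpa [hp, hne'] using this
    have hx : x = 0 := by
      -- Multiplying the equality of the `v 1` coefficients by `(s + tθ)(s' + t'θ)` turns both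
      -- multipliers into norms in `F`; then independence of 1 and `θ` applies.
      have e3 : algebraMap F K (x * n * s') + algebraMap F K (x * n * t') * θ =
          algebraMap F K (x' * n' * s) + algebraMap F K (x' * n' * t) * θ := by
        simp only [map_mul, hn, hn']
        linear_combination (algebraMap F K s + algebraMap F K t * θ) *
          (algebraMap F K s' + algebraMap F K t' * θ) * e1
      obtain ⟨e4, e5⟩ := eq_zero_of_linear hθ (x := x * n * s' - x' * n' * s)
        (y := x * n * t' - x' * n' * t) (by
          simp only [map_sub]
          linear_combination e3)
      have : x * n * (s * t' - s' * t) = 0 := by linear_combination s * e5 - t * e4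
      simpa [hn0, sub_ne_zero.2 hne] using this
    rw [hx, hy, zero_smul, zero_smul, add_zero]
  -- The directrices are defined over `F`, so the extended surface is invariant under conjugation
  -- and one transversal suffices.
  · have hstab : ∀ y : Fin 7 → K,
        (∃ s t : K, (s, t) ≠ 0 ∧ y ∈ generator (fun i => (ext7 (a i) : Fin 7 → K))
          (fun i => (ext7 (c i) : Fin 7 → K)) s t) →
        ∃ s t : K, (s, t) ≠ 0 ∧ conj7 F y ∈ generator (fun i => (ext7 (a i) : Fin 7 → K))
          (fun i => (ext7 (c i) : Fin 7 → K)) s t := by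
      rintro y ⟨s, t, hst, hy⟩
      obtain ⟨k, l, rfl⟩ := Submodule.mem_span_pair.1 hy
      refine ⟨frob F s, frob F t, by simpa using hst, ?_⟩
      rw [conj7_add, conj7_smul, conj7_smul, conj7_conicPt, conj7_cubicPt]
      exact Submodule.mem_span_pair.2 ⟨_, _, rfl⟩
    have hmain : ∀ y ∈ vanishing (frob F τ) (frob F (frob F τ)),
        ∃ s t : K, (s, t) ≠ 0 ∧ y ∈ generator (fun i => (ext7 (a i) : Fin 7 → K))
          (fun i => (ext7 (c i) : Fin 7 → K)) s t := by
      intro y hy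
      -- At this parameter both directrix points lie on the transversal, with images `D v 1` and `D
      -- u` under `phi τ`. As `v 1` and `u` span the line at infinity, the generator is the whole
      -- transversal.
      refine ⟨-θ, 1, by simp, ?_⟩
      have hline : lineAtInfinity K = Submodule.span K {v 1, u} := by
        refine eq_span_pair (finrank_lineAtInfinity K) ?_ (mem_lineAtInfinity.2 h1)
          (mem_lineAtInfinity.2 hu2)
        rw [LinearIndependent.pair_iff]
        intro x z hxz
        have := hcoord (-(z * θ)) x z (by rw [← hxz, hudef]; module)
        exact this.2
      have hy2 : phi τ y ∈ lineAtInfinity K := mem_lineAtInfinity.2 (congrFun hy.1 2)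
      rw [hline] at hy2
      obtain ⟨k, l, hkl⟩ := Submodule.mem_span_pair.1 hy2
      have hD : (-θ + 1 * frob F θ) * (-θ + 1 * frob F (frob F θ)) ≠ 0 := by
        refine mul_ne_zero ?_ ?_
        · rw [one_mul, neg_add_eq_sub]
          exact sub_ne_zero.2 h01.symm
        · rw [one_mul, neg_add_eq_sub]
          exact sub_ne_zero.2 h02.symm
      have e0 := hap (-θ) 1
      have e1 := hcp (-θ) 1
      set D := (-θ + 1 * frob F θ) * (-θ + 1 * frob F (frob F θ))
      refine Submodule.mem_span_pair.2 ⟨D⁻¹ * k, D⁻¹ * l, ?_⟩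
      rw [← sub_eq_zero]
      refine eq_zero_of_phi t01 t02 t12 ?_ ?_ ?_
      · rw [map_sub, map_add, map_smul, map_smul, e0, e1, ← hkl, hudef, smul_smul, smul_smul,
          mul_assoc, mul_comm k, inv_mul_cancel_left₀ hD, mul_assoc, mul_comm l,
          inv_mul_cancel_left₀ hD]
        module
      · rw [map_sub, map_add, map_smul, map_smul, hav.1, hcv.1, hy.1]
        simp
      · rw [map_sub, map_add, map_smul, map_smul, hav.2, hcv.2, hy.2]
        simp
    intro g hg Q hQ
    obtain ⟨y, hy, rfl⟩ := exists_mk_eq Q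
    rw [mk_mem_pts] at hQ
    have hgoal : ∃ s t : K, (s, t) ≠ 0 ∧ y ∈ generator (fun i => (ext7 (a i) : Fin 7 → K))
          (fun i => (ext7 (c i) : Fin 7 → K)) s t := by
      rcases hg.eq_vanishing hK hτ with rfl | rfl | rfl
      · exact hmain y hQ
      · have h1 := (conj7_mem_vanishing (F := F)).2 ((conj7_mem_vanishing (F := F)).2 hQ)
        rw [frob_frob_frob hK, vanishing_comm] at h1
        have h2 := hstab _ (hmain _ h1)
        rwa [conj7_conj7_conj7 hK] at h2
      · have h1 := (conj7_mem_vanishing (F := F)).2 hQ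
        have h2 := hstab _ (hstab _ (hmain _ h1))
        rwa [conj7_conj7_conj7 hK] at h2
    obtain ⟨s, t, hst, hy'⟩ := hgoal
    exact ⟨s, t, hst, mk_mem_pts.2 hy'⟩
  · ext x
    obtain ⟨ξ, hξ, rfl⟩ := exists_mk_eq x
    rw [mk_mem_bbSet hK hτ]
    simp only [Set.mem_sdiff, mk_mem_vecPts, mem_lineAtInfinity, mk_mem_pts,
      mem_hyperplaneAtInfinity, bbInv_apply_two, map_eq_zero]
    refine and_congr_left fun hξ6 => ?_
    have hξ6' : algebraMap F K (ξ 6) ≠ 0 := by simpa using hξ6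
    constructor
    · rintro ⟨s, t, hst, h⟩
      rw [mk_mem_pts] at h
      obtain ⟨x, y, rfl⟩ := Submodule.mem_span_pair.1 h
      have hp : (algebraMap F K s + algebraMap F K t * frob F θ) *
          (algebraMap F K s + algebraMap F K t * frob F (frob F θ)) ≠ 0 :=
        mul_ne_zero (add_mul_ne_zero (frob_notMem hθ) hst)
          (add_mul_ne_zero (frob_notMem (frob_notMem hθ)) hst)
      refine ⟨_, inv_ne_zero hp, ?_⟩
      rw [hgen, inv_smul_smul₀ hp, mem_span_range_three]
      exact ⟨y * s, x, y * t, by simp only [algebraMap_smul]⟩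
    · rintro ⟨k, hk, hkM⟩
      obtain ⟨s, x, t, hsxt⟩ := mem_span_range_three.1 hkM
      have h6 : algebraMap F K s + algebraMap F K t * θ = k * algebraMap F K (ξ 6) := by
        have := congrFun hsxt 2
        simpa [h0, h1, ← hθdef, bbInv_apply_two, Algebra.smul_def] using this
      have hst : (s, t) ≠ 0 := by
        rintro h
        rw [Prod.mk_eq_zero] at h
        rw [h.1, h.2] at h6
        simp [hk, hξ6] at h6
      obtain ⟨n, hn0, hn⟩ := exists_norm_linear_eq hK hθ hst
      -- With `p` the multiplier and `n = (s + tθ)p`, the factor `ξ₆ / n` satisfies `p ξ₆ / n = ξ₆ /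
      -- (s + tθ) = k⁻¹`, which undoes the scaling by `k`.
      refine ⟨s, t, hst, mk_mem_pts.2 (Submodule.mem_span_pair.2 ⟨ξ 6 / n * x, ξ 6 / n, ?_⟩)⟩
      refine bbInv_injective hK hτ ?_
      have hn' : algebraMap F K n ≠ 0 := by simpa using hn0
      have hk' : bbInv τ ξ = k⁻¹ • (s • v 0 + x • v 1 + t • v 2) := by
        rw [hsxt, inv_smul_smul₀ hk]
      have hcoef : ((algebraMap F K s + algebraMap F K t * frob F θ) *
          (algebraMap F K s + algebraMap F K t * frob F (frob F θ))) * algebraMap F K (ξ 6 / n) =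
            k⁻¹ := by
        rw [map_div₀]
        field_simp
        rw [hn, h6]
        ring
      rw [hgen, hk', ← hcoef, ← algebraMap_smul K s, ← algebraMap_smul K x, ← algebraMap_smul K t,
        map_mul, map_mul, map_mul]
      module

end Surface

/-! ### The shape of an arbitrary special twisted cubic -/

section SpecialCubic

theorem conicPt_ne_zero {k : Type*} [Field k] {a : Fin 3 → Fin 7 → k} (ha : LinearIndependent k a)
    {s t : k} (hst : (s, t) ≠ 0) : conicPt a s t ≠ 0 := by
  intro h
  have := Fintype.linearIndependent_iff.1 ha ![s ^ 2, s * t, t ^ 2] (by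
    simpa [Fin.sum_univ_three, conicPt] using h)
  have h0 : s ^ 2 = 0 := this 0
  have h2 : t ^ 2 = 0 := this 2
  exact hst (Prod.mk_eq_zero.2 ⟨pow_eq_zero_iff (by norm_num) |>.1 h0,
    pow_eq_zero_iff (by norm_num) |>.1 h2⟩)

theorem cubicPt_ne_zero {k : Type*} [Field k] {c : Fin 4 → Fin 7 → k} (hc : LinearIndependent k c)
    {s t : k} (hst : (s, t) ≠ 0) : cubicPt c s t ≠ 0 := by
  intro h
  have := Fintype.linearIndependent_iff.1 hc ![s ^ 3, s ^ 2 * t, s * t ^ 2, t ^ 3] (by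
    simpa [Fin.sum_univ_four, cubicPt] using h)
  have h0 : s ^ 3 = 0 := this 0
  have h2 : t ^ 3 = 0 := this 3
  exact hst (Prod.mk_eq_zero.2 ⟨pow_eq_zero_iff (by norm_num) |>.1 h0,
    pow_eq_zero_iff (by norm_num) |>.1 h2⟩)

variable {F K : Type*} [Field F] [Finite F] [Field K] [Algebra F K]
  (hK : Module.finrank F K = 3) {τ : K} (hτ : τ ∉ Set.range (algebraMap F K))

include hK hτ

/-- A special twisted cubic meets the hyperplane at infinity in three conjugate points, which are
on the transversals. -/
theorem IsSpecialCubic.exists_root {c : Fin 4 → Fin 7 → F} {U : PG2 K}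
    (hc : IsSpecialCubic τ c U) :
    ∃ ρ : K, ρ ∉ Set.range (algebraMap F K) ∧ c 0 6 ≠ 0 ∧
      phi τ (cubicPt (fun i => (ext7 (c i) : Fin 7 → K)) (frob F ρ) 1) = 0 ∧
      phi τ (cubicPt (fun i => (ext7 (c i) : Fin 7 → K)) (frob F (frob F ρ)) 1) = 0 ∧
      ∀ s t : K, s ^ 3 * algebraMap F K (c 0 6) + s ^ 2 * t * algebraMap F K (c 1 6) +
          s * t ^ 2 * algebraMap F K (c 2 6) + t ^ 3 * algebraMap F K (c 3 6) =
        algebraMap F K (c 0 6) *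
          ((s - ρ * t) * ((s - frob F ρ * t) * (s - frob F (frob F ρ) * t))) := by
  have htr := isTransversal_vanishing hK hτ
  obtain ⟨s, t, hst, hmem⟩ := hc.special _ htr
  -- At `t = 0` the point is `c 0`, which is defined over `F`, whereas a transversal has no such
  -- point. The same reason keeps the parameter `ρ` outside `F`.
  have ht : t ≠ 0 := by
    rintro rfl
    have hs : s ≠ 0 := fun h => hst (by rw [h]; rfl)
    have h1 : cubicPt (fun i => (ext7 (c i) : Fin 7 → K)) s 0 = s ^ 3 • ext7 (c 0) := by
      simp [cubicPt]
    rw [h1, Submodule.smul_mem_iff _ (pow_ne_zero 3 hs)] at hmem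
    exact hc.indep.ne_zero 0 (htr.disjoint _ hmem)
  have hscale : cubicPt (fun i => (ext7 (c i) : Fin 7 → K)) s t =
      t ^ 3 • cubicPt (fun i => (ext7 (c i) : Fin 7 → K)) (s / t) 1 := by
    simp only [cubicPt, smul_add, smul_smul]
    congr 1
    · congr 1
      · congr 1
        · congr 1
          field_simp
        · congr 1
          field_simp
      · congr 1
        field_simp
    · congr 1
      ring
  rw [hscale, Submodule.smul_mem_iff _ (pow_ne_zero 3 ht)] at hmem
  set ρ := s / t
  have hρ : ρ ∉ Set.range (algebraMap F K) := by
    rintro ⟨r, hr⟩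
    rw [← hr, ← map_one (algebraMap F K), ← ext7_cubicPt] at hmem
    exact cubicPt_ne_zero hc.indep (by simp) (htr.disjoint _ hmem)
  obtain ⟨h01, h02, h12⟩ := frob_ne hK hρ
  have hv1 : phi τ (cubicPt (fun i => (ext7 (c i) : Fin 7 → K)) (frob F ρ) 1) = 0 := by
    have := (phi_conj7_eq_zero hK).2 hmem.2
    rwa [conj7_cubicPt, map_one] at this
  have hv2 : phi τ (cubicPt (fun i => (ext7 (c i) : Fin 7 → K)) (frob F (frob F ρ)) 1) = 0 := by
    have := (phi_conj7_conj7_eq_zero hK).2 hmem.1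
    rwa [conj7_cubicPt, conj7_cubicPt, map_one, map_one] at this
  have hroot : ∀ r x : K, phi x (cubicPt (fun i => (ext7 (c i) : Fin 7 → K)) r 1) = 0 →
      r ^ 3 * algebraMap F K (c 0 6) + r ^ 2 * algebraMap F K (c 1 6) +
        r * algebraMap F K (c 2 6) + algebraMap F K (c 3 6) = 0 := by
    intro r x h
    simpa [cubicPt] using congrFun h 2
  have r0 := hroot _ _ hmem.1
  have r1 := hroot _ _ hv1
  have r2 := hroot _ _ hv2
  set z0 := algebraMap F K (c 0 6) with hz0
  -- The last coordinate is a cubic form vanishing at the three conjugates of `ρ`; subtracting `z0`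
  -- times the product of the linear factors leaves a quadratic with three roots.
  obtain ⟨e0, e1, e2⟩ := quadratic_eq_zero h01 h02 h12
    (a := algebraMap F K (c 3 6) + z0 * (ρ * frob F ρ * frob F (frob F ρ)))
    (b := algebraMap F K (c 2 6) -
      z0 * (ρ * frob F ρ + ρ * frob F (frob F ρ) + frob F ρ * frob F (frob F ρ)))
    (c := algebraMap F K (c 1 6) + z0 * (ρ + frob F ρ + frob F (frob F ρ)))
    (by linear_combination r0) (by linear_combination r1) (by linear_combination r2)
  -- If the leading coefficient were zero, the whole cubic would lie at infinity, and a
  -- 4-dimensional span would equal a 3-dimensional spread element.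
  have hc0 : c 0 6 ≠ 0 := by
    intro h
    have hz : z0 = 0 := by rw [hz0, h, map_zero]
    rw [hz] at e0 e1 e2
    have hall : ∀ i, c i 6 = 0 := by
      intro i
      fin_cases i
      · exact h
      · simpa using e2
      · simpa using e1
      · simpa using e0
    have hle : Submodule.span F (Set.range c) ≤ hyperplaneAtInfinity F := by
      rw [Submodule.span_le]
      rintro _ ⟨i, rfl⟩
      exact mem_hyperplaneAtInfinity.2 (hall i)
    have habout := hc.about
    rw [inf_eq_left.2 hle] at habout
    have h4 : Module.finrank F (Submodule.span F (Set.range c)) = 4 :=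
      finrank_span_eq_card hc.indep
    rw [habout, finrank_bb hK hτ hc.infinity] at h4
    simp at h4
  refine ⟨ρ, hρ, hc0, hv1, hv2, fun s t => ?_⟩
  linear_combination t ^ 3 * e0 + s * t ^ 2 * e1 + s ^ 2 * t * e2

/-- All points of a special twisted cubic are affine. -/
theorem IsSpecialCubic.cubicPt_six_ne_zero {c : Fin 4 → Fin 7 → F} {U : PG2 K}
    (hc : IsSpecialCubic τ c U) {s t : F} (hst : (s, t) ≠ 0) : cubicPt c s t 6 ≠ 0 := by
  obtain ⟨ρ, hρ, hc0, -, -, h⟩ := hc.exists_root hK hτ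
  have hst' : (s, -t) ≠ 0 := by simpa using hst
  intro h0
  have h1 := congrArg (algebraMap F K) h0
  have h2 := h (algebraMap F K s) (algebraMap F K t)
  rw [eq_comm] at h2
  simp only [cubicPt, Pi.add_apply, Pi.smul_apply, smul_eq_mul, map_add, map_mul, map_pow,
    map_zero] at h1
  rw [h1, mul_eq_zero, mul_eq_zero, mul_eq_zero] at h2
  have hne : ∀ r : K, r ∉ Set.range (algebraMap F K) →
      algebraMap F K s - r * algebraMap F K t ≠ 0 := by
    intro r hr hz
    refine add_mul_ne_zero hr hst' ?_
    rw [map_neg]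
    linear_combination hz
  rcases h2 with h2 | h2 | h2 | h2
  · exact hc0 (by simpa using h2)
  · exact hne _ hρ h2
  · exact hne _ (frob_notMem hρ) h2
  · exact hne _ (frob_notMem (frob_notMem hρ)) h2

/-- A generator of a ruled surface of a tangent subplane represents the line of the subplane
through an affine point `P` and the point of tangency `T`. -/
theorem IsRuledSurfaceOf.exists_generator {v : Fin 3 → Fin 3 → K} (hv : LinearIndependent K v)
    (h0 : v 0 2 = 1) (h1 : v 1 2 = 0) {a : Fin 3 → Fin 7 → F} {c : Fin 4 → Fin 7 → F}
    (hac : IsRuledSurfaceOf τ (vecPts (Submodule.span F (Set.range v)))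
      (Projectivization.mk K (v 1) (hv.ne_zero 1)) a c) :
    ∃ s t : F, (s, t) ≠ 0 ∧ Module.finrank F (generator a c s t) = 2 ∧
      bb τ (Projectivization.mk K (v 0) (hv.ne_zero 0)) ≤ generator a c s t ∧
      pts (generator a c s t) \ pts (hyperplaneAtInfinity F) =
        bbSet τ ((vecPts (Submodule.span F (Set.range v)) ∩ pts (Submodule.span K {v 0, v 1})) \
          {Projectivization.mk K (v 1) (hv.ne_zero 1)}) := by
  set M := Submodule.span F (Set.range v) with hM
  have hm : ∀ i, v i ∈ M := fun i => Submodule.subset_span ⟨i, rfl⟩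
  have hv01 : LinearIndependent K ![v 0, v 1] := by
    have := hv.comp ![0, 1] (by decide)
    convert this using 1
    ext i : 1
    fin_cases i <;> rfl
  obtain ⟨U, -, hc⟩ := hac.cubic
  obtain ⟨x0, hx0⟩ := exists_bbInv_eq hK hτ (F := F) (v := v 0) ⟨1, by rw [map_one, h0]⟩
  have hx06 : x0 6 = 1 := by
    have := bbInv_apply_two τ x0
    rw [hx0, h0] at this
    exact (algebraMap F K).injective (by rw [← this, map_one])
  have hx0ne : x0 ≠ 0 := by
    rintro rfl
    simp at hx06
  -- The image of `⟨v 0⟩` is an affine point of the surface, which selects the generator.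
  have hmem : Projectivization.mk F x0 hx0ne ∈
      surfacePts a c \ pts (hyperplaneAtInfinity F) := by
    rw [hac.affine, mk_mem_bbSet hK hτ]
    refine ⟨⟨v 0, hm 0, hv.ne_zero 0, by simp only [hx0]⟩, ?_⟩
    rw [mk_mem_lineAtInfinity, hx0, h0]
    exact one_ne_zero
  obtain ⟨⟨s, t, hst, hgen⟩, -⟩ := hmem
  rw [mk_mem_pts] at hgen
  have hsurf : ∀ y : Fin 7 → F, y ∈ generator a c s t → y 6 ≠ 0 →
      ∃ k : K, k ≠ 0 ∧ k • bbInv τ y ∈ M := by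
    intro y hy hy6
    have hy0 : y ≠ 0 := by
      rintro rfl
      exact hy6 rfl
    have : Projectivization.mk F y hy0 ∈ surfacePts a c \ pts (hyperplaneAtInfinity F) :=
      ⟨⟨s, t, hst, mk_mem_pts.2 hy⟩, fun h => hy6 (mem_hyperplaneAtInfinity.1 (mk_mem_pts.1 h))⟩
    rw [hac.affine, mk_mem_bbSet hK hτ] at this
    exact mk_mem_vecPts.1 this.1
  set A := conicPt a s t with hA
  set C := cubicPt c s t with hC
  have hA0 : A ≠ 0 := conicPt_ne_zero hac.conic.indep hst
  have hC6 : C 6 ≠ 0 := hc.cubicPt_six_ne_zero hK hτ hst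
  have hAbb : A ∈ bb τ (Projectivization.mk K (v 1) (hv.ne_zero 1)) := by
    rw [← hac.conic.plane, hA, conicPt]
    refine Submodule.add_mem _ (Submodule.add_mem _ ?_ ?_) ?_ <;>
      exact Submodule.smul_mem _ _ (Submodule.subset_span ⟨_, rfl⟩)
  obtain ⟨k, hk⟩ := mem_bb_mk.1 hAbb
  have hA6 : A 6 = 0 := by
    have := bbInv_apply_two τ A
    rw [← hk] at this
    simpa [h1] using this.symm
  have hk0 : k ≠ 0 := by
    rintro rfl
    rw [zero_smul] at hk
    exact bbInv_ne_zero hK hτ hA0 hk.symm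
  have hAC : LinearIndependent F ![A, C] := by
    rw [LinearIndependent.pair_iff]
    intro x y hxy
    have hy : y = 0 := by simpa [hA6, hC6] using congrFun hxy 6
    subst hy
    rw [zero_smul, add_zero, smul_eq_zero] at hxy
    exact ⟨hxy.resolve_right hA0, rfl⟩
  have hfin : Module.finrank F (generator a c s t) = 2 := by
    have := finrank_span_eq_card hAC
    rwa [range_pair, Fintype.card_fin] at this
  have hx0A : LinearIndependent F ![x0, A] := by
    rw [LinearIndependent.pair_iff]
    intro x y hxy
    have hx : x = 0 := by simpa [hA6, hx06] using congrFun hxy 6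
    subst hx
    rw [zero_smul, zero_add, smul_eq_zero] at hxy
    exact ⟨rfl, hxy.resolve_right hA0⟩
  have hspan : generator a c s t = Submodule.span F {x0, A} :=
    eq_span_pair hfin hx0A hgen (Submodule.subset_span (Set.mem_insert _ _))
  have hval : ∀ x y : F, bbInv τ (x • x0 + y • A) =
      algebraMap F K x • v 0 + (algebraMap F K y * k) • v 1 := by
    intro x y
    rw [map_add, map_smul, map_smul, hx0, ← hk, ← algebraMap_smul K x, ← algebraMap_smul K y,
      smul_smul]
  -- The conic point `A` represents only a `K`-multiple `k v 1`. The affine point `x0 + A` of the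
  -- generator belongs to the subplane, which forces `k` into `F`.
  have hkF : k ∈ Set.range (algebraMap F K) := by
    obtain ⟨l, hl, hlM⟩ := hsurf (x0 + A) (by
      rw [hspan]
      exact Submodule.add_mem _ (Submodule.subset_span (by simp))
        (Submodule.subset_span (by simp))) (by simp [hx06, hA6])
    have hv' : bbInv τ (x0 + A) = v 0 + k • v 1 := by rw [map_add, hx0, hk]
    rw [hv'] at hlM
    obtain ⟨x, y, hxy⟩ := exists_eq_add_of_mem_span hv hv01 (hm 0) (hm 1) hlM
      (Submodule.smul_mem _ _ (Submodule.mem_span_pair.2 ⟨1, k, by rw [one_smul]⟩))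
    rw [← algebraMap_smul K x, ← algebraMap_smul K y] at hxy
    have := LinearIndependent.pair_iff.1 hv01 (algebraMap F K x - l) (algebraMap F K y - l * k) (by
      rw [← sub_eq_zero] at hxy
      rw [← hxy]
      module)
    refine ⟨y / x, ?_⟩
    rw [map_div₀, sub_eq_zero.1 this.1, sub_eq_zero.1 this.2, mul_div_cancel_left₀ _ hl]
  refine ⟨s, t, hst, hfin, ?_, ?_⟩
  · intro y hy
    obtain ⟨l, hl⟩ := mem_bb_mk.1 hy
    have hly : l = algebraMap F K (y 6) := by
      have := bbInv_apply_two τ y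
      rw [← hl] at this
      simpa [h0] using this
    have : y = y 6 • x0 := by
      refine bbInv_injective hK hτ ?_
      rw [map_smul, hx0, ← hl, hly, algebraMap_smul]
    rw [this]
    exact Submodule.smul_mem _ _ hgen
  · ext x
    obtain ⟨y, hy0, rfl⟩ := exists_mk_eq x
    rw [mk_mem_bbSet hK hτ]
    simp only [Set.mem_sdiff, mk_mem_pts, mem_hyperplaneAtInfinity, Set.mem_inter_iff,
      mk_mem_vecPts, Set.mem_singleton_iff, Projectivization.mk_eq_mk_iff']
    constructor
    · rintro ⟨hy, hy6⟩
      refine ⟨⟨hsurf y hy hy6, ?_⟩, ?_⟩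
      · rw [hspan] at hy
        obtain ⟨x, z, rfl⟩ := Submodule.mem_span_pair.1 hy
        rw [hval]
        exact Submodule.mem_span_pair.2 ⟨_, _, rfl⟩
      · rintro ⟨l, hl⟩
        have := bbInv_apply_two τ y
        rw [← hl] at this
        have : algebraMap F K (y 6) = 0 := by simpa [h1] using this.symm
        exact hy6 (by simpa using this)
    · rintro ⟨⟨⟨l, hl, hlM⟩, hL⟩, hT⟩
      obtain ⟨x, z, hxz⟩ := exists_eq_add_of_mem_span hv hv01 (hm 0) (hm 1) hlM
        (Submodule.smul_mem _ l hL)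
      rw [← algebraMap_smul K x, ← algebraMap_smul K z] at hxz
      have h6 : algebraMap F K x = l * algebraMap F K (y 6) := by
        have := congrFun hxz 2
        simpa [h0, h1, bbInv_apply_two, Algebra.smul_def] using this
      have hx : x ≠ 0 := by
        rintro rfl
        refine hT ⟨l⁻¹ * algebraMap F K z, ?_⟩
        rw [map_zero, zero_smul, zero_add] at hxz
        rw [mul_smul, hxz, inv_smul_smul₀ hl]
      have hx' : algebraMap F K x ≠ 0 := by simpa using hx
      have hy6 : y 6 ≠ 0 := by
        intro h
        rw [h, map_zero, mul_zero] at h6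
        exact hx' h6
      have hy6' : algebraMap F K (y 6) ≠ 0 := by simpa using hy6
      refine ⟨?_, hy6⟩
      obtain ⟨κ, rfl⟩ := hkF
      have hκ : κ ≠ 0 := by
        rintro rfl
        exact hk0 (map_zero _)
      rw [hspan, Submodule.mem_span_pair]
      refine ⟨y 6, y 6 * z / (x * κ), bbInv_injective hK hτ ?_⟩
      have hl' : bbInv τ y = l⁻¹ • (algebraMap F K x • v 0 + algebraMap F K z • v 1) := by
        rw [hxz, inv_smul_smul₀ hl]
      have hl'' : l = algebraMap F K x / algebraMap F K (y 6) := by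
        rw [h6, mul_div_cancel_right₀ _ hy6']
      rw [hval, hl', hl'', map_div₀, map_mul, map_mul, smul_add, smul_smul, smul_smul]
      congr 2
      · field_simp
      · field_simp

end SpecialCubic

/-! ### Tangent lines of special twisted cubics -/

section Tangent

variable {F K : Type*} [Field F] [Finite F] [Field K] [Algebra F K]
  (hK : Module.finrank F K = 3) {τ : K} (hτ : τ ∉ Set.range (algebraMap F K))

include hK hτ

/-- The tangent at `⟨v⟩` of a special twisted cubic that represents points of the subline
`{⟨s • v + t • w⟩ | s, t ∈ F}`. -/
theorem IsSpecialCubic.cubicTangent_eq {e : Fin 3 → Fin 3 → K} (he : LinearIndependent K e)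
    {v w : Fin 3 → K} (hvw : LinearIndependent K ![v, w]) {hv0 : v ≠ 0}
    (hv : v ∈ Submodule.span F (Set.range e)) (hw : w ∈ Submodule.span F (Set.range e))
    (hv2 : v 2 = 1) {n : Fin 4 → Fin 7 → F} {U : PG2 K} (hn : IsSpecialCubic τ n U)
    (hsub : cubicPts n ⊆ bbSet τ (vecPts (Submodule.span F (Set.range e)) ∩
      pts (Submodule.span K {v, w})))
    {s₀ t₀ : F} (hst : (s₀, t₀) ≠ 0)
    (hP : bb τ (Projectivization.mk K v hv0) = Submodule.span F {cubicPt n s₀ t₀})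
    {xv xw : Fin 7 → F} (hxv : bbInv τ xv = v) (hxw : bbInv τ xw = w - w 2 • v) :
    cubicTangent n s₀ t₀ = Submodule.span F {xv, xw} := by
  obtain ⟨ρ, hρ, hz0, hr1, hr2, hz⟩ := hn.exists_root hK hτ
  obtain ⟨-, -, h12⟩ := frob_ne hK hρ
  set ρ₁ := frob F ρ
  set ρ₂ := frob F ρ₁
  have hρ₁ : ρ₁ ∉ Set.range (algebraMap F K) := frob_notMem hρ
  have hρ₂ : ρ₂ ∉ Set.range (algebraMap F K) := frob_notMem hρ₁
  have hne : ∀ r : K, r ∉ Set.range (algebraMap F K) → ∀ s t : F, (s, t) ≠ 0 →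
      algebraMap F K s - r * algebraMap F K t ≠ 0 := by
    intro r hr s t hst hz
    have hst' : (s, -t) ≠ 0 := by simpa using hst
    refine add_mul_ne_zero hr hst' ?_
    rw [map_neg]
    linear_combination hz
  obtain ⟨u, hu, rfl⟩ := exists_mk_eq U
  have hu2 : u 2 = 0 := mk_mem_lineAtInfinity.1 hn.infinity
  have hvu : ∀ x y : K, x • v + y • u = 0 → x = 0 ∧ y = 0 := by
    intro x y hxy
    have hx : x = 0 := by simpa [hv2, hu2] using congrFun hxy 2
    subst hx
    rw [zero_smul, zero_add, smul_eq_zero] at hxy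
    exact ⟨rfl, hxy.resolve_right hu⟩
  set w' := w - w 2 • v with hw'
  have hw'0 : w' ≠ 0 := by
    intro h
    have := LinearIndependent.pair_iff.1 hvw (-w 2) 1 (by rw [← h, hw']; module)
    exact one_ne_zero this.2
  have hw'2 : w' 2 = 0 := by simp [hw', hv2]
  have hxv6 : xv 6 = 1 := by
    have := bbInv_apply_two τ xv
    rw [hxv, hv2] at this
    exact (algebraMap F K).injective (by rw [← this, map_one])
  set X := cubicPt n s₀ t₀ with hX
  have hX6 : X 6 ≠ 0 := hn.cubicPt_six_ne_zero hK hτ hst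
  have hXv : X = X 6 • xv := by
    have hXbb : X ∈ bb τ (Projectivization.mk K v hv0) := by
      rw [hP]
      exact Submodule.mem_span_singleton_self _
    obtain ⟨κ, hκ⟩ := mem_bb_mk.1 hXbb
    have : κ = algebraMap F K (X 6) := by
      have := bbInv_apply_two τ X
      rw [← hκ] at this
      simpa [hv2] using this
    refine bbInv_injective hK hτ ?_
    rw [map_smul, hxv, ← hκ, this, algebraMap_smul]
  have hxvX : xv = (X 6)⁻¹ • X := by
    rw [eq_inv_smul_iff₀ hX6]
    exact hXv.symm
  -- The 3-space of the cubic contains `xv` and meets infinity in `[U]`, so subtracting the right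
  -- multiple of `xv` from a coefficient vector lands in `[U]`.
  have hg : ∀ i, ∃ g : K, bbInv τ (n i) = algebraMap F K (n i 6) • v + g • u := by
    intro i
    have hmem : n i - n i 6 • xv ∈ bb τ (Projectivization.mk K u hu) := by
      rw [← hn.about]
      refine ⟨Submodule.sub_mem _ (Submodule.subset_span ⟨i, rfl⟩) (Submodule.smul_mem _ _ ?_), ?_⟩
      · rw [hxvX, hX, cubicPt]
        refine Submodule.smul_mem _ _ ?_
        refine Submodule.add_mem _ (Submodule.add_mem _ (Submodule.add_mem _ ?_ ?_) ?_) ?_ <;>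
          exact Submodule.smul_mem _ _ (Submodule.subset_span ⟨_, rfl⟩)
      · exact mem_hyperplaneAtInfinity.2 (by simp [hxv6])
    obtain ⟨g, hg⟩ := mem_bb_mk.1 hmem
    refine ⟨g, ?_⟩
    rw [hg, map_sub, map_smul, hxv, algebraMap_smul]
    abel
  choose g hg using hg
  have hphi : ∀ s t : K, phi τ (cubicPt (fun i => (ext7 (n i) : Fin 7 → K)) s t) =
      (algebraMap F K (n 0 6) * ((s - ρ * t) * ((s - ρ₁ * t) * (s - ρ₂ * t)))) • v +
        (s ^ 3 * g 0 + s ^ 2 * t * g 1 + s * t ^ 2 * g 2 + t ^ 3 * g 3) • u := by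
    intro s t
    rw [← hz, phi_cubicPt, hg, hg, hg, hg]
    module
  rw [hphi] at hr1 hr2
  have e1 := (hvu _ _ hr1).2
  have e2 := (hvu _ _ hr2).2
  -- The `u`-component is a cubic form vanishing at `ρ₁` and `ρ₂`; its remaining linear factor is `g
  -- 0 s + l t`.
  set l := g 1 + g 0 * (ρ₁ + ρ₂) with hl
  have hg2 : g 2 = g 0 * (ρ₁ * ρ₂) - l * (ρ₁ + ρ₂) := by
    refine mul_left_cancel₀ (sub_ne_zero.2 h12) ?_
    linear_combination e1 - e2
  have hg3 : g 3 = l * (ρ₁ * ρ₂) := by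
    linear_combination e1 - ρ₁ * hg2
  have hg1 : g 1 = l - g 0 * (ρ₁ + ρ₂) := by rw [hl]; ring
  have hval : ∀ s t : F, bbInv τ (cubicPt n s t) =
      (algebraMap F K (n 0 6) * ((algebraMap F K s - ρ * algebraMap F K t) *
        ((algebraMap F K s - ρ₁ * algebraMap F K t) *
          (algebraMap F K s - ρ₂ * algebraMap F K t)))) • v +
        ((g 0 * algebraMap F K s + l * algebraMap F K t) *
          ((algebraMap F K s - ρ₁ * algebraMap F K t) *
            (algebraMap F K s - ρ₂ * algebraMap F K t))) • u := by
    intro s t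
    rw [← phi_ext7, ext7_cubicPt, hphi]
    congr 2
    rw [hg1, hg2, hg3]
    ring
  set S := algebraMap F K s₀ with hS
  set R := algebraMap F K t₀ with hR
  set E := (S - ρ₁ * R) * (S - ρ₂ * R) with hE
  have hE0 : E ≠ 0 := mul_ne_zero (hne _ hρ₁ _ _ hst) (hne _ hρ₂ _ _ hst)
  have hXval : algebraMap F K (X 6) = algebraMap F K (n 0 6) * ((S - ρ * R) * E) ∧
      g 0 * S + l * R = 0 := by
    have h := hval s₀ t₀
    rw [← hX, hXv, map_smul, hxv, ← algebraMap_smul K (X 6)] at h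
    obtain ⟨h1, h2⟩ := hvu (algebraMap F K (n 0 6) * ((S - ρ * R) * E) - algebraMap F K (X 6))
      ((g 0 * S + l * R) * E) (by
        rw [eq_comm, ← sub_eq_zero] at h
        rw [← h]
        module)
    exact ⟨(sub_eq_zero.1 h1).symm, (mul_eq_zero.1 h2).resolve_right hE0⟩
  obtain ⟨hX6val, hlin⟩ := hXval
  -- The linear factor vanishes at the parameter `(s₀, t₀)` of `⟨v⟩`, so it equals `lam (t₀ s - s₀
  -- t)`.
  obtain ⟨lam, hlam0, hlam1⟩ : ∃ lam : K, g 0 = lam * R ∧ l = -(lam * S) := by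
    by_cases ht : t₀ = 0
    · have hs : S ≠ 0 := by
        rw [hS, Ne, map_eq_zero]
        rintro rfl
        exact hst (by rw [ht]; rfl)
      have hR0 : R = 0 := by rw [hR, ht, map_zero]
      rw [hR0, mul_zero, add_zero] at hlin
      refine ⟨-l / S, ?_, ?_⟩
      · rw [hR0, mul_zero]
        exact (mul_eq_zero.1 hlin).resolve_right hs
      · field_simp
    · have hR0 : R ≠ 0 := by rwa [hR, Ne, map_eq_zero]
      refine ⟨g 0 / R, ?_, ?_⟩
      · field_simp
      · field_simp
        linear_combination hlin
  -- If `lam` were zero, `n 0` and `n 1` would have no `u`-component and would be proportional.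
  have hlam : lam ≠ 0 := by
    rintro rfl
    have hl0 : l = 0 := by rw [hlam1]; ring
    have h0 : g 0 = 0 := by rw [hlam0]; ring
    have h1 : g 1 = 0 := by rw [hg1, hl0, h0]; ring
    have hdep : n 1 6 • n 0 + (-n 0 6) • n 1 = 0 := by
      refine bbInv_injective hK hτ ?_
      rw [map_add, map_smul, map_smul, hg, hg, h0, h1, map_zero, ← algebraMap_smul K (n 1 6),
        ← algebraMap_smul K (-n 0 6), map_neg]
      module
    have := Fintype.linearIndependent_iff.1 hn.indep ![n 1 6, -n 0 6, 0, 0] (by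
      simpa [Fin.sum_univ_four] using hdep) 1
    exact hz0 (by simpa using this)
  -- The normalisation makes the linear factor equal to `lam`, so up to the factor `D` the point is
  -- `Z v + lam u`; comparison with a point `x v + z w` of the subline gives both equations.
  have hpoint : ∀ s t : F, t₀ * s - s₀ * t = 1 → ∃ (η : K) (x : F), u = η • w' ∧
      algebraMap F K (n 0 6) * (algebraMap F K s - ρ * algebraMap F K t) =
        lam * η * (algebraMap F K x + w 2) := by
    intro s t hs
    have hst1 : (s, t) ≠ 0 := by
      intro h
      rw [Prod.mk_eq_zero] at h
      simp [h.1, h.2] at hs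
    have hmem : Projectivization.mk F (cubicPt n s t) (cubicPt_ne_zero hn.indep hst1) ∈
        cubicPts n := ⟨s, t, hst1, rfl⟩
    have h := hsub hmem
    rw [mk_mem_bbSet hK hτ, Set.mem_inter_iff, mk_mem_vecPts, mk_mem_pts] at h
    obtain ⟨⟨k, hk, hkM⟩, hL⟩ := h
    obtain ⟨x, z, hxz⟩ := exists_eq_add_of_mem_span he hvw hv hw hkM (Submodule.smul_mem _ k hL)
    have hdet : g 0 * algebraMap F K s + l * algebraMap F K t = lam := by
      have := congrArg (algebraMap F K) hs
      rw [map_sub, map_mul, map_mul, map_one] at this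
      rw [hlam0, hlam1]
      linear_combination lam * this
    rw [hval, hdet, ← algebraMap_smul K x, ← algebraMap_smul K z] at hxz
    have hD0 : (algebraMap F K s - ρ₁ * algebraMap F K t) *
        (algebraMap F K s - ρ₂ * algebraMap F K t) ≠ 0 :=
      mul_ne_zero (hne _ hρ₁ _ _ hst1) (hne _ hρ₂ _ _ hst1)
    set D := (algebraMap F K s - ρ₁ * algebraMap F K t) *
        (algebraMap F K s - ρ₂ * algebraMap F K t)
    set Z := algebraMap F K (n 0 6) * (algebraMap F K s - ρ * algebraMap F K t) with hZ
    have h2 : algebraMap F K x + algebraMap F K z * w 2 = k * (Z * D) := by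
      have := congrFun hxz 2
      simp only [Pi.add_apply, Pi.smul_apply, smul_eq_mul, hv2, hu2] at this
      rw [hZ]
      linear_combination this
    have h3 : algebraMap F K z • w' = (k * (lam * D)) • u := by
      have h4 : algebraMap F K z • w' - (k * (lam * D)) • u =
          (k * (Z * D) - (algebraMap F K x + algebraMap F K z * w 2)) • v := by
        have h5 : algebraMap F K z • w' = algebraMap F K z • w - (algebraMap F K z * w 2) • v := by
          rw [hw']
          module
        rw [h5, eq_sub_of_add_eq' hxz, hZ]
        module
      rwa [h2, sub_self, zero_smul, sub_eq_zero] at h4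
    have hkD : k * (lam * D) ≠ 0 := mul_ne_zero hk (mul_ne_zero hlam hD0)
    have hz0' : algebraMap F K z ≠ 0 := by
      intro h
      rw [h, zero_smul, eq_comm, smul_eq_zero] at h3
      exact h3.elim hkD hu
    refine ⟨(k * (lam * D))⁻¹ * algebraMap F K z, x / z, ?_, ?_⟩
    · rw [mul_smul, h3, inv_smul_smul₀ hkD]
    · rw [map_div₀]
      field_simp
      rw [← mul_comm (w 2)] at h2
      linear_combination -h2
  obtain ⟨s₁, t₁, h1⟩ : ∃ s₁ t₁ : F, t₀ * s₁ - s₀ * t₁ = 1 := by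
    by_cases ht : t₀ = 0
    · have hs : s₀ ≠ 0 := by
        rintro rfl
        exact hst (by rw [ht]; rfl)
      exact ⟨0, -s₀⁻¹, by simp [hs]⟩
    · exact ⟨t₀⁻¹, 0, by simp [ht]⟩
  obtain ⟨η, x₁, hη, hx₁⟩ := hpoint s₁ t₁ h1
  -- Adding `(s₀, t₀)` preserves the normalisation. Subtracting the two equations cancels `w 2` and
  -- leaves a multiple `f` in `F`.
  obtain ⟨η', x₂, hη', hx₂⟩ := hpoint (s₁ + s₀) (t₁ + t₀) (by linear_combination h1)
  have hηη' : η' = η := smul_left_injective K hw'0 (hη'.symm.trans hη)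
  rw [hηη'] at hx₂
  set f := x₂ - x₁ with hf
  have hfval : algebraMap F K (n 0 6) * (S - ρ * R) = lam * η * algebraMap F K f := by
    rw [hf, map_sub]
    simp only [map_add] at hx₂
    linear_combination hx₂ - hx₁
  have hf0 : f ≠ 0 := by
    intro h
    rw [h, map_zero, mul_zero, mul_eq_zero] at hfval
    exact hfval.elim (by simpa using hz0) (hne _ hρ _ _ hst)
  have hf0' : algebraMap F K f ≠ 0 := by simpa using hf0
  -- The derivative of the `u`-component involves `lam η E` once `u` is written in terms of `w'`;
  -- that this lies in `F` is what makes the tangent direction a multiple of `xw` over `F`.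
  have hδ : lam * η * E = algebraMap F K (X 6 / f) := by
    rw [map_div₀, hX6val, eq_div_iff hf0']
    linear_combination -E * hfval
  have hlincomb : ∀ (a b c d : F) (m : F),
      algebraMap F K a * g 0 + algebraMap F K b * g 1 + algebraMap F K c * g 2 +
        algebraMap F K d * g 3 = lam * algebraMap F K m * E →
      ∃ r : F, a • n 0 + b • n 1 + c • n 2 + d • n 3 = r • xv + (m * (X 6 / f)) • xw := by
    intro a b c d m h
    refine ⟨a * n 0 6 + b * n 1 6 + c * n 2 6 + d * n 3 6, bbInv_injective hK hτ ?_⟩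
    have h5 : (algebraMap F K a * g 0 + algebraMap F K b * g 1 + algebraMap F K c * g 2 +
        algebraMap F K d * g 3) * η = algebraMap F K (m * (X 6 / f)) := by
      rw [h, map_mul, ← hδ]
      ring
    have h6 : bbInv τ ((a * n 0 6 + b * n 1 6 + c * n 2 6 + d * n 3 6) • xv +
        (m * (X 6 / f)) • xw) =
        algebraMap F K (a * n 0 6 + b * n 1 6 + c * n 2 6 + d * n 3 6) • v +
          algebraMap F K (m * (X 6 / f)) • w' := by
      rw [map_add, map_smul, map_smul, hxv, hxw, algebraMap_smul, algebraMap_smul]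
    rw [h6, ← h5]
    simp only [map_add, map_smul, map_mul, hg]
    rw [hη, ← algebraMap_smul K a, ← algebraMap_smul K b, ← algebraMap_smul K c,
      ← algebraMap_smul K d]
    module
  -- The `u`-component is `lam (t₀ s - s₀ t)(s - ρ₁ t)(s - ρ₂ t)`, whose first factor is zero at
  -- `(s₀, t₀)`; so its partial derivatives there are `lam t₀ E` and `-lam s₀ E`.
  obtain ⟨r, hr⟩ := hlincomb (3 * s₀ ^ 2) (2 * s₀ * t₀) (t₀ ^ 2) 0 t₀ (by
    rw [hE, hg1, hg2, hlam0, hlam1]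
    simp only [map_mul, map_pow, map_ofNat, map_zero]
    ring)
  obtain ⟨r', hr'⟩ := hlincomb 0 (s₀ ^ 2) (2 * s₀ * t₀) (3 * t₀ ^ 2) (-s₀) (by
    rw [hE, hg1, hg2, hg3, hlam0, hlam1]
    simp only [map_mul, map_pow, map_ofNat, map_zero, map_neg]
    ring)
  rw [zero_smul, add_zero] at hr
  rw [zero_smul, zero_add] at hr'
  have hδ0 : X 6 / f ≠ 0 := div_ne_zero hX6 hf0
  rw [cubicTangent, hr, hr', ← hX]
  apply le_antisymm
  · rw [Submodule.span_le]
    rintro y (rfl | rfl | rfl)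
    · rw [hXv]
      exact Submodule.smul_mem _ _ (Submodule.subset_span (Set.mem_insert _ _))
    · exact Submodule.mem_span_pair.2 ⟨_, _, rfl⟩
    · exact Submodule.mem_span_pair.2 ⟨_, _, rfl⟩
  · have hxvmem : xv ∈ Submodule.span F {X, r • xv + (t₀ * (X 6 / f)) • xw,
        r' • xv + (-s₀ * (X 6 / f)) • xw} := by
      have := Submodule.smul_mem (Submodule.span F {X, r • xv + (t₀ * (X 6 / f)) • xw,
        r' • xv + (-s₀ * (X 6 / f)) • xw}) (X 6)⁻¹ (Submodule.subset_span (Set.mem_insert X _))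
      rwa [← hxvX] at this
    rw [Submodule.span_le]
    rintro y (rfl | rfl)
    · exact hxvmem
    · by_cases ht : t₀ = 0
      · have hs : s₀ ≠ 0 := by
          rintro rfl
          exact hst (by rw [ht]; rfl)
        have hc0 : -s₀ * (X 6 / f) ≠ 0 := mul_ne_zero (neg_ne_zero.2 hs) hδ0
        refine (Submodule.smul_mem_iff _ hc0).1 ((Submodule.add_mem_iff_right _
          (Submodule.smul_mem _ r' hxvmem)).1 (Submodule.subset_span (by simp)))
      · have hc0 : t₀ * (X 6 / f) ≠ 0 := mul_ne_zero ht hδ0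
        refine (Submodule.smul_mem_iff _ hc0).1 ((Submodule.add_mem_iff_right _
          (Submodule.smul_mem _ r hxvmem)).1 (Submodule.subset_span (by simp)))

end Tangent

/-! ### Tangent subplanes in normal form -/

section NormalForm

variable {F K : Type*} [Field F] [Field K] [Algebra F K]

theorem vecPts_smul (v : Fin 3 → Fin 3 → K) {k : K} (hk : k ≠ 0) :
    vecPts (Submodule.span F (Set.range fun i => k • v i)) =
      vecPts (Submodule.span F (Set.range v)) := by
  have hscale : ∀ a b c : F, a • k • v 0 + b • k • v 1 + c • k • v 2 =
      k • (a • v 0 + b • v 1 + c • v 2) := by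
    intro a b c
    rw [smul_add, smul_add, smul_comm a k, smul_comm b k, smul_comm c k]
  ext Q
  obtain ⟨z, hz, rfl⟩ := exists_mk_eq Q
  simp only [mk_mem_vecPts, mem_span_range_three, hscale]
  constructor
  · rintro ⟨l, hl, a, b, c, h⟩
    exact ⟨k⁻¹ * l, mul_ne_zero (inv_ne_zero hk) hl, a, b, c, by
      rw [mul_smul, ← h, inv_smul_smul₀ hk]⟩
  · rintro ⟨l, hl, a, b, c, h⟩
    exact ⟨k * l, mul_ne_zero hk hl, a, b, c, by rw [mul_smul, ← h]⟩

theorem eq_zero_of_linearIndependent_three {v : Fin 3 → Fin 3 → K} (hv : LinearIndependent K v)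
    {x y z : K} (h : x • v 0 + y • v 1 + z • v 2 = 0) : x = 0 ∧ y = 0 ∧ z = 0 := by
  have := Fintype.linearIndependent_iff.1 hv ![x, y, z] (by simpa [Fin.sum_univ_three] using h)
  exact ⟨this 0, this 1, this 2⟩

/-- Coordinates for a subplane tangent to the line at infinity at `T`, and an affine point `P` of
it. -/
theorem exists_normalForm [Finite F] {B : Set (PG2 K)} (hB : IsSubplane (Nat.card F) B)
    {T P : PG2 K} (hT : IsTangentAt B T) (hPB : P ∈ B) (hP : P ∉ pts (lineAtInfinity K)) :
    ∃ (v : Fin 3 → Fin 3 → K) (hv : LinearIndependent K v),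
      B = vecPts (Submodule.span F (Set.range v)) ∧
      P = Projectivization.mk K (v 0) (hv.ne_zero 0) ∧
      T = Projectivization.mk K (v 1) (hv.ne_zero 1) ∧
      v 0 2 = 1 ∧ v 1 2 = 0 ∧ v 2 2 ∉ Set.range (algebraMap F K) := by
  obtain ⟨e, he, hBe⟩ := hB.exists_eq_vecPts
  have hTmem : T ∈ B ∩ pts (lineAtInfinity K) := by
    rw [hT]
    rfl
  obtain ⟨hTB, hTinf⟩ := hTmem
  rw [hBe] at hPB hTB
  obtain ⟨p, hp, hp0, rfl⟩ := hPB
  obtain ⟨t, ht, ht0, rfl⟩ := hTB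
  rw [mk_mem_lineAtInfinity] at hP hTinf
  have hpt : LinearIndependent K ![p, t] := by
    rw [LinearIndependent.pair_iff]
    intro x y hxy
    have hx : x = 0 := by simpa [hTinf, hP] using congrFun hxy 2
    subst hx
    rw [zero_smul, zero_add, smul_eq_zero] at hxy
    exact ⟨rfl, hxy.resolve_right ht0⟩
  obtain ⟨x, hli, hspan⟩ := exists_extend_basis he hpt hp ht
  -- All three vectors are rescaled by the same factor, which leaves the point set of their `F`-span
  -- unchanged.
  have hk : (p 2)⁻¹ ≠ 0 := inv_ne_zero hP
  have hv : LinearIndependent K fun i => (p 2)⁻¹ • ![p, t, x] i :=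
    hli.units_smul fun _ => Units.mk0 _ hk
  have hBv : B = vecPts (Submodule.span F (Set.range fun i => (p 2)⁻¹ • ![p, t, x] i)) := by
    rw [hBe, hspan, vecPts_smul _ hk]
  refine ⟨fun i => (p 2)⁻¹ • ![p, t, x] i, hv, hBv, ?_, ?_, ?_, ?_, ?_⟩
  · exact (Projectivization.mk_eq_mk_iff' K _ _ _ _).2 ⟨p 2, smul_inv_smul₀ hP p⟩
  · exact (Projectivization.mk_eq_mk_iff' K _ _ _ _).2 ⟨p 2, smul_inv_smul₀ hP t⟩
  · exact inv_mul_cancel₀ hP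
  · simp [hTinf]
  · set v : Fin 3 → Fin 3 → K := fun i => (p 2)⁻¹ • ![p, t, x] i with hvdef
    have hv0 : v 0 2 = 1 := inv_mul_cancel₀ hP
    rintro ⟨r, hr⟩
    -- If `v 2 2 = r` were in `F`, the vector `v 2 - r v 0` would give a second point of the
    -- subplane at infinity.
    have hm : v 2 - r • v 0 ∈ Submodule.span F (Set.range v) :=
      Submodule.sub_mem _ (Submodule.subset_span ⟨2, rfl⟩)
        (Submodule.smul_mem _ _ (Submodule.subset_span ⟨0, rfl⟩))
    have hm0 : v 2 - r • v 0 ≠ 0 := by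
      intro h
      have := eq_zero_of_linearIndependent_three hv (x := -algebraMap F K r) (y := 0) (z := 1) (by
        rw [← algebraMap_smul K r] at h
        rw [← h]
        module)
      exact one_ne_zero this.2.2
    have hmem : Projectivization.mk K _ hm0 ∈ B ∩ pts (lineAtInfinity K) := by
      refine ⟨hBv ▸ ⟨_, hm, hm0, rfl⟩, mk_mem_lineAtInfinity.2 ?_⟩
      rw [← algebraMap_smul K r, Pi.sub_apply, Pi.smul_apply, hv0, ← hr]
      simp
    rw [hT, Set.mem_singleton_iff, Projectivization.mk_eq_mk_iff'] at hmem
    obtain ⟨a, ha⟩ := hmem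
    have hvt : t = p 2 • v 1 := (smul_inv_smul₀ hP t).symm
    have := eq_zero_of_linearIndependent_three hv (x := -algebraMap F K r) (y := -(a * p 2))
      (z := 1) (by
        rw [hvt, ← algebraMap_smul K r, ← sub_eq_zero] at ha
        rw [← neg_eq_zero, ← ha]
        module)
    exact one_ne_zero this.2.2

theorem linearIndependent_zero_add {v : Fin 3 → Fin 3 → K} (hv : LinearIndependent K v) {a b : K}
    (hab : (a, b) ≠ 0) : LinearIndependent K ![v 0, a • v 1 + b • v 2] := by
  rw [LinearIndependent.pair_iff]
  intro x y hxy
  obtain ⟨h0, h1, h2⟩ := eq_zero_of_linearIndependent_three hv (x := x) (y := y * a) (z := y * b) (by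
    rw [← hxy]
    module)
  refine ⟨h0, ?_⟩
  by_contra hy
  exact hab (Prod.mk_eq_zero.2 ⟨(mul_eq_zero.1 h1).resolve_left hy,
    (mul_eq_zero.1 h2).resolve_left hy⟩)

theorem isLineOf_vecPts_span {v : Fin 3 → Fin 3 → K} (hv : LinearIndependent K v) {a b : F}
    (hab : (a, b) ≠ 0) : IsLineOf (vecPts (Submodule.span F (Set.range v)))
      (Submodule.span K {v 0, algebraMap F K a • v 1 + algebraMap F K b • v 2}) := by
  have hli := linearIndependent_zero_add hv (a := algebraMap F K a) (b := algebraMap F K b)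
    (by simpa using hab)
  have hm : ∀ i, v i ∈ Submodule.span F (Set.range v) := fun i => Submodule.subset_span ⟨i, rfl⟩
  refine isLineOf_span hli (hv0 := hli.ne_zero 0) (hw0 := hli.ne_zero 1) ⟨_, hm 0, _, rfl⟩
    ⟨_, ?_, _, rfl⟩
  rw [algebraMap_smul, algebraMap_smul]
  exact Submodule.add_mem _ (Submodule.smul_mem _ _ (hm 1)) (Submodule.smul_mem _ _ (hm 2))

theorem exists_eq_span_of_isLineOf {v : Fin 3 → Fin 3 → K} (hv : LinearIndependent K v)
    {L : Submodule K (Fin 3 → K)} (hL : IsLineOf (vecPts (Submodule.span F (Set.range v))) L)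
    (hP : v 0 ∈ L) : ∃ a b : F, (a, b) ≠ 0 ∧
      L = Submodule.span K {v 0, algebraMap F K a • v 1 + algebraMap F K b • v 2} := by
  obtain ⟨Q, ⟨⟨m, hm, hm0, rfl⟩, hmL⟩, hne⟩ :=
    hL.2.exists_ne (Projectivization.mk K (v 0) (hv.ne_zero 0))
  rw [mk_mem_pts] at hmL
  obtain ⟨x, a, b, rfl⟩ := mem_span_range_three.1 hm
  have hab : (a, b) ≠ 0 := by
    intro h
    rw [Prod.mk_eq_zero] at h
    refine hne ?_
    rw [Projectivization.mk_eq_mk_iff']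
    exact ⟨algebraMap F K x, by rw [h.1, h.2, algebraMap_smul]; simp⟩
  refine ⟨a, b, hab, eq_span_pair hL.1 (linearIndependent_zero_add hv (by simpa using hab)) hP ?_⟩
  have : algebraMap F K a • v 1 + algebraMap F K b • v 2 =
      (x • v 0 + a • v 1 + b • v 2) - algebraMap F K x • v 0 := by
    simp only [algebraMap_smul]
    abel
  rw [this]
  exact L.sub_mem hmL (L.smul_mem _ hP)

/-- The tangent subspace exists and is unique. -/
theorem isTangentSubspace_iff [Finite F] {v : Fin 3 → Fin 3 → K} (hv : LinearIndependent K v)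
    (h0 : v 0 2 = 1) (h1 : v 1 2 = 0) {A : Set (PG2 K)} :
    IsTangentSubspace (Nat.card F) (vecPts (Submodule.span F (Set.range v)))
      (Projectivization.mk K (v 1) (hv.ne_zero 1)) (Projectivization.mk K (v 0) (hv.ne_zero 0)) A ↔
    A = vecPts (Submodule.span F (Set.range ![v 0, v 1, v 2 - v 2 2 • v 0])) := by
  set θ := v 2 2 with hθ
  set u := v 2 - θ • v 0 with hu
  have hu2 : u 2 = 0 := by simp [hu, h0, ← hθ]
  have hli : LinearIndependent K ![v 0, v 1, u] := by
    rw [Fintype.linearIndependent_iff]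
    intro g hg
    rw [Fin.sum_univ_three] at hg
    change g 0 • v 0 + g 1 • v 1 + g 2 • u = 0 at hg
    obtain ⟨e0, e1, e2⟩ := eq_zero_of_linearIndependent_three hv (x := g 0 - g 2 * θ) (y := g 1)
      (z := g 2) (by
        rw [← hg, hu]
        module)
    rw [e2, zero_mul, sub_zero] at e0
    intro i
    fin_cases i <;> assumption
  have hline : ∀ L, IsLineOf (vecPts (Submodule.span F (Set.range v))) L → v 0 ∈ L → v 1 ∈ L →
      L = Submodule.span K {v 0, v 1} := by
    intro L hL hP hT
    refine eq_span_pair hL.1 ?_ hP hT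
    simpa using linearIndependent_zero_add hv (a := 1) (b := 0) (by simp)
  have hli01 : LinearIndependent K ![v 0, v 1] := by
    simpa using linearIndependent_zero_add hv (a := 1) (b := 0) (by simp)
  have hm : ∀ i, v i ∈ Submodule.span F (Set.range v) := fun i => Submodule.subset_span ⟨i, rfl⟩
  constructor
  · intro hA
    -- Two points `v 0`, `v 0 + v 1` on `PT` and two points `u`, `v 1 + u` at infinity determine the
    -- subplane.
    refine hA.subplane.eq_vecPts_of_mem hli ?_
    have hinf : ∀ a : F, ∀ hx : a • v 1 + u ≠ 0, Projectivization.mk K _ hx ∈ A := by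
      intro a hx
      refine hA.infinity _ (isLineOf_vecPts_span hv (a := a) (b := 1) (by simp))
        (mk_mem_pts.2 (Submodule.subset_span (by simp))) ⟨mk_mem_pts.2 ?_, ?_⟩
      · refine Submodule.mem_span_pair.2 ⟨-θ, 1, ?_⟩
        rw [hu, ← algebraMap_smul K a, map_one]
        module
      · rw [mk_mem_lineAtInfinity, ← algebraMap_smul K a]
        simp [h1, hu2]
    have hthr : ∀ a : F, ∀ hx : v 0 + a • v 1 ≠ 0, Projectivization.mk K _ hx ∈ A := by
      intro a hx
      refine hA.through _ (isLineOf_vecPts_span hv (a := 1) (b := 0) (by simp))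
        (mk_mem_pts.2 (Submodule.subset_span (by simp)))
        (mk_mem_pts.2 (Submodule.subset_span (by simp)))
        ⟨⟨_, ?_, hx, rfl⟩, mk_mem_pts.2 ?_⟩
      · exact Submodule.add_mem _ (hm 0) (Submodule.smul_mem _ _ (hm 1))
      · refine Submodule.mem_span_pair.2 ⟨1, algebraMap F K a, ?_⟩
        simp
    rintro x (rfl | rfl | rfl | rfl) hx
    · simpa using hthr 0 (by simpa using hx)
    · simpa using hthr 1 (by simpa using hx)
    · simpa using hinf 0 (by simpa using hx)
    · simpa using hinf 1 (by simpa using hx)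
  · rintro rfl
    have hm0 : v 0 ∈ Submodule.span F (Set.range ![v 0, v 1, u]) := Submodule.subset_span ⟨0, rfl⟩
    have hm1 : v 1 ∈ Submodule.span F (Set.range ![v 0, v 1, u]) := Submodule.subset_span ⟨1, rfl⟩
    have hm2 : u ∈ Submodule.span F (Set.range ![v 0, v 1, u]) := Submodule.subset_span ⟨2, rfl⟩
    refine ⟨isSubplane_vecPts hli, ?_, ?_⟩
    · rintro L hL hP Q ⟨hQL, hQinf⟩
      obtain ⟨z, hz, rfl⟩ := exists_mk_eq Q
      rw [mk_mem_pts] at hP hQL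
      rw [mk_mem_lineAtInfinity] at hQinf
      obtain ⟨a, b, -, rfl⟩ := exists_eq_span_of_isLineOf hv hL hP
      obtain ⟨k, l, rfl⟩ := Submodule.mem_span_pair.1 hQL
      -- The vanishing last coordinate determines `k`, and the point at infinity becomes `a v 1 + b
      -- u` with `a`, `b` in `F`.
      have hk : k = -(l * algebraMap F K b * θ) := by
        simp only [Pi.add_apply, Pi.smul_apply, smul_eq_mul, h0, h1, ← hθ] at hQinf
        linear_combination hQinf
      have hEq : k • v 0 + l • (algebraMap F K a • v 1 + algebraMap F K b • v 2) =
          l • (algebraMap F K a • v 1 + algebraMap F K b • u) := by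
        rw [hk, hu]
        module
      have hl : l ≠ 0 := by
        rintro rfl
        exact hz (by rw [hEq, zero_smul])
      rw [mk_mem_vecPts]
      refine ⟨l⁻¹, inv_ne_zero hl, ?_⟩
      rw [hEq, inv_smul_smul₀ hl, algebraMap_smul, algebraMap_smul]
      exact Submodule.add_mem _ (Submodule.smul_mem _ _ hm1) (Submodule.smul_mem _ _ hm2)
    · rintro L hL hP hT Q ⟨⟨z, hz, hz0, rfl⟩, hQL⟩
      rw [mk_mem_pts] at hP hT hQL
      rw [hline L hL hP hT] at hQL
      obtain ⟨x, y, rfl⟩ := exists_eq_add_of_mem_span hv hli01 (hm 0) (hm 1) hz hQL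
      exact ⟨_, Submodule.add_mem _ (Submodule.smul_mem _ _ hm0) (Submodule.smul_mem _ _ hm1), hz0,
        rfl⟩

/-- A subplane secant to the line at infinity is represented by a plane. -/
theorem bbSpan_vecPts [Finite F] (hK : Module.finrank F K = 3) {τ : K}
    (hτ : τ ∉ Set.range (algebraMap F K)) {u v w : Fin 3 → K}
    (hu : u 2 = 1) (hv : v 2 = 0) (hw : w 2 = 0) {x y z : Fin 7 → F} (hx : bbInv τ x = u)
    (hy : bbInv τ y = v) (hz : bbInv τ z = w) :
    bbSpan τ (vecPts (Submodule.span F (Set.range ![u, v, w]))) =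
      Submodule.span F (Set.range ![x, y, z]) := by
  have hval : ∀ a b c : F, bbInv τ (a • x + b • y + c • z) = a • u + b • v + c • w := by
    intro a b c
    simp only [map_add, map_smul, hx, hy, hz]
  have h2 : ∀ a b c : F, (a • u + b • v + c • w) 2 = algebraMap F K a := by
    intro a b c
    simp [hu, hv, hw, Algebra.smul_def]
  apply le_antisymm
  · refine iSup₂_le ?_
    rintro _ ⟨⟨m, hm, hm0, rfl⟩, hminf⟩ p hp
    rw [mk_mem_lineAtInfinity] at hminf
    obtain ⟨a, b, c, rfl⟩ := mem_span_range_three.1 hm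
    change (a • u + b • v + c • w) 2 ≠ 0 at hminf
    obtain ⟨k, hk⟩ := mem_bb_mk.1 hp
    change k • (a • u + b • v + c • w) = _ at hk
    have h6 : k * algebraMap F K a = algebraMap F K (p 6) := by
      rw [← h2 a b c, ← bbInv_apply_two τ p, ← hk]
      rfl
    rw [h2] at hminf
    have hp' : p = (p 6 / a) • (a • x + b • y + c • z) := by
      refine bbInv_injective hK hτ ?_
      rw [map_smul, hval, ← hk, ← algebraMap_smul K (p 6 / a), map_div₀, ← h6,
        mul_div_cancel_right₀ _ hminf]
    rw [hp']
    exact Submodule.smul_mem _ _ (mem_span_range_three.2 ⟨a, b, c, rfl⟩)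
  -- Only affine points contribute to the span, so `y` and `z` are obtained as differences of affine
  -- points.
  · have hmem : ∀ b c : F, x + b • y + c • z ∈
        bbSpan τ (vecPts (Submodule.span F (Set.range ![u, v, w]))) := by
      intro b c
      have h3 := h2 1 b c
      rw [map_one] at h3
      have hne : (1 : F) • u + b • v + c • w ≠ 0 := by
        intro h
        rw [h] at h3
        exact zero_ne_one h3
      have hA : Projectivization.mk K _ hne ∈
          vecPts (Submodule.span F (Set.range ![u, v, w])) \ pts (lineAtInfinity K) := by
        refine ⟨⟨_, mem_span_range_three.2 ⟨1, b, c, rfl⟩, hne, rfl⟩, ?_⟩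
        rw [mk_mem_lineAtInfinity, h3]
        exact one_ne_zero
      have hle := le_iSup₂ (f := fun Q (_ : Q ∈ vecPts (Submodule.span F (Set.range ![u, v, w])) \
        pts (lineAtInfinity K)) => bb (F := F) τ Q) _ hA
      refine hle (mem_bb_mk.2 ⟨1, ?_⟩)
      have h4 := hval 1 b c
      rw [one_smul F x] at h4
      rw [one_smul, h4]
    have hx' : x ∈ bbSpan τ (vecPts (Submodule.span F (Set.range ![u, v, w]))) := by
      simpa using hmem 0 0
    rw [Submodule.span_le]
    rintro _ ⟨i, rfl⟩
    fin_cases i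
    · exact hx'
    · exact (Submodule.add_mem_iff_right _ hx').1 (by simpa using hmem 1 0)
    · exact (Submodule.add_mem_iff_right _ hx').1 (by simpa using hmem 0 1)

end NormalForm
end BruckBose

/-! ### The main theorem -/

theorem corollary4p6 {F K : Type*} [Field F] [Finite F] [Field K] [Algebra F K]
    (q : ℕ) (hq : Nat.card F = q) (hK : Module.finrank F K = 3)
    (τ : K) (hτ : IsPrimitiveRoot τ (q ^ 3 - 1))
    (B : Set (PG2 K)) (hB : IsSubplane q B)
    (T : PG2 K) (hT : IsTangentAt B T)
    (P : PG2 K) (hPB : P ∈ B) (hP : P ∉ pts (lineAtInfinity K)) :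
    -- the tangent subspace and the ruled surface of `B` are well defined
    (∃! A, IsTangentSubspace q B T P A) ∧
    (∃ (a : Fin 3 → Fin 7 → F) (c : Fin 4 → Fin 7 → F), IsRuledSurfaceOf τ B T a c) ∧
    -- there are `q` lines of `B` through `P` and not through `T`, with distinct images
    {L | IsLineOf B L ∧ P ∈ pts L ∧ T ∉ pts L}.ncard = q ∧
    Set.InjOn (fun L => bbSet (F := F) τ (B ∩ pts L))
      {L | IsLineOf B L ∧ P ∈ pts L ∧ T ∉ pts L} ∧
    -- each of them corresponds to a special twisted cubic
    (∀ L, IsLineOf B L → P ∈ pts L → T ∉ pts L →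
      ∃ (n : Fin 4 → Fin 7 → F) (U : PG2 K), IsSpecialCubic τ n U ∧
        cubicPts n = bbSet τ (B ∩ pts L)) ∧
    -- there is one line of `B` through `P` and `T`, and it corresponds to a generator line
    (∃! L, IsLineOf B L ∧ P ∈ pts L ∧ T ∈ pts L) ∧
    (∀ L, IsLineOf B L → P ∈ pts L → T ∈ pts L →
      ∀ (a : Fin 3 → Fin 7 → F) (c : Fin 4 → Fin 7 → F), IsRuledSurfaceOf τ B T a c →
        ∃ s t : F, (s, t) ≠ 0 ∧ Module.finrank F (generator a c s t) = 2 ∧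
          bb τ P ≤ generator a c s t ∧
          pts (generator a c s t) \ pts (hyperplaneAtInfinity F) =
            bbSet τ ((B ∩ pts L) \ {T})) ∧
    -- `[P^⊥]` is a plane, and it contains the tangents at `P` to the twisted cubics
    (∀ A, IsTangentSubspace q B T P A →
      Module.finrank F (bbSpan (F := F) τ A) = 3 ∧
      ∀ L, IsLineOf B L → P ∈ pts L → T ∉ pts L →
        ∀ (n : Fin 4 → Fin 7 → F) (U : PG2 K), IsSpecialCubic τ n U →
          cubicPts n = bbSet τ (B ∩ pts L) →
          ∀ s t : F, (s, t) ≠ 0 → bb τ P = Submodule.span F {cubicPt n s t} →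
            Module.finrank F (cubicTangent n s t) = 2 ∧
            cubicTangent n s t ≤ bbSpan τ A) := by
  subst hq
  have hτ' : τ ∉ Set.range (algebraMap F K) := primitiveRoot_notMem_range rfl hτ
  obtain ⟨v, hv, rfl, rfl, rfl, h0, h1, hθ⟩ := exists_normalForm (F := F) hB hT hPB hP
  clear hB hT hPB hP
  set M := Submodule.span F (Set.range v) with hM
  have hm : ∀ i, v i ∈ M := fun i => Submodule.subset_span ⟨i, rfl⟩
  have hcoord : ∀ x y z : K, x • v 0 + y • v 1 + z • v 2 = 0 → x = 0 ∧ y = 0 ∧ z = 0 :=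
    fun x y z h => eq_zero_of_linearIndependent_three hv h
  -- The lines through `P` other than `PT` are `⟨v 0, w y⟩`, one for each `y` in `F`; hence there
  -- are `q` of them.
  let w : F → Fin 3 → K := fun y => algebraMap F K y • v 1 + v 2
  have hw2 : ∀ y, w y 2 = v 2 2 := by
    intro y
    simp [w, h1]
  have hwM : ∀ y, w y ∈ M := by
    intro y
    change algebraMap F K y • v 1 + v 2 ∈ M
    rw [algebraMap_smul]
    exact Submodule.add_mem _ (Submodule.smul_mem _ _ (hm 1)) (hm 2)
  have hli : ∀ y, LinearIndependent K ![v 0, w y] := by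
    intro y
    simpa [w] using linearIndependent_zero_add hv (a := algebraMap F K y) (b := 1) (by simp)
  have hwu : ∀ y, w y - w y 2 • v 0 ≠ 0 := by
    intro y h
    have := LinearIndependent.pair_iff.1 (hli y) (-w y 2) 1 (by rw [← h]; module)
    exact one_ne_zero this.2
  have hwmem : ∀ y y', w y ∈ Submodule.span K {v 0, w y'} → y = y' := by
    intro y y' h
    obtain ⟨k, l, hkl⟩ := Submodule.mem_span_pair.1 h
    obtain ⟨-, e1, e2⟩ := hcoord k (l * algebraMap F K y' - algebraMap F K y) (l - 1) (by
      rw [← sub_eq_zero] at hkl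
      rw [← hkl]
      module)
    rw [sub_eq_zero.1 e2, one_mul] at e1
    exact ((algebraMap F K).injective (sub_eq_zero.1 e1)).symm
  have hT : ∀ y, v 1 ∉ Submodule.span K {v 0, w y} := by
    intro y h
    obtain ⟨k, l, hkl⟩ := Submodule.mem_span_pair.1 h
    obtain ⟨-, e1, e2⟩ := hcoord k (l * algebraMap F K y - 1) l (by
      rw [← sub_eq_zero] at hkl
      rw [← hkl]
      module)
    rw [e2] at e1
    simp at e1
  have hline : ∀ y, IsLineOf (vecPts M) (Submodule.span K {v 0, w y}) := by
    intro y
    simpa [w] using isLineOf_vecPts_span hv (a := y) (b := 1) (by simp)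
  have hclass : ∀ L, IsLineOf (vecPts M) L → v 0 ∈ L → v 1 ∉ L →
      ∃ y, L = Submodule.span K {v 0, w y} := by
    intro L hL hP hTL
    obtain ⟨a, b, hab, rfl⟩ := exists_eq_span_of_isLineOf hv hL hP
    have hb : b ≠ 0 := by
      rintro rfl
      have ha : a ≠ 0 := fun h => hab (by rw [h]; rfl)
      refine hTL (Submodule.mem_span_pair.2 ⟨0, (algebraMap F K a)⁻¹, ?_⟩)
      rw [map_zero, zero_smul, zero_smul, zero_add, add_zero, inv_smul_smul₀ (by simpa using ha)]
    have hb' : algebraMap F K b ≠ 0 := by simpa using hb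
    refine ⟨a / b, eq_span_pair hL.1 (hli _) hP (Submodule.mem_span_pair.2
      ⟨0, (algebraMap F K b)⁻¹, ?_⟩)⟩
    change _ = algebraMap F K (a / b) • v 1 + v 2
    rw [zero_smul, zero_add, smul_add, smul_smul, inv_smul_smul₀ hb', map_div₀, div_eq_inv_mul]
  have hclass' : ∀ L, IsLineOf (vecPts M) L →
      Projectivization.mk K (v 0) (hv.ne_zero 0) ∈ pts L →
      Projectivization.mk K (v 1) (hv.ne_zero 1) ∉ pts L →
      ∃ y, L = Submodule.span K {v 0, w y} := fun L hL hP hTL =>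
    hclass L hL (mk_mem_pts.1 hP) fun h => hTL (mk_mem_pts.2 h)
  have hvT : ∀ L, IsLineOf (vecPts M) L → Projectivization.mk K (v 0) (hv.ne_zero 0) ∈ pts L →
      Projectivization.mk K (v 1) (hv.ne_zero 1) ∈ pts L → L = Submodule.span K {v 0, v 1} := by
    intro L hL hP hTL
    refine eq_span_pair hL.1 ?_ (mk_mem_pts.1 hP) (mk_mem_pts.1 hTL)
    simpa using linearIndependent_zero_add hv (a := 1) (b := 0) (by simp)
  have hlineT : IsLineOf (vecPts M) (Submodule.span K {v 0, v 1}) := by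
    simpa using isLineOf_vecPts_span (F := F) hv (a := 1) (b := 0) (by simp)
  refine ⟨?_, exists_isRuledSurfaceOf hK hτ' hv h0 h1 hθ, ?_, ?_, ?_, ?_, ?_, ?_⟩
  · exact ⟨_, (isTangentSubspace_iff hv h0 h1).2 rfl, fun A hA =>
      (isTangentSubspace_iff hv h0 h1).1 hA⟩
  · have hset : {L | IsLineOf (vecPts M) L ∧ Projectivization.mk K (v 0) (hv.ne_zero 0) ∈ pts L ∧
        Projectivization.mk K (v 1) (hv.ne_zero 1) ∉ pts L} =
        Set.range fun y : F => Submodule.span K {v 0, w y} := by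
      ext L
      constructor
      · rintro ⟨hL, hP, hTL⟩
        obtain ⟨y, rfl⟩ := hclass' L hL hP hTL
        exact ⟨y, rfl⟩
      · rintro ⟨y, rfl⟩
        exact ⟨hline y, mk_mem_pts.2 (Submodule.subset_span (by simp)),
          fun h => hT y (mk_mem_pts.1 h)⟩
    rw [hset, ← Set.image_univ, Set.ncard_image_of_injective, Set.ncard_univ]
    intro y y' hyy'
    have h : Submodule.span K {v 0, w y} = Submodule.span K {v 0, w y'} := hyy'
    exact hwmem y y' (h ▸ Submodule.subset_span (by simp))
  · rintro L ⟨hL, hP, hTL⟩ L' ⟨hL', hP', hTL'⟩ hEq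
    obtain ⟨y, rfl⟩ := hclass' L hL hP hTL
    obtain ⟨y', rfl⟩ := hclass' L' hL' hP' hTL'
    -- The lines are told apart by the affine point `⟨v 0 + w y⟩`, whose last coordinate is `1 + θ ≠
    -- 0`.
    have hs : 1 + v 2 2 ≠ 0 := by
      simpa using add_mul_ne_zero hθ (s := 1) (t := 1) (by simp)
    obtain ⟨ξ, hξ⟩ := exists_bbInv_eq hK hτ' (F := F) (v := (1 + v 2 2)⁻¹ • (v 0 + w y))
      ⟨1, by simp [h0, hw2, hs]⟩
    have hξ0 : ξ ≠ 0 := by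
      rintro rfl
      have := congrFun hξ 2
      simp [h0, hw2, hs] at this
    have hmem : Projectivization.mk F ξ hξ0 ∈
        bbSet τ (vecPts M ∩ pts (Submodule.span K {v 0, w y})) := by
      rw [mk_mem_bbSet hK hτ', Set.mem_inter_iff, mk_mem_vecPts, mk_mem_pts, hξ]
      refine ⟨⟨1 + v 2 2, hs, ?_⟩, ?_⟩
      · rw [smul_inv_smul₀ hs]
        exact Submodule.add_mem _ (hm 0) (hwM y)
      · exact Submodule.smul_mem _ _ (Submodule.mem_span_pair.2 ⟨1, 1, by simp⟩)
    have hEq' : bbSet (F := F) τ (vecPts M ∩ pts (Submodule.span K {v 0, w y})) =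
        bbSet τ (vecPts M ∩ pts (Submodule.span K {v 0, w y'})) := hEq
    rw [hEq', mk_mem_bbSet hK hτ', Set.mem_inter_iff, mk_mem_pts] at hmem
    have h2 := hmem.2
    rw [hξ, Submodule.smul_mem_iff _ (inv_ne_zero hs),
      Submodule.add_mem_iff_right _ (Submodule.subset_span (by simp))] at h2
    rw [hwmem y y' h2]
  · intro L hL hP hTL
    obtain ⟨y, rfl⟩ := hclass' L hL hP hTL
    have hθy : w y 2 ∉ Set.range (algebraMap F K) := by rwa [hw2]
    obtain ⟨c, hc, -, hcp⟩ := exists_isSpecialCubic hK hτ' h0 hθy (hwu y)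
    exact ⟨c, _, hc, cubicPts_eq_bbSet hK hτ' hv (hli y) (hm 0) (hwM y) h0 hθy hcp⟩
  · exact ⟨_, ⟨hlineT, mk_mem_pts.2 (Submodule.subset_span (by simp)),
      mk_mem_pts.2 (Submodule.subset_span (by simp))⟩, fun L ⟨hL, hP, hTL⟩ => hvT L hL hP hTL⟩
  · intro L hL hP hTL a c hac
    rw [hvT L hL hP hTL]
    exact hac.exists_generator hK hτ' hv h0 h1
  · intro A hA
    rw [isTangentSubspace_iff hv h0 h1] at hA
    subst hA
    have hu2 : (v 2 - v 2 2 • v 0) 2 = 0 := by simp [h0]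
    obtain ⟨x0, hx0⟩ := exists_bbInv_eq hK hτ' (F := F) (v := v 0) ⟨1, by simp [h0]⟩
    obtain ⟨x1, hx1⟩ := exists_bbInv_eq hK hτ' (F := F) (v := v 1) ⟨0, by simp [h1]⟩
    obtain ⟨x2, hx2⟩ := exists_bbInv_eq hK hτ' (F := F) (v := v 2 - v 2 2 • v 0)
      ⟨0, by simp [hu2]⟩
    have hlin : ∀ a b c : F, a • x0 + b • x1 + c • x2 = 0 → a = 0 ∧ b = 0 ∧ c = 0 := by
      intro a b c h
      have h3 := congrArg (bbInv τ) h
      rw [map_add, map_add, map_smul, map_smul, map_smul, hx0, hx1, hx2, map_zero,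
        ← algebraMap_smul K a, ← algebraMap_smul K b, ← algebraMap_smul K c] at h3
      obtain ⟨e0, e1, e2⟩ := hcoord (algebraMap F K a - algebraMap F K c * v 2 2)
        (algebraMap F K b) (algebraMap F K c) (by
          rw [← h3]
          module)
      rw [e2, zero_mul, sub_zero] at e0
      exact ⟨by simpa using e0, by simpa using e1, by simpa using e2⟩
    rw [bbSpan_vecPts hK hτ' h0 h1 hu2 hx0 hx1 hx2]
    refine ⟨?_, ?_⟩
    · rw [finrank_span_eq_card, Fintype.card_fin]
      rw [Fintype.linearIndependent_iff]
      intro g hg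
      rw [Fin.sum_univ_three] at hg
      obtain ⟨e0, e1, e2⟩ := hlin (g 0) (g 1) (g 2) hg
      intro i
      fin_cases i <;> assumption
    · intro L hL hP hTL n U hn hset s t hst hPt
      obtain ⟨y, rfl⟩ := hclass' L hL hP hTL
      -- The direction of the tangent is an `F`-combination of the two points at infinity spanning
      -- `[P^⊥]` with `x0`, whatever the line `y`.
      have hxw : bbInv τ (y • x1 + x2) = w y - w y 2 • v 0 := by
        rw [map_add, map_smul, hx1, hx2, hw2, ← algebraMap_smul K y]
        change _ = algebraMap F K y • v 1 + v 2 - _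
        abel
      rw [hn.cubicTangent_eq hK hτ' hv (hli y) (hm 0) (hwM y) h0 hset.subset hst hPt hx0 hxw]
      constructor
      · have hli2 : LinearIndependent F ![x0, y • x1 + x2] := by
          rw [LinearIndependent.pair_iff]
          intro a b hab
          obtain ⟨e0, -, e2⟩ := hlin a (b * y) b (by
            rw [← hab]
            module)
          exact ⟨e0, e2⟩
        have := finrank_span_eq_card hli2
        rwa [range_pair, Fintype.card_fin] at this
      · rw [Submodule.span_le]
        rintro z (rfl | rfl)
        · exact Submodule.subset_span ⟨0, rfl⟩
        · exact mem_span_range_three.2 ⟨0, y, 1, by simp⟩
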